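/- Let $\lambda>0$, $v(x)=1/|x|$ on $\mathbb{R}^3$, and for $\alpha>0$ let $\overline v_\alpha=\operatorname{sgn}(v)\min\{|v|,\alpha^{-1}\}$. For a pair potential $w$ put $$V_w(x,y,z)=\lambda\bigl(w(x-y)w(x-z)+w(y-z)w(y-x)+w(z-x)w(z-y)\bigr),$$ and let $V=V_v$, $\overline V_\alpha=V_{\overline v_\alpha}$. For $W\in\{V,\overline V_\alpha\}$ consider the quintic Hartree equation $$\mathrm{i}\partial_t u_t=-\Delta u_t+\tfrac12\Bigl(\int W(x,y,z)\,|u_t(y)|^2|u_t(z)|^2\,\mathrm{d}y\,\mathrm{d}z\Bigr)u_t ,$$ whose solutions are understood as curves $u\in C(\mathbb{R};H^1(\mathbb{R}^3))$ satisfying the equation, at every time, in the sense of distributions on $\mathbb{R}^3$. Let $M>0$ and let $a\in[0,1/2)$ or $a>1$. Set $$r(\eta)=\frac{1-\eta(1+2a)}2\ \text{ if } 0\le a<\tfrac12,\qquad r(\eta)=\frac{1-3\eta}2\ \text{ if } a>1 .$$ There are constants $C,K$, depending only on $\lambda$, $a$ and $M$, such that the following holds for every $\varphi_0\in H^{3/2+a}(\mathbb{R}^3)$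 with $\|\varphi_0\|_{H^{3/2+a}}\le M$, every $\eta\in\mathbb{R}$, every integer $N\ge1$ and every cut-off $\alpha=\alpha_N$ with $0<\alpha_N\le N^{-\eta}$. If $\varphi_t$ and $\phi_t$ are the solutions of the quintic Hartree equation with the potentials $V$ and $\overline V_{\alpha_N}$, respectively, and with the same initial datum $\varphi_{t=0}=\phi_{t=0}=\varphi_0$, then for all $t\in\mathbb{R}$ $$\|\varphi_t-\phi_t\|_{L^2}\le C\,N^{r(\eta)}e^{K|t|},$$ and, if $\|\varphi_0\|_{L^2}=1$, then for all $t\in\mathbb{R}$ and all $k\in\mathbb{N}$ $$\operatorname{Tr}\Bigl|\,|\varphi_t\rangle\langle\varphi_t|^{\otimes k}-|\phi_t\rangle\langle\phi_t|^{\otimes k}\Bigr|\le C\,k\,N^{r(\eta)}e^{K|t|}.$$ -/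

import Mathlib

open MeasureTheory Filter Topology
open scoped ENNReal SchwartzMap FourierTransform Laplacian

noncomputable section

namespace QuinticHartree

/-- Physical space `ℝ³`. -/
abbrev R3 : Type := EuclideanSpace ℝ (Fin 3)

/-- The one-particle Hilbert space `L²(ℝ³; ℂ)`. -/
abbrev L2 : Type := Lp ℂ 2 (volume : Measure R3)

/-- The `k`-particle Hilbert space `L²((ℝ³)ᵏ; ℂ)`. -/
abbrev L2k (k : ℕ) : Type := Lp ℂ 2 (volume : Measure (Fin k → R3))

/-! ### Sobolev spaces -/

/-- `f ∈ Hˢ(ℝ³)`, for `f ∈ L²(ℝ³)`. -/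
def MemH (s : ℝ) (f : L2) : Prop :=
  TemperedDistribution.MemSobolev s 2 (f : 𝓢'(R3, ℂ))

/-- The norm `‖f‖_{Hˢ} = ‖(1 - Δ)^{s/2} f‖_{L²}`, computed on the Fourier side and with values in
`[0, ∞]`; with Mathlib's normalisation of the Fourier transform, `-Δ` is the multiplication
by `(2π|ξ|)²`. -/
def sobolevNorm (s : ℝ) (f : L2) : ℝ≥0∞ :=
  eLpNorm (fun ξ : R3 => (((1 + (2 * Real.pi * ‖ξ‖) ^ 2) ^ (s / 2) : ℝ) : ℂ) * (𝓕 f : L2) ξ) 2 volume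

/-! ### The interaction potentials -/

/-- The Coulomb potential `v(x) = 1/|x|`. -/
def coulomb (x : R3) : ℝ := 1 / ‖x‖

/-- The cut-off potential `v̄(x) = sgn(v(x)) min{|v(x)|, α⁻¹}`. -/
def cutCoulomb (α : ℝ) (x : R3) : ℝ :=
  Real.sign (coulomb x) * min |coulomb x| α⁻¹

/-- The three-body potential
`λ (w(x-y) w(x-z) + w(y-z) w(y-x) + w(z-x) w(z-y))` built from a pair potential `w`. -/
def threeBody (lam : ℝ) (w : R3 → ℝ) (x y z : R3) : ℝ :=
  lam * (w (x - y) * w (x - z) + w (y - z) * w (y - x) + w (z - x) * w (z - y))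

/-- The mean-field potential `x ↦ ∫ V(x,y,z) |f(y)|² |f(z)|² dy dz`. -/
def meanField (V : R3 → R3 → R3 → ℝ) (f : L2) (x : R3) : ℝ :=
  ∫ p : R3 × R3, V x p.1 p.2 * ‖f p.1‖ ^ 2 * ‖f p.2‖ ^ 2

/-! ### The quintic Hartree equation -/

/-- `u` is the (global, finite-energy) solution with initial datum `u₀` of
`i ∂ₜ u = -Δ u + (1/2) (∫ V(x,y,z) |u(y)|² |u(z)|² dy dz) u`:
`u` is a continuous curve in `H¹(ℝ³)` with `u(0) = u₀`, and the equation holds at every time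
in the sense of tempered distributions on `ℝ³`. -/
structure IsHartreeSolution (V : R3 → R3 → R3 → ℝ) (u₀ : L2) (u : ℝ → L2) : Prop where
  memH : ∀ t, MemH 1 (u t)
  continuous : ∀ t₀, Tendsto (fun t => sobolevNorm 1 (u t - u t₀)) (𝓝 t₀) (𝓝 0)
  initial : u 0 = u₀
  equation : ∀ (χ : 𝓢(R3, ℂ)) (t : ℝ), ∃ d : ℂ,
    HasDerivAt (fun s => ∫ x, χ x * u s x) d t ∧
    Complex.I * d = -(∫ x, (Δ χ) x * u t x)
      + ∫ x, χ x * ((1 / 2 : ℂ) * (meanField V (u t) x : ℂ) * u t x)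

/-! ### Tensor powers, projections, trace norm -/

theorem memLp_tensorPower (f : L2) (k : ℕ) :
    MemLp (fun x : Fin k → R3 => ∏ i, f (x i)) 2 volume := by
  have hm : AEStronglyMeasurable (fun x : Fin k → R3 => ∏ i, f (x i)) volume :=
    Finset.aestronglyMeasurable_fun_prod _ fun i _ =>
      (Lp.aestronglyMeasurable f).comp_quasiMeasurePreserving
        (Measure.quasiMeasurePreserving_eval (fun _ => (volume : Measure R3)) i)
  rw [memLp_two_iff_integrable_sq_norm hm]
  have h := (memLp_two_iff_integrable_sq_norm (Lp.aestronglyMeasurable f)).1 (Lp.memLp f)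
  have h2 := Integrable.fintype_prod (ι := Fin k) (μ := fun _ => (volume : Measure R3))
    (f := fun _ x => ‖f x‖ ^ 2) (fun _ => h)
  simpa [norm_prod, Finset.prod_pow, volume_pi] using h2

/-- The tensor power `f^{⊗k}(x₁, …, x_k) = f(x₁) ⋯ f(x_k)`. -/
def tensorPower (f : L2) (k : ℕ) : L2k k := (memLp_tensorPower f k).toLp _

/-- `|f⟩⟨f|^{⊗k}`, which acts on `L²(ℝ³)^{⊗k} = L²((ℝ³)ᵏ)` as `|f^{⊗k}⟩⟨f^{⊗k}|`. -/
def projTensor (f : L2) (k : ℕ) : L2k k →L[ℂ] L2k k :=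
  InnerProductSpace.rankOne ℂ (tensorPower f k) (tensorPower f k)

/-- `Tr |T| ∈ [0, ∞]` with `|T| = (T* T)^{1/2}`: the sum of the diagonal entries of the positive
operator `|T|` in an orthonormal (Hilbert) basis (its value does not depend on the basis). -/
def traceNorm {H : Type*} [NormedAddCommGroup H] [InnerProductSpace ℂ H] [CompleteSpace H]
    (T : H →L[ℂ] H) : ℝ≥0∞ :=
  let b := (exists_hilbertBasis ℂ H).choose_spec.choose
  ∑' i, ENNReal.ofReal (RCLike.re (inner ℂ (b i) (CFC.abs T (b i))))

end QuinticHartree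

end

/-! The cut-off changes the pair potential only on the ball of radius α, and both flows stay in a
ball of H¹ whose radius is independent of α. The comparison is then a Gronwall argument in L²
(`norm_sub_le_of_solutions`). With F and F_α the two nonlinearities, F(φ) - F_α(ϕ) splits into the
error F(φ) - F_α(φ), of size α^{3/2}, and the increment F_α(φ) - F_α(ϕ), which is Lipschitz for the
L² distance on balls of H¹ (`norm_nonlin_sub_le`).

The error bound is `norm_nonlin_sub_cut_sq_le`. Cauchy–Schwarz separates the singularity from the
localisation: Hardy's inequality controls |x|⁻² against |f|², and what remains is the mass of pairs
of points at distance less than α, which is O(α³) on balls of H¹ (`lintegral_pairs_le`). Both facts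
come from one integration by parts inequality, `integral_normSq_mul_lineDeriv_le`, applied to vector
fields with a well-chosen divergence.

The H¹ bound follows from conservation of mass and energy, since the interaction is nonnegative. For
a distributional H¹ solution the energy cannot be differentiated directly. Removing the free
evolution first makes the equation hold in L² (`hasDerivAt_prop_fourier`). Then Re⟨u(s), i u(s+h)⟩
is differentiated in s, where the Laplacian cancels exactly, and h tends to 0 after division by h
(`IsHartreeSolution.energy_eq`).

As for the rate, r(η) = 1/2 - pη with p = 1/2 + a or p = 3/2. For α ≤ 1, α^{3/2} ≤ α^p; for α ≥ 1
conservation of mass suffices; and α^p ≤ N^{-pη} ≤ N^{r(η)}. The trace norm of a difference of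
projections is controlled by the overlap of the two vectors, and Bernoulli's inequality makes the
dependence on k linear (`traceNorm_projTensor_sub`). -/

noncomputable section

namespace QuinticHartree

/-! ### Trace norm of a difference of two rank-one projections -/

section TraceNorm

variable {H : Type*} [NormedAddCommGroup H] [InnerProductSpace ℂ H]

/-- This is the trace of T² in an arbitrary Hilbert basis: T² expands into four rank-one terms, and
Parseval sums each of them. -/
theorem hasSum_inner_sq_sub_rankOne {ι : Type*} (b : HilbertBasis ι ℂ H) {F G : H}
    (hF : ‖F‖ = 1) (hG : ‖G‖ = 1) {T : H →L[ℂ] H}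
    (hT : T = InnerProductSpace.rankOne ℂ F F - InnerProductSpace.rankOne ℂ G G) :
    HasSum (fun i => inner ℂ (b i) (T (T (b i)))) (2 - 2 * (‖inner ℂ F G‖ ^ 2 : ℝ) : ℂ) := by
  have hFF : inner ℂ F F = (1 : ℂ) := by simp [inner_self_eq_norm_sq_to_K, hF]
  have hGG : inner ℂ G G = (1 : ℂ) := by simp [inner_self_eq_norm_sq_to_K, hG]
  have h1 := b.hasSum_inner_mul_inner F F
  have h2 := b.hasSum_inner_mul_inner G G
  have h3 := (b.hasSum_inner_mul_inner F G).mul_left (inner ℂ G F)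
  have h4 := (b.hasSum_inner_mul_inner G F).mul_left (inner ℂ F G)
  have h := ((h1.add h2).sub h3).sub h4
  have hc : (‖inner ℂ F G‖ ^ 2 : ℝ) = inner ℂ F G * inner ℂ G F := by
    rw [← inner_conj_symm G F, Complex.mul_conj, Complex.normSq_eq_norm_sq]
  have hv : (2 - 2 * (‖inner ℂ F G‖ ^ 2 : ℝ) : ℂ) = inner ℂ F F + inner ℂ G G -
      inner ℂ G F * inner ℂ F G - inner ℂ F G * inner ℂ G F := by
    rw [hFF, hGG, hc]; ring
  rw [hv]
  refine (congrArg (fun u => HasSum u _) (funext fun i => ?_)).mpr h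
  · simp only [hT, sub_apply, InnerProductSpace.rankOne_apply, map_sub,
      map_smul, inner_sub_right, inner_smul_right, hFF, hGG]
    ring

/-- The only possible nonzero eigenvalues of T are ±s with s = √(1 - |⟨F,G⟩|²). Hence T³ = s²T and
|T| = s⁻¹T², whose trace is s⁻¹ · 2s² = 2s. The cubic identity replaces a diagonalisation. -/
theorem traceNorm_rankOne_sub_rankOne [CompleteSpace H] {F G : H} (hF : ‖F‖ = 1) (hG : ‖G‖ = 1) :
    traceNorm (InnerProductSpace.rankOne ℂ F F - InnerProductSpace.rankOne ℂ G G) ≤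
      ENNReal.ofReal (2 * √(1 - ‖inner ℂ F G‖ ^ 2)) := by
  set T := InnerProductSpace.rankOne ℂ F F - InnerProductSpace.rankOne ℂ G G with hT
  have hFF : inner ℂ F F = (1 : ℂ) := by simp [inner_self_eq_norm_sq_to_K, hF]
  have hGG : inner ℂ G G = (1 : ℂ) := by simp [inner_self_eq_norm_sq_to_K, hG]
  have hc : (‖inner ℂ F G‖ ^ 2 : ℝ) = inner ℂ F G * inner ℂ G F := by
    rw [← inner_conj_symm G F, Complex.mul_conj, Complex.normSq_eq_norm_sq]
  set s := √(1 - ‖inner ℂ F G‖ ^ 2) with hs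
  have hle : ‖inner ℂ F G‖ ^ 2 ≤ 1 := by
    have := norm_inner_le_norm (𝕜 := ℂ) F G
    rw [hF, hG] at this
    nlinarith [norm_nonneg (inner ℂ F G)]
  have hs2 : s ^ 2 = 1 - ‖inner ℂ F G‖ ^ 2 := Real.sq_sqrt (by linarith)
  have hs0 : 0 ≤ s := Real.sqrt_nonneg _
  have hsa : IsSelfAdjoint T := by
    rw [ContinuousLinearMap.isSelfAdjoint_iff', hT, map_sub, InnerProductSpace.adjoint_rankOne,
      InnerProductSpace.adjoint_rankOne]
  have hstar : star T = T := hsa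
  have hcube : T * T * T = s ^ 2 • T := by
    ext x
    have e1 : T F = F - inner ℂ G F • G := by
      simp [hT, hF]
    have e2 : T G = inner ℂ F G • F - G := by
      simp [hT, hG]
    have hx : T x = inner ℂ F x • F - inner ℂ G x • G := by simp [hT]
    have e3 : T (T F) = (s ^ 2 : ℝ) • F := by
      rw [e1, map_sub, map_smul, e1, e2, hs2, ← Complex.coe_smul]
      push_cast [hc]
      module
    have e4 : T (T G) = (s ^ 2 : ℝ) • G := by
      rw [e2, map_sub, map_smul, e1, e2, hs2, ← Complex.coe_smul]
      push_cast [hc]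
      module
    simp only [mul_apply_eq_comp, smul_apply]
    rw [hx, map_sub, map_sub, map_smul, map_smul, map_smul, map_smul, e3, e4, smul_sub,
      smul_comm, smul_comm (inner ℂ G x)]
  have hTT : 0 ≤ T * T := by
    have := star_mul_self_nonneg T
    rwa [hstar] at this
  rcases hs0.eq_or_lt with h0 | hpos
  -- Here s⁻¹ is not available, but T³ = 0 and self-adjointness force T = 0 by two uses of the
  -- C*-identity.
  · have hT0 : T = 0 := by
      rw [← h0] at hcube
      have h4 : (T * T) * (T * T) = 0 := by
        rw [← mul_assoc, hcube]; simp
      have h5 : T * T = 0 := by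
        have hst : star (T * T) = T * T := by rw [star_mul, hstar]
        rw [← CStarRing.star_mul_self_eq_zero_iff, hst, h4]
      rw [← CStarRing.star_mul_self_eq_zero_iff, hstar, h5]
    rw [hT0]
    simp [traceNorm]
  -- By uniqueness of the positive square root it suffices that s⁻¹T² is nonnegative and that s⁻²T⁴
  -- = T², which is the cubic identity.
  · have habs : CFC.abs T = s⁻¹ • (T * T) := by
      rw [CFC.abs, CFC.sqrt_eq_iff (star T * T) _ (star_mul_self_nonneg T)
        (smul_nonneg (inv_nonneg.2 hs0) hTT), hstar, smul_mul_smul_comm,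
        show T * T * (T * T) = T * T * T * T from by noncomm_ring, hcube, smul_mul_assoc, smul_smul]
      rw [show s⁻¹ * s⁻¹ * s ^ 2 = 1 by field_simp, one_smul]
    unfold traceNorm
    simp only
    set b := (exists_hilbertBasis ℂ H).choose_spec.choose
    have hsum := (hasSum_inner_sq_sub_rankOne b hF hG hT)
    have hre : HasSum (fun i => RCLike.re (inner ℂ (b i) (CFC.abs T (b i)))) (2 * s) := by
      have h1 := (Complex.hasSum_re hsum).mul_left s⁻¹
      have hv : s⁻¹ * (2 - 2 * (‖inner ℂ F G‖ ^ 2 : ℝ) : ℂ).re = 2 * s := by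
        have : ((2 - 2 * (‖inner ℂ F G‖ ^ 2 : ℝ) : ℂ)).re = 2 * s ^ 2 := by
          rw [hs2]
          have : (2 - 2 * (‖inner ℂ F G‖ ^ 2 : ℝ) : ℂ) =
            ((2 - 2 * ‖inner ℂ F G‖ ^ 2 : ℝ) : ℂ) := by push_cast; ring
          rw [this, Complex.ofReal_re]; ring
        rw [this]; field_simp
      rw [hv] at h1
      refine (congrArg (fun u => HasSum u _) (funext fun i => ?_)).mpr h1
      rw [habs, smul_apply, mul_apply_eq_comp, ← Complex.coe_smul, inner_smul_right]
      simp
    rw [← ENNReal.ofReal_tsum_of_nonneg _ hre.summable, hre.tsum_eq]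
    intro i
    have hp : (0 : H →L[ℂ] H) ≤ CFC.abs T := CFC.abs_nonneg T
    rw [ContinuousLinearMap.nonneg_iff_isPositive] at hp
    exact hp.re_inner_nonneg_right _

end TraceNorm

/-! ### Overlaps of tensor powers -/

theorem inner_tensorPower (f g : L2) (k : ℕ) :
    inner ℂ (tensorPower f k) (tensorPower g k) = (inner ℂ f g) ^ k := by
  rw [MeasureTheory.L2.inner_def, MeasureTheory.L2.inner_def]
  have h : (fun x => inner ℂ (tensorPower f k x) (tensorPower g k x)) =ᵐ[volume]
      fun x : Fin k → R3 => ∏ i, inner ℂ (f (x i)) (g (x i)) := by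
    filter_upwards [(memLp_tensorPower f k).coeFn_toLp, (memLp_tensorPower g k).coeFn_toLp]
      with x hx hy
    rw [tensorPower, tensorPower, hx, hy]
    simp [Finset.prod_mul_distrib, map_prod]
  rw [integral_congr_ae h]
  have := integral_fintype_prod_eq_prod (𝕜 := ℂ) (ι := Fin k) (μ := fun _ => (volume : Measure R3))
    (fun _ x => inner ℂ (f x) (g x))
  rw [volume_pi, this]
  simp

theorem norm_tensorPower {f : L2} (hf : ‖f‖ = 1) (k : ℕ) : ‖tensorPower f k‖ = 1 := by
  have h := inner_tensorPower f f k
  rw [inner_self_eq_norm_sq_to_K, inner_self_eq_norm_sq_to_K, hf] at h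
  have h2 : (‖tensorPower f k‖ ^ 2 : ℝ) = 1 := by
    have : ((‖tensorPower f k‖ ^ 2 : ℝ) : ℂ) = 1 := by simpa using h
    exact_mod_cast this
  nlinarith [norm_nonneg (tensorPower f k)]

/-- With c = |⟨f,g⟩| the tensor powers have overlap c^k. Bernoulli gives 1 - c^{2k} ≤ k(1 - c²), and
1 - c² ≤ ‖f - g‖² for unit vectors. Enlarging k to k² makes the square root a multiple of k. -/
theorem traceNorm_projTensor_sub {f g : L2} (hf : ‖f‖ = 1) (hg : ‖g‖ = 1) (k : ℕ) :
    traceNorm (projTensor f k - projTensor g k) ≤ ENNReal.ofReal (2 * k * ‖f - g‖) := by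
  refine (traceNorm_rankOne_sub_rankOne (norm_tensorPower hf k) (norm_tensorPower hg k)).trans ?_
  apply ENNReal.ofReal_le_ofReal
  rw [inner_tensorPower, norm_pow, mul_assoc]
  refine mul_le_mul_of_nonneg_left (Real.sqrt_le_iff.2 ⟨by positivity, ?_⟩) zero_le_two
  set c := ‖inner ℂ f g‖ with hc
  have hc0 : 0 ≤ c := norm_nonneg _
  have h1 : 1 - c ^ 2 ≤ ‖f - g‖ ^ 2 := by
    have h := norm_sub_sq (𝕜 := ℂ) f g
    have h2 : RCLike.re (inner ℂ f g) ≤ c := RCLike.re_le_norm _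
    rw [hf, hg] at h
    nlinarith [sq_nonneg (1 - c)]
  have h2 : 1 - (c ^ k) ^ 2 ≤ k * (1 - c ^ 2) := by
    have := one_add_mul_le_pow (a := c ^ 2 - 1) (by nlinarith [sq_nonneg c]) k
    rw [← pow_mul, mul_comm k 2, pow_mul]
    rw [add_sub_cancel] at this
    linarith
  rcases Nat.eq_zero_or_pos k with rfl | hk
  · simp
  have hk1 : (1 : ℝ) ≤ k := by exact_mod_cast hk
  calc 1 - (c ^ k) ^ 2 ≤ k * (1 - c ^ 2) := h2
    _ ≤ k * ‖f - g‖ ^ 2 := by gcongr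
    _ ≤ k ^ 2 * ‖f - g‖ ^ 2 := by gcongr; nlinarith
    _ = _ := by ring

/-! ### Inequalities for functions with controlled translations -/

section Translations

theorem integrable_normSq {f : R3 → ℂ} (hf : MemLp f 2 volume) :
    Integrable (fun x => ‖f x‖ ^ 2) volume :=
  (memLp_two_iff_integrable_sq_norm hf.1).1 hf

/-- The derivative is given at parameter 0 only, but at every base point; moving the base point
yields it along the whole line, and the mean value inequality applies. -/
theorem abs_sub_le_of_hasLineDeriv {e : R3} {Y Y' : R3 → ℝ} {L : ℝ}
    (hd : ∀ x, HasDerivAt (fun s : ℝ => Y (x + s • e)) (Y' x) 0) (hL : ∀ x, |Y' x| ≤ L)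
    (x : R3) (s : ℝ) : |Y (x + s • e) - Y x| ≤ L * |s| := by
  have hd' : ∀ r : ℝ, HasDerivAt (fun s : ℝ => Y (x + s • e)) (Y' (x + r • e)) r := by
    intro r
    have h := hd (x + r • e)
    have h2 : HasDerivAt (fun s : ℝ => Y (x + r • e + (s - r) • e)) (Y' (x + r • e)) r := by
      have := HasDerivAt.comp_sub_const (f := fun s : ℝ => Y (x + r • e + s • e)) r r
        (by simpa using h)
      simpa using this
    refine h2.congr_of_eventuallyEq (Eventually.of_forall fun s => ?_)
    simp only
    rw [add_assoc, ← add_smul, add_sub_cancel]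
  have := (convex_univ : Convex ℝ (Set.univ : Set ℝ)).norm_image_sub_le_of_norm_hasDerivWithin_le
    (f := fun s : ℝ => Y (x + s • e)) (f' := fun r => Y' (x + r • e)) (C := L) (x := 0) (y := s)
    (fun r _ => (hd' r).hasDerivWithinAt) (fun r _ => hL _) trivial trivial
  simpa using this

/-- An integration by parts inequality, with difference quotients in place of derivatives. -/
theorem integral_normSq_mul_lineDeriv_le {f : R3 → ℂ} (hf : MemLp f 2 volume) {D : ℝ}
    (hD : ∀ a, ∫ x, ‖f (x + a) - f x‖ ^ 2 ≤ D ^ 2 * ‖a‖ ^ 2)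
    {e : R3} (he : ‖e‖ = 1) {Y Y' : R3 → ℝ} {B L c : ℝ} (hc : 0 < c)
    (hYm : Measurable Y) (hB : ∀ x, |Y x| ≤ B)
    (hd : ∀ x, HasDerivAt (fun s : ℝ => Y (x + s • e)) (Y' x) 0) (hL : ∀ x, |Y' x| ≤ L) :
    ∫ x, ‖f x‖ ^ 2 * Y' x ≤ c * D ^ 2 + c⁻¹ * ∫ x, ‖f x‖ ^ 2 * Y x ^ 2 := by
  have hρ := integrable_normSq hf
  have hB0 : 0 ≤ B := (abs_nonneg _).trans (hB 0)
  have hY2 : ∀ x, Y x ^ 2 ≤ B ^ 2 := fun x => by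
    rw [← sq_abs]; exact pow_le_pow_left₀ (abs_nonneg _) (hB x) 2
  have hshift : ∀ a : R3, Measurable fun x => Y (x + a) := fun a =>
    hYm.comp (measurable_id.add_const a)
  have hi1 : ∀ a : R3, Integrable (fun x => ‖f x‖ ^ 2 * Y (x + a)) := fun a =>
    hρ.mul_bdd (c := B) (hshift a).aestronglyMeasurable
      (Eventually.of_forall fun x => by simpa using hB (x + a))
  have hi2 : ∀ a : R3, Integrable (fun x => ‖f x‖ ^ 2 * Y (x + a) ^ 2) := fun a =>
    hρ.mul_bdd (c := B ^ 2) ((hshift a).pow_const 2).aestronglyMeasurable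
      (Eventually.of_forall fun x => by simpa using hY2 (x + a))
  have hlip := abs_sub_le_of_hasLineDeriv hd hL
  have hcont : ∀ x, Tendsto (fun s : ℝ => Y (x + s • e)) (𝓝[>] 0) (𝓝 (Y x)) := by
    intro x
    have := (hd x).continuousAt.tendsto
    simp only [zero_smul, add_zero] at this
    exact this.mono_left nhdsWithin_le_nhds
  have hfa : ∀ a : R3, MemLp (fun x => f (x + a)) 2 volume := fun a =>
    hf.comp_measurePreserving (measurePreserving_add_right volume a)
  -- For difference quotients, integration by parts is a translation of the integral, so only the L²
  -- modulus of continuity of f enters. The two terms in Y² merge as s tends to 0.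
  have key : ∀ s : ℝ, 0 < s →
      ∫ x, ‖f x‖ ^ 2 * ((Y (x + s • e) - Y x) / s) ≤
        c * D ^ 2 + (2 * c)⁻¹ * (∫ x, ‖f x‖ ^ 2 * Y (x + s • e) ^ 2) +
          (2 * c)⁻¹ * ∫ x, ‖f x‖ ^ 2 * Y x ^ 2 := by
    intro s hs
    set a : R3 := s • e
    have hna : ‖a‖ = s := by rw [norm_smul, he, mul_one, Real.norm_eq_abs, abs_of_pos hs]
    have hY0 : Integrable (fun x => ‖f x‖ ^ 2 * Y x) := by simpa using hi1 0
    have hY20 : Integrable (fun x => ‖f x‖ ^ 2 * Y x ^ 2) := by simpa using hi2 0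
    have e1 : ∫ x, ‖f x‖ ^ 2 * ((Y (x + a) - Y x) / s) =
        s⁻¹ * ∫ x, (‖f x‖ ^ 2 - ‖f (x + a)‖ ^ 2) * Y (x + a) := by
      have hsh : ∫ x, ‖f (x + a)‖ ^ 2 * Y (x + a) = ∫ x, ‖f x‖ ^ 2 * Y x :=
        integral_add_right_eq_self (fun x => ‖f x‖ ^ 2 * Y x) a
      have hsi : Integrable (fun x => ‖f (x + a)‖ ^ 2 * Y (x + a)) :=
        hY0.comp_add_right a
      have l1 : ∫ x, (‖f x‖ ^ 2 - ‖f (x + a)‖ ^ 2) * Y (x + a) =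
          (∫ x, ‖f x‖ ^ 2 * Y (x + a)) - ∫ x, ‖f x‖ ^ 2 * Y x := by
        rw [← hsh, ← integral_sub (hi1 a) hsi]
        exact integral_congr_ae (Eventually.of_forall fun x => by simp only; ring)
      rw [l1, ← integral_sub (hi1 a) hY0, ← integral_const_mul]
      exact integral_congr_ae (Eventually.of_forall fun x => by simp only; field_simp)
    have hdi : Integrable (fun x => ‖f (x + a) - f x‖ ^ 2) :=
      integrable_normSq (f := fun x => f (x + a) - f x) ((hfa a).sub hf)
    have hsi2 : Integrable (fun x => ‖f (x + a)‖ ^ 2 * Y (x + a) ^ 2) :=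
      hY20.comp_add_right a
    have hsh2 : ∫ x, ‖f (x + a)‖ ^ 2 * Y (x + a) ^ 2 = ∫ x, ‖f x‖ ^ 2 * Y x ^ 2 :=
      integral_add_right_eq_self (fun x => ‖f x‖ ^ 2 * Y x ^ 2) a
    have e2 : ∫ x, (‖f x‖ ^ 2 - ‖f (x + a)‖ ^ 2) * Y (x + a) ≤
        ∫ x, (c / s * ‖f (x + a) - f x‖ ^ 2 + s / (2 * c) * (‖f x‖ ^ 2 * Y (x + a) ^ 2) +
          s / (2 * c) * (‖f (x + a)‖ ^ 2 * Y (x + a) ^ 2)) := by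
      refine integral_mono ?_ (((hdi.const_mul _).add ((hi2 a).const_mul _)).add
        (hsi2.const_mul _)) fun x => ?_
      · have : Integrable (fun x => ‖f x‖ ^ 2 * Y (x + a) - ‖f (x + a)‖ ^ 2 * Y (x + a)) :=
          (hi1 a).sub (hY0.comp_add_right a)
        exact this.congr (Eventually.of_forall fun x => by simp only; ring)
      · simp only
        set p := ‖f x‖
        set q := ‖f (x + a)‖
        set d := ‖f (x + a) - f x‖
        set y := Y (x + a)
        have hpq : |p - q| ≤ d := by
          have := abs_norm_sub_norm_le (f x) (f (x + a))
          rwa [norm_sub_rev] at this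
        have hp : 0 ≤ p := norm_nonneg _
        have hq : 0 ≤ q := norm_nonneg _
        have hd0 : 0 ≤ d := norm_nonneg _
        have h1 : (p ^ 2 - q ^ 2) * y ≤ d * (p * |y|) + d * (q * |y|) := by
          calc (p ^ 2 - q ^ 2) * y ≤ |(p ^ 2 - q ^ 2) * y| := le_abs_self _
            _ = |p - q| * ((p + q) * |y|) := by
                rw [show (p ^ 2 - q ^ 2) * y = (p - q) * ((p + q) * y) by ring, abs_mul, abs_mul,
                  abs_of_nonneg (add_nonneg hp hq)]
            _ ≤ d * ((p + q) * |y|) := by gcongr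
            _ = _ := by ring
        -- The weights are such that, after division by s, the bound D²s² on the increment of f
        -- leaves cD² with no power of s.
        have amgm : ∀ u v : ℝ, u * v ≤ c / s / 2 * u ^ 2 + s / (2 * c) * v ^ 2 := by
          intro u v
          have h : 0 ≤ (c * u - s * v) ^ 2 / (2 * c * s) := by positivity
          have : (c * u - s * v) ^ 2 / (2 * c * s) =
            c / s / 2 * u ^ 2 + s / (2 * c) * v ^ 2 - u * v := by field_simp; ring
          linarith
        have h2 := amgm d (p * |y|)
        have h3 := amgm d (q * |y|)
        rw [mul_pow, sq_abs] at h2 h3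
        linarith
    have hI1 : Integrable (fun x => c / s * ‖f (x + a) - f x‖ ^ 2 +
        s / (2 * c) * (‖f x‖ ^ 2 * Y (x + a) ^ 2)) :=
      (hdi.const_mul _).add ((hi2 a).const_mul _)
    rw [integral_add hI1 (hsi2.const_mul _), integral_add (hdi.const_mul _) ((hi2 a).const_mul _),
      integral_const_mul, integral_const_mul, integral_const_mul, hsh2] at e2
    rw [e1]
    have hDa := hD a
    rw [hna] at hDa
    have h4 : c / s * ∫ x, ‖f (x + a) - f x‖ ^ 2 ≤ c / s * (D ^ 2 * s ^ 2) := by gcongr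
    calc _ ≤ s⁻¹ * (c / s * (D ^ 2 * s ^ 2) + s / (2 * c) * (∫ x, ‖f x‖ ^ 2 * Y (x + a) ^ 2) +
          s / (2 * c) * ∫ x, ‖f x‖ ^ 2 * Y x ^ 2) := by gcongr; linarith
      _ = _ := by field_simp
  have lim1 : Tendsto (fun s : ℝ => ∫ x, ‖f x‖ ^ 2 * ((Y (x + s • e) - Y x) / s)) (𝓝[>] 0)
      (𝓝 (∫ x, ‖f x‖ ^ 2 * Y' x)) := by
    refine tendsto_integral_filter_of_dominated_convergence (fun x => ‖f x‖ ^ 2 * L) ?_ ?_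
      (hρ.mul_const L) ?_
    · exact Eventually.of_forall fun s => hρ.aestronglyMeasurable.mul
        (((hshift _).sub hYm).div_const s).aestronglyMeasurable
    · filter_upwards [self_mem_nhdsWithin] with s (hs : 0 < s)
      refine Eventually.of_forall fun x => ?_
      rw [norm_mul, norm_pow, norm_norm, norm_div, Real.norm_eq_abs, Real.norm_eq_abs]
      refine mul_le_mul_of_nonneg_left ?_ (by positivity)
      rw [div_le_iff₀ (abs_pos.2 hs.ne')]
      exact hlip x s
    · refine Eventually.of_forall fun x => ?_
      refine Tendsto.const_mul _ ?_
      have := (hd x).tendsto_slope_zero_right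
      simpa [div_eq_inv_mul] using this
  have lim2 : Tendsto (fun s : ℝ => ∫ x, ‖f x‖ ^ 2 * Y (x + s • e) ^ 2) (𝓝[>] 0)
      (𝓝 (∫ x, ‖f x‖ ^ 2 * Y x ^ 2)) := by
    refine tendsto_integral_filter_of_dominated_convergence (fun x => ‖f x‖ ^ 2 * B ^ 2) ?_ ?_
      (hρ.mul_const _) ?_
    · exact Eventually.of_forall fun s => (hi2 _).aestronglyMeasurable
    · refine Eventually.of_forall fun s => Eventually.of_forall fun x => ?_
      rw [norm_mul, norm_pow, norm_norm, Real.norm_eq_abs, abs_of_nonneg (sq_nonneg _)]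
      exact mul_le_mul_of_nonneg_left (hY2 _) (by positivity)
    · exact Eventually.of_forall fun x => ((hcont x).pow 2).const_mul _
  have hfin := le_of_tendsto_of_tendsto lim1
    ((tendsto_const_nhds.add (lim2.const_mul _)).add tendsto_const_nhds)
    (eventually_nhdsWithin_of_forall fun s hs => key s hs)
  calc _ ≤ _ := hfin
    _ = _ := by field_simp; ring

end Translations

/-! ### Hardy's inequality -/

section Hardy

/-- The `j`-th coordinate vector of `ℝ³`. -/
abbrev coordVec (j : Fin 3) : R3 := EuclideanSpace.single j (1 : ℝ)

theorem norm_add_smul_coordVec_sq (z : R3) (j : Fin 3) (s : ℝ) :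
    ‖z + s • coordVec j‖ ^ 2 = ‖z‖ ^ 2 + 2 * z j * s + s ^ 2 := by
  rw [norm_add_sq_real, inner_smul_right, EuclideanSpace.inner_single_right, norm_smul]
  simp
  ring

theorem hasDerivAt_normSq_line (z : R3) (j : Fin 3) :
    HasDerivAt (fun s : ℝ => ‖z + s • coordVec j‖ ^ 2) (2 * z j) 0 := by
  simp_rw [norm_add_smul_coordVec_sq]
  have h := (((hasDerivAt_id (0 : ℝ)).const_mul (2 * z j)).const_add (‖z‖ ^ 2)).add
    ((hasDerivAt_id (0 : ℝ)).pow 2)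
  simp only [id_eq, mul_one, Nat.cast_ofNat, Nat.add_one_sub_one, pow_one, mul_zero,
    add_zero] at h
  exact h

theorem hasDerivAt_coord_line (z : R3) (j : Fin 3) :
    HasDerivAt (fun s : ℝ => (z + s • coordVec j) j) 1 0 := by
  have h := ((hasDerivAt_id (0 : ℝ))).const_add (z j)
  simpa using h

theorem sum_coord_sq (z : R3) : ∑ j, z j ^ 2 = ‖z‖ ^ 2 := by
  rw [EuclideanSpace.real_norm_sq_eq]

theorem coord_sq_le (z : R3) (j : Fin 3) : z j ^ 2 ≤ ‖z‖ ^ 2 := by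
  rw [← sum_coord_sq]
  exact Finset.single_le_sum (f := fun j => z j ^ 2) (fun i _ => sq_nonneg _) (Finset.mem_univ j)

theorem measurable_coord (j : Fin 3) : Measurable fun z : R3 => z j := by
  fun_prop

/-- Hardy's inequality with a regularised weight. -/
theorem hardy_regularized {f : R3 → ℂ} (hf : MemLp f 2 volume) {D : ℝ}
    (hD : ∀ a, ∫ x, ‖f (x + a) - f x‖ ^ 2 ≤ D ^ 2 * ‖a‖ ^ 2) {ε : ℝ} (hε : 0 < ε) (x₀ : R3) :
    ∫ x, ‖f x‖ ^ 2 * (‖x - x₀‖ ^ 2 + ε)⁻¹ ≤ 12 * D ^ 2 := by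
  have hρ := integrable_normSq hf
  -- The field Y = (x - x₀)/(|x - x₀|² + ε) satisfies |Y|² ≤ 1/(|x - x₀|² + ε) ≤ div Y, and ε keeps
  -- Y and its derivatives bounded.
  set Y : Fin 3 → R3 → ℝ := fun j x => (x - x₀) j / (‖x - x₀‖ ^ 2 + ε) with hY
  set Y' : Fin 3 → R3 → ℝ := fun j x =>
    (1 * (‖x - x₀‖ ^ 2 + ε) - (x - x₀) j * (2 * (x - x₀) j)) / (‖x - x₀‖ ^ 2 + ε) ^ 2 with hY'
  have hpos : ∀ x : R3, 0 < ‖x - x₀‖ ^ 2 + ε := fun x => by positivity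
  have hYm : ∀ j, Measurable (Y j) := fun j =>
    ((measurable_coord j).comp (measurable_id.sub_const x₀)).div (by fun_prop)
  have hY'm : ∀ j, Measurable (Y' j) := fun j => by
    have := (measurable_coord j).comp (measurable_id.sub_const x₀)
    refine Measurable.div (Measurable.sub (by fun_prop) ?_) (by fun_prop)
    exact this.mul (this.const_mul 2)
  have hY2 : ∀ j x, Y j x ^ 2 ≤ (‖x - x₀‖ ^ 2 + ε)⁻¹ := fun j x => by
    simp only [hY]
    rw [div_pow, div_le_iff₀ (pow_pos (hpos x) 2), pow_two (‖x - x₀‖ ^ 2 + ε),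
      inv_mul_cancel_left₀ (hpos x).ne']
    linarith [coord_sq_le (x - x₀) j]
  have hinv : ∀ x : R3, (‖x - x₀‖ ^ 2 + ε)⁻¹ ≤ ε⁻¹ := fun x =>
    inv_anti₀ hε (by linarith [sq_nonneg ‖x - x₀‖])
  have hYB : ∀ j x, |Y j x| ≤ √ε⁻¹ := fun j x =>
    Real.abs_le_sqrt ((hY2 j x).trans (hinv x))
  have hd : ∀ j x, HasDerivAt (fun s : ℝ => Y j (x + s • coordVec j)) (Y' j x) 0 := by
    intro j x
    have h1 := hasDerivAt_coord_line (x - x₀) j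
    have h2 := (hasDerivAt_normSq_line (x - x₀) j).add_const ε
    have h := h1.div h2 (by simpa using (hpos x).ne')
    simp only [zero_smul, add_zero] at h
    refine h.congr_of_eventuallyEq (Eventually.of_forall fun s => ?_)
    simp only [hY, Pi.div_apply, add_sub_right_comm]
  have hL : ∀ j x, |Y' j x| ≤ 3 * ε⁻¹ := by
    intro j x
    have h1 := coord_sq_le (x - x₀) j
    have hp := hpos x
    simp only [hY']
    rw [abs_div, abs_of_pos (pow_pos hp 2), div_le_iff₀ (pow_pos hp 2)]
    have h2 : |1 * (‖x - x₀‖ ^ 2 + ε) - (x - x₀) j * (2 * (x - x₀) j)| ≤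
        3 * (‖x - x₀‖ ^ 2 + ε) := by
      rw [abs_le]; constructor <;> nlinarith [sq_nonneg ((x - x₀) j)]
    refine h2.trans ?_
    have h3 : 1 ≤ ε⁻¹ * (‖x - x₀‖ ^ 2 + ε) := by
      rw [inv_mul_eq_div, le_div_iff₀ hε]; nlinarith [sq_nonneg ‖x - x₀‖]
    nlinarith
  have hIY' : ∀ j, Integrable (fun x => ‖f x‖ ^ 2 * Y' j x) := fun j =>
    hρ.mul_bdd (c := 3 * ε⁻¹) (hY'm j).aestronglyMeasurable (Eventually.of_forall (hL j))
  have hIY : ∀ j, Integrable (fun x => ‖f x‖ ^ 2 * Y j x ^ 2) := fun j =>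
    hρ.mul_bdd (c := ε⁻¹) ((hYm j).pow_const 2).aestronglyMeasurable
      (Eventually.of_forall fun x => by
        rw [Real.norm_eq_abs, abs_of_nonneg (sq_nonneg _)]; exact (hY2 j x).trans (hinv x))
  have hIw : Integrable (fun x => ‖f x‖ ^ 2 * (‖x - x₀‖ ^ 2 + ε)⁻¹) :=
    hρ.mul_bdd (c := ε⁻¹) (by fun_prop)
      (Eventually.of_forall fun x => by
        rw [Real.norm_eq_abs, abs_of_nonneg (inv_nonneg.2 (hpos x).le)]; exact hinv x)
  -- The choice c = 2 puts the factor 1/2 in front of |Y|², so that this term is absorbed: W ≤ 6D² +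
  -- W/2. Charging D² once per coordinate gives 12 instead of the sharp 4.
  have hj : ∀ j, ∫ x, ‖f x‖ ^ 2 * Y' j x ≤ 2 * D ^ 2 + 2⁻¹ * ∫ x, ‖f x‖ ^ 2 * Y j x ^ 2 := fun j =>
    integral_normSq_mul_lineDeriv_le hf hD (by simp) two_pos (hYm j) (hYB j) (hd j) (hL j)
  have hsum := Finset.sum_le_sum fun j (_ : j ∈ Finset.univ) => hj j
  rw [← integral_finsetSum _ fun j _ => hIY' j, Finset.sum_add_distrib,
    ← Finset.mul_sum Finset.univ (fun j => ∫ x, ‖f x‖ ^ 2 * Y j x ^ 2),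
    ← integral_finsetSum _ fun j _ => hIY j] at hsum
  have h1 : ∫ x, ‖f x‖ ^ 2 * (‖x - x₀‖ ^ 2 + ε)⁻¹ ≤ ∫ x, ∑ j, ‖f x‖ ^ 2 * Y' j x := by
    refine integral_mono hIw (integrable_finsetSum _ fun j _ => hIY' j) fun x => ?_
    simp only
    rw [← Finset.mul_sum]
    refine mul_le_mul_of_nonneg_left ?_ (by positivity)
    have hp := hpos x
    simp only [hY']
    rw [← Finset.sum_div, Finset.sum_sub_distrib,
      show ∑ j, (x - x₀) j * (2 * (x - x₀) j) = 2 * ‖x - x₀‖ ^ 2 by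
        rw [← sum_coord_sq, Finset.mul_sum]; exact Finset.sum_congr rfl fun j _ => by ring]
    rw [le_div_iff₀ (pow_pos hp 2), pow_two (‖x - x₀‖ ^ 2 + ε), inv_mul_cancel_left₀ hp.ne']
    simp
    nlinarith [sq_nonneg ‖x - x₀‖]
  have h2 : ∫ x, ∑ j, ‖f x‖ ^ 2 * Y j x ^ 2 ≤ ∫ x, ‖f x‖ ^ 2 * (‖x - x₀‖ ^ 2 + ε)⁻¹ := by
    refine integral_mono (integrable_finsetSum _ fun j _ => hIY j) hIw fun x => ?_
    simp only
    rw [← Finset.mul_sum]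
    refine mul_le_mul_of_nonneg_left ?_ (by positivity)
    have hp := hpos x
    simp only [hY, div_pow]
    rw [← Finset.sum_div, sum_coord_sq, div_le_iff₀ (pow_pos hp 2), pow_two (‖x - x₀‖ ^ 2 + ε),
      inv_mul_cancel_left₀ hp.ne']
    linarith
  simp at hsum
  linarith

theorem ofReal_normSq (z : ℂ) : ENNReal.ofReal (‖z‖ ^ 2) = ‖z‖ₑ ^ 2 := by
  rw [ENNReal.ofReal_pow (norm_nonneg _), ofReal_norm]

theorem ae_ne_point (x₀ : R3) : ∀ᵐ y : R3, y ≠ x₀ := by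
  simp [ae_iff, measure_singleton]

/-- Hardy's inequality. -/
theorem hardy {f : R3 → ℂ} (hf : MemLp f 2 volume) {D : ℝ}
    (hD : ∀ a, ∫ x, ‖f (x + a) - f x‖ ^ 2 ≤ D ^ 2 * ‖a‖ ^ 2) (x₀ : R3) :
    ∫⁻ x, ENNReal.ofReal ((‖x₀ - x‖ ^ 2)⁻¹) * ‖f x‖ₑ ^ 2 ≤ ENNReal.ofReal (12 * D ^ 2) := by
  have hρ := integrable_normSq hf
  -- The regularisation is removed along ε = 1/(n+1) by Fatou's lemma.
  set g : ℕ → R3 → ℝ≥0∞ := fun n x =>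
    ENNReal.ofReal (‖f x‖ ^ 2 * (‖x - x₀‖ ^ 2 + ((n : ℝ) + 1)⁻¹)⁻¹) with hg
  have hbound : ∀ n, ∫⁻ x, g n x ≤ ENNReal.ofReal (12 * D ^ 2) := by
    intro n
    have hε : (0 : ℝ) < ((n : ℝ) + 1)⁻¹ := by positivity
    have hI : Integrable (fun x => ‖f x‖ ^ 2 * (‖x - x₀‖ ^ 2 + ((n : ℝ) + 1)⁻¹)⁻¹) :=
      hρ.mul_bdd (c := ((n : ℝ) + 1)⁻¹⁻¹) (by fun_prop)
        (Eventually.of_forall fun x => by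
          rw [Real.norm_eq_abs, abs_of_nonneg (by positivity)]
          exact inv_anti₀ hε (by linarith [sq_nonneg ‖x - x₀‖]))
    rw [← ofReal_integral_eq_lintegral_ofReal hI (Eventually.of_forall fun x => by positivity)]
    exact ENNReal.ofReal_le_ofReal (hardy_regularized hf hD hε x₀)
  have hlim : ∀ᵐ x, Tendsto (fun n => g n x) atTop
      (𝓝 (ENNReal.ofReal ((‖x₀ - x‖ ^ 2)⁻¹) * ‖f x‖ₑ ^ 2)) := by
    filter_upwards [ae_ne_point x₀] with x hx
    have hx0 : ‖x - x₀‖ ^ 2 ≠ 0 := by simpa [sub_eq_zero] using hx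
    rw [← ofReal_normSq, ← ENNReal.ofReal_mul (by positivity), mul_comm, norm_sub_rev]
    refine (ENNReal.continuous_ofReal.tendsto _).comp (Tendsto.const_mul _ ?_)
    have h0 : Tendsto (fun n : ℕ => ((n : ℝ) + 1)⁻¹) atTop (𝓝 0) := by
      simpa [one_div] using tendsto_one_div_add_atTop_nhds_zero_nat (𝕜 := ℝ)
    have := (h0.const_add (‖x - x₀‖ ^ 2)).inv₀ (by simpa using hx0)
    simpa using this
  calc ∫⁻ x, ENNReal.ofReal ((‖x₀ - x‖ ^ 2)⁻¹) * ‖f x‖ₑ ^ 2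
      = ∫⁻ x, liminf (fun n => g n x) atTop :=
        lintegral_congr_ae (hlim.mono fun x hx => hx.liminf_eq.symm)
    _ ≤ liminf (fun n => ∫⁻ x, g n x) atTop := lintegral_liminf_le' fun n => by
        have := hf.1
        exact AEMeasurable.ennreal_ofReal (AEMeasurable.mul (by fun_prop) (by fun_prop))
    _ ≤ ENNReal.ofReal (12 * D ^ 2) :=
        liminf_le_of_frequently_le' (Frequently.of_forall hbound)

end Hardy

/-! ### Mass of pairs of points at small distance -/

section LocalMass

/-- The regularised distance `√(α² + |z|²)`. -/
def regDist (α : ℝ) (z : R3) : ℝ := √(α ^ 2 + ‖z‖ ^ 2)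

theorem regDist_sq (α : ℝ) (z : R3) : regDist α z ^ 2 = α ^ 2 + ‖z‖ ^ 2 :=
  Real.sq_sqrt (by positivity)

theorem regDist_pos {α : ℝ} (hα : 0 < α) (z : R3) : 0 < regDist α z :=
  Real.sqrt_pos.2 (by positivity)

theorem le_regDist (α : ℝ) (z : R3) : α ≤ regDist α z :=
  Real.le_sqrt_of_sq_le (by linarith [sq_nonneg ‖z‖])

theorem measurable_regDist (α : ℝ) : Measurable (regDist α) := by
  unfold regDist; fun_prop

/-- The coordinates of the vector field `α³ z / (α² + |z|²)^{3/2}`. -/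
def fluxField (α : ℝ) (j : Fin 3) (z : R3) : ℝ := α ^ 3 * z j / regDist α z ^ 3

/-- The derivative of the `j`-th coordinate of the flux field in the `j`-th direction. -/
def fluxDeriv (α : ℝ) (j : Fin 3) (z : R3) : ℝ :=
  α ^ 3 * (1 / regDist α z ^ 3 - 3 * z j ^ 2 / regDist α z ^ 5)

theorem measurable_fluxField (α : ℝ) (j : Fin 3) : Measurable (fluxField α j) := by
  have := measurable_regDist α
  unfold fluxField; fun_prop

theorem measurable_fluxDeriv (α : ℝ) (j : Fin 3) : Measurable (fluxDeriv α j) := by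
  have := measurable_regDist α
  unfold fluxDeriv; fun_prop

theorem hasDerivAt_fluxField {α : ℝ} (hα : 0 < α) (j : Fin 3) (z : R3) :
    HasDerivAt (fun s : ℝ => fluxField α j (z + s • coordVec j)) (fluxDeriv α j z) 0 := by
  have hq := regDist_pos hα z
  have h1 := (hasDerivAt_coord_line z j).const_mul (α ^ 3)
  have h2 : HasDerivAt (fun s : ℝ => regDist α (z + s • coordVec j)) (z j / regDist α z) 0 := by
    have := ((hasDerivAt_normSq_line z j).const_add (α ^ 2)).sqrt (by
      simp only [zero_smul, add_zero]; positivity)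
    simp only [zero_smul, add_zero] at this
    refine this.congr_deriv ?_
    simp only [regDist]; field_simp
  have h3 := h1.div (h2.pow 3) (by simpa using hq.ne')
  simp only [Pi.pow_apply, zero_smul, add_zero] at h3
  refine h3.congr_deriv ?_
  rw [fluxDeriv]
  field_simp
  simp
  ring

theorem abs_coord_le_regDist (α : ℝ) (j : Fin 3) (z : R3) : |z j| ≤ regDist α z :=
  Real.abs_le_sqrt (by linarith [coord_sq_le z j, sq_nonneg α])

theorem abs_fluxField_le {α : ℝ} (hα : 0 < α) (j : Fin 3) (z : R3) :
    |fluxField α j z| ≤ α ^ 3 * (‖z‖ ^ 2 + α ^ 2)⁻¹ := by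
  have hq := regDist_pos hα z
  rw [fluxField, abs_div, abs_mul, abs_of_pos (pow_pos hα 3), abs_of_pos (pow_pos hq 3),
    add_comm, ← regDist_sq, div_le_iff₀ (pow_pos hq 3)]
  have := abs_coord_le_regDist α j z
  calc α ^ 3 * |z j| ≤ α ^ 3 * regDist α z := by gcongr
    _ = _ := by field_simp

theorem abs_fluxDeriv_le {α : ℝ} (hα : 0 < α) (j : Fin 3) (z : R3) :
    |fluxDeriv α j z| ≤ 4 := by
  have hq := regDist_pos hα z
  have h1 : z j ^ 2 ≤ regDist α z ^ 2 := by
    rw [regDist_sq]; linarith [coord_sq_le z j, sq_nonneg α]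
  have h2 : α ^ 3 ≤ regDist α z ^ 3 := pow_le_pow_left₀ hα.le (le_regDist α z) 3
  have h3 : 3 * z j ^ 2 / regDist α z ^ 5 ≤ 3 / regDist α z ^ 3 := by
    rw [div_le_div_iff₀ (by positivity) (by positivity)]
    calc 3 * z j ^ 2 * regDist α z ^ 3 ≤ 3 * regDist α z ^ 2 * regDist α z ^ 3 := by gcongr
      _ = _ := by ring
  have h4 : 0 ≤ 3 * z j ^ 2 / regDist α z ^ 5 := by positivity
  have h5 : 0 < 1 / regDist α z ^ 3 := by positivity
  have h6 : 3 / regDist α z ^ 3 = 3 * (1 / regDist α z ^ 3) := by ring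
  have h7 : |1 / regDist α z ^ 3 - 3 * z j ^ 2 / regDist α z ^ 5| ≤ 4 / regDist α z ^ 3 := by
    have h8 : 4 / regDist α z ^ 3 = 4 * (1 / regDist α z ^ 3) := by ring
    rw [abs_le]; constructor <;> linarith
  rw [fluxDeriv, abs_mul, abs_of_pos (pow_pos hα 3)]
  calc _ ≤ regDist α z ^ 3 * (4 / regDist α z ^ 3) := by gcongr
    _ = 4 := by field_simp

theorem sum_fluxDeriv {α : ℝ} (hα : 0 < α) (z : R3) :
    ∑ j, fluxDeriv α j z = 3 * α ^ 5 / regDist α z ^ 5 := by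
  have hq := regDist_pos hα z
  have h2 := regDist_sq α z
  have h3 := sum_coord_sq z
  simp only [fluxDeriv, ← Finset.mul_sum, Finset.sum_sub_distrib, ← Finset.sum_div]
  rw [h3]
  simp
  field_simp
  rw [h2]; ring

/-- The divergence is 3(α/`regDist`)⁵, and `regDist` is at most √2 α on this ball; √2 ≤ 3/2 gives
3/(4 · 3/2) = 1/2. Thus twice the divergence dominates the indicator of the ball. -/
theorem half_le_sum_fluxDeriv {α : ℝ} (hα : 0 < α) {z : R3} (hz : ‖z‖ < α) :
    1 / 2 ≤ ∑ j, fluxDeriv α j z := by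
  have hq := regDist_pos hα z
  have h1 : regDist α z ≤ 3 / 2 * α := by
    apply Real.sqrt_le_iff.2 ⟨by positivity, ?_⟩
    nlinarith [norm_nonneg z]
  have h2 : regDist α z ^ 2 ≤ 2 * α ^ 2 := by
    rw [regDist_sq]; nlinarith [norm_nonneg z]
  rw [sum_fluxDeriv hα, le_div_iff₀ (by positivity)]
  calc 1 / 2 * regDist α z ^ 5 = 1 / 2 * ((regDist α z ^ 2) ^ 2 * regDist α z) := by ring
    _ ≤ 1 / 2 * ((2 * α ^ 2) ^ 2 * (3 / 2 * α)) := by gcongr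
    _ = 3 * α ^ 5 := by ring

theorem sum_fluxDeriv_nonneg {α : ℝ} (hα : 0 < α) (z : R3) : 0 ≤ ∑ j, fluxDeriv α j z := by
  have hq := regDist_pos hα z
  rw [sum_fluxDeriv hα]; positivity

/-- The mass of pairs of points at distance less than `α` is of order `α³`. -/
theorem integral_pairs_le {f : R3 → ℂ} (hf : MemLp f 2 volume) (hfm : Measurable f) {D : ℝ}
    (hD : ∀ a, ∫ x, ‖f (x + a) - f x‖ ^ 2 ≤ D ^ 2 * ‖a‖ ^ 2) {α : ℝ} (hα : 0 < α) :
    ∫ x, ‖f x‖ ^ 2 * ∫ y, (∑ j, fluxDeriv α j (x - y)) * ‖f y‖ ^ 2 ≤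
      α ^ 3 * (3 * D ^ 2 + 432 * D ^ 4 * ∫ y, ‖f y‖ ^ 2) := by
  have hρ := integrable_normSq hf
  set n := ∫ y, ‖f y‖ ^ 2 with hn
  -- The flux field convolved with |f|² has as divergence the inner integral to be estimated. Its
  -- size is α³ times a regularised Hardy integral with ε = α², so |Y| ≤ 12α³D² without any
  -- pointwise bound on f.
  set Y : Fin 3 → R3 → ℝ := fun j x => ∫ y, fluxField α j (x - y) * ‖f y‖ ^ 2 with hY
  set Y' : Fin 3 → R3 → ℝ := fun j x => ∫ y, fluxDeriv α j (x - y) * ‖f y‖ ^ 2 with hY'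
  have hIX : ∀ j x, Integrable (fun y => fluxField α j (x - y) * ‖f y‖ ^ 2) := fun j x =>
    hρ.bdd_mul (c := α) (((measurable_fluxField α j).comp
      (measurable_const.sub measurable_id)).aestronglyMeasurable) (Eventually.of_forall fun y => by
        refine (abs_fluxField_le hα j (x - y)).trans ?_
        rw [← div_eq_mul_inv, div_le_iff₀ (by positivity)]
        nlinarith [sq_nonneg ‖x - y‖, mul_nonneg hα.le (sq_nonneg ‖x - y‖)])
  have hIX' : ∀ j x, Integrable (fun y => fluxDeriv α j (x - y) * ‖f y‖ ^ 2) := fun j x =>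
    hρ.bdd_mul (c := 4) (((measurable_fluxDeriv α j).comp
      (measurable_const.sub measurable_id)).aestronglyMeasurable)
      (Eventually.of_forall fun y => abs_fluxDeriv_le hα j (x - y))
  have hYm : ∀ j, Measurable (Y j) := fun j => by
    have : StronglyMeasurable (fun p : R3 × R3 => fluxField α j (p.1 - p.2) * ‖f p.2‖ ^ 2) := by
      refine Measurable.stronglyMeasurable ?_
      exact ((measurable_fluxField α j).comp (measurable_fst.sub measurable_snd)).mul
        ((hfm.comp measurable_snd).norm.pow_const 2)
    exact this.integral_prod_right.measurable
  have hY'm : ∀ j, Measurable (Y' j) := fun j => by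
    have : StronglyMeasurable (fun p : R3 × R3 => fluxDeriv α j (p.1 - p.2) * ‖f p.2‖ ^ 2) := by
      refine Measurable.stronglyMeasurable ?_
      exact ((measurable_fluxDeriv α j).comp (measurable_fst.sub measurable_snd)).mul
        ((hfm.comp measurable_snd).norm.pow_const 2)
    exact this.integral_prod_right.measurable
  have hYB : ∀ j x, |Y j x| ≤ α ^ 3 * (12 * D ^ 2) := by
    intro j x
    have hIw : Integrable (fun y => ‖f y‖ ^ 2 * (‖y - x‖ ^ 2 + α ^ 2)⁻¹) :=
      hρ.mul_bdd (c := (α ^ 2)⁻¹) (by fun_prop) (Eventually.of_forall fun y => by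
        rw [Real.norm_eq_abs, abs_of_nonneg (by positivity)]
        exact inv_anti₀ (by positivity) (by linarith [sq_nonneg ‖y - x‖]))
    calc |Y j x| ≤ ∫ y, α ^ 3 * (‖f y‖ ^ 2 * (‖y - x‖ ^ 2 + α ^ 2)⁻¹) := by
          rw [← Real.norm_eq_abs]
          refine norm_integral_le_of_norm_le (hIw.const_mul _) (Eventually.of_forall fun y => ?_)
          rw [norm_mul, Real.norm_eq_abs, norm_pow, norm_norm, norm_sub_rev y x]
          calc _ ≤ α ^ 3 * (‖x - y‖ ^ 2 + α ^ 2)⁻¹ * ‖f y‖ ^ 2 := by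
                gcongr; exact abs_fluxField_le hα j (x - y)
            _ = _ := by ring
      _ ≤ _ := by
          rw [integral_const_mul]
          have := hardy_regularized hf hD (pow_pos hα 2) x
          gcongr
  have hL : ∀ j x, |Y' j x| ≤ 4 * n := by
    intro j x
    rw [hn, ← integral_const_mul, ← Real.norm_eq_abs]
    refine norm_integral_le_of_norm_le (hρ.const_mul _) (Eventually.of_forall fun y => ?_)
    rw [norm_mul, Real.norm_eq_abs, norm_pow, norm_norm]
    gcongr; exact abs_fluxDeriv_le hα j (x - y)
  have hd : ∀ j x, HasDerivAt (fun s : ℝ => Y j (x + s • coordVec j)) (Y' j x) 0 := by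
    intro j x
    have hder : ∀ (r : ℝ) (y : R3), HasDerivAt
        (fun s : ℝ => fluxField α j (x + s • coordVec j - y) * ‖f y‖ ^ 2)
        (fluxDeriv α j (x + r • coordVec j - y) * ‖f y‖ ^ 2) r := by
      intro r y
      refine HasDerivAt.mul_const ?_ _
      have h2 := HasDerivAt.comp_sub_const
        (f := fun s : ℝ => fluxField α j (x + r • coordVec j - y + s • coordVec j)) r r
        (by simpa using hasDerivAt_fluxField hα j (x + r • coordVec j - y))
      refine h2.congr_of_eventuallyEq (Eventually.of_forall fun s => ?_)
      simp only
      congr 1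
      module
    have h := hasDerivAt_integral_of_dominated_loc_of_deriv_le (μ := volume)
      (F := fun (s : ℝ) y => fluxField α j (x + s • coordVec j - y) * ‖f y‖ ^ 2)
      (F' := fun (s : ℝ) y => fluxDeriv α j (x + s • coordVec j - y) * ‖f y‖ ^ 2)
      (bound := fun y => 4 * ‖f y‖ ^ 2) (x₀ := (0 : ℝ)) (s := Set.univ) univ_mem
      (Eventually.of_forall fun s => (hIX j _).aestronglyMeasurable) (hIX j _)
      (hIX' j _).aestronglyMeasurable
      (Eventually.of_forall fun y s _ => by
        rw [norm_mul, Real.norm_eq_abs, norm_pow, norm_norm]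
        gcongr; exact abs_fluxDeriv_le hα j _)
      (hρ.const_mul 4) (Eventually.of_forall fun y s _ => hder s y)
    simpa using h.2
  have hIY' : ∀ j, Integrable (fun x => ‖f x‖ ^ 2 * Y' j x) := fun j =>
    hρ.mul_bdd (c := 4 * n) (hY'm j).aestronglyMeasurable (Eventually.of_forall (hL j))
  have hn0 : 0 ≤ n := integral_nonneg fun x => by positivity
  have hj : ∀ j, ∫ x, ‖f x‖ ^ 2 * Y' j x ≤ α ^ 3 * (D ^ 2 + 144 * D ^ 4 * n) := by
    intro j
    -- With c = α³ both terms, cD² and c⁻¹ times a multiple of α⁶, are of order α³.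
    have h1 := integral_normSq_mul_lineDeriv_le hf hD (e := coordVec j) (by simp) (pow_pos hα 3)
      (hYm j) (hYB j) (hd j) (hL j)
    have hsq : ∀ x, Y j x ^ 2 ≤ (α ^ 3 * (12 * D ^ 2)) ^ 2 := fun x => by
      rw [← sq_abs]; exact pow_le_pow_left₀ (abs_nonneg _) (hYB j x) 2
    have h2 : ∫ x, ‖f x‖ ^ 2 * Y j x ^ 2 ≤ n * (α ^ 3 * (12 * D ^ 2)) ^ 2 := by
      rw [hn, ← integral_mul_const]
      refine integral_mono_of_nonneg (Eventually.of_forall fun x => by positivity)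
        (hρ.mul_const _) (Eventually.of_forall fun x => ?_)
      exact mul_le_mul_of_nonneg_left (hsq x) (by positivity)
    calc _ ≤ _ := h1
      _ ≤ α ^ 3 * D ^ 2 + (α ^ 3)⁻¹ * (n * (α ^ 3 * (12 * D ^ 2)) ^ 2) := by gcongr
      _ = _ := by field_simp; ring
  have hsum := Finset.sum_le_sum fun j (_ : j ∈ Finset.univ) => hj j
  rw [← integral_finsetSum _ fun j _ => hIY' j] at hsum
  calc ∫ x, ‖f x‖ ^ 2 * ∫ y, (∑ j, fluxDeriv α j (x - y)) * ‖f y‖ ^ 2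
      = ∫ x, ∑ j, ‖f x‖ ^ 2 * Y' j x := by
        refine integral_congr_ae (Eventually.of_forall fun x => ?_)
        simp only
        rw [← Finset.mul_sum, ← integral_finsetSum _ fun j _ => hIX' j x]
        simp_rw [Finset.sum_mul]
    _ ≤ _ := hsum
    _ = _ := by simp; ring

/-- This has the strength of a bound by α³‖f‖₄⁴ with the L⁴ norm controlled in H¹, but needs no
Sobolev embedding: the indicator of the ball is at most twice the divergence of the flux field,
which is nonnegative everywhere. -/
theorem lintegral_pairs_le {f : R3 → ℂ} (hf : MemLp f 2 volume) (hfm : Measurable f) {D : ℝ}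
    (hD : ∀ a, ∫ x, ‖f (x + a) - f x‖ ^ 2 ≤ D ^ 2 * ‖a‖ ^ 2) {α : ℝ} (hα : 0 < α) :
    ∫⁻ x, ‖f x‖ₑ ^ 2 * ∫⁻ y, (if ‖x - y‖ < α then 1 else 0) * ‖f y‖ₑ ^ 2 ≤
      ENNReal.ofReal (2 * α ^ 3 * (3 * D ^ 2 + 432 * D ^ 4 * ∫ y, ‖f y‖ ^ 2)) := by
  have hρ := integrable_normSq hf
  have hm : StronglyMeasurable
      (fun p : R3 × R3 => (∑ j, fluxDeriv α j (p.1 - p.2)) * ‖f p.2‖ ^ 2) := by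
    refine Measurable.stronglyMeasurable ?_
    refine Measurable.mul (Finset.measurable_sum _ fun j _ => ?_)
      ((hfm.comp measurable_snd).norm.pow_const 2)
    exact (measurable_fluxDeriv α j).comp (measurable_fst.sub measurable_snd)
  have hb : ∀ z, |∑ j, fluxDeriv α j z| ≤ 12 := fun z => by
    refine (Finset.abs_sum_le_sum_abs _ _).trans ?_
    refine (Finset.sum_le_sum fun j _ => abs_fluxDeriv_le hα j z).trans ?_
    simp; norm_num
  have hIX : ∀ x, Integrable (fun y => (∑ j, fluxDeriv α j (x - y)) * ‖f y‖ ^ 2) := fun x =>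
    hρ.bdd_mul (c := 12) (Finset.aestronglyMeasurable_fun_sum _ fun j _ =>
      ((measurable_fluxDeriv α j).comp
      (measurable_const.sub measurable_id)).aestronglyMeasurable)
      (Eventually.of_forall fun y => hb (x - y))
  have hI : Integrable (fun x => ‖f x‖ ^ 2 * ∫ y, (∑ j, fluxDeriv α j (x - y)) * ‖f y‖ ^ 2) := by
    refine hρ.mul_bdd (c := ∫ y, 12 * ‖f y‖ ^ 2)
      hm.integral_prod_right.aestronglyMeasurable (Eventually.of_forall fun x => ?_)
    refine norm_integral_le_of_norm_le (hρ.const_mul _) (Eventually.of_forall fun y => ?_)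
    rw [norm_mul, Real.norm_eq_abs, norm_pow, norm_norm]
    gcongr; exact hb _
  have hin : ∀ x, ∫⁻ y, (if ‖x - y‖ < α then 1 else 0) * ‖f y‖ₑ ^ 2 ≤
      ENNReal.ofReal (2 * ∫ y, (∑ j, fluxDeriv α j (x - y)) * ‖f y‖ ^ 2) := by
    intro x
    rw [← integral_const_mul, ofReal_integral_eq_lintegral_ofReal ((hIX x).const_mul 2)
      (Eventually.of_forall fun y => mul_nonneg zero_le_two
        (mul_nonneg (sum_fluxDeriv_nonneg hα _) (by positivity)))]
    refine lintegral_mono fun y => ?_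
    simp only
    have h0 := sum_fluxDeriv_nonneg hα (x - y)
    rw [← mul_assoc, ENNReal.ofReal_mul (by positivity), ofReal_normSq]
    gcongr
    split_ifs with h
    · rw [← ENNReal.ofReal_one]
      exact ENNReal.ofReal_le_ofReal (by linarith [half_le_sum_fluxDeriv hα h])
    · exact zero_le
  calc _ ≤ ∫⁻ x, ENNReal.ofReal
        (2 * (‖f x‖ ^ 2 * ∫ y, (∑ j, fluxDeriv α j (x - y)) * ‖f y‖ ^ 2)) := by
        refine lintegral_mono fun x => ?_
        simp only
        rw [mul_left_comm, ENNReal.ofReal_mul (by positivity), ofReal_normSq]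
        gcongr
        exact hin x
    _ = ENNReal.ofReal
        (∫ x, 2 * (‖f x‖ ^ 2 * ∫ y, (∑ j, fluxDeriv α j (x - y)) * ‖f y‖ ^ 2)) := by
        rw [ofReal_integral_eq_lintegral_ofReal (hI.const_mul 2)]
        exact Eventually.of_forall fun x => mul_nonneg zero_le_two (mul_nonneg (by positivity)
          (integral_nonneg fun y => mul_nonneg (sum_fluxDeriv_nonneg hα _) (by positivity)))
    _ ≤ _ := by
        apply ENNReal.ofReal_le_ofReal
        rw [integral_const_mul, mul_assoc]
        have := integral_pairs_le hf hfm hD hα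
        gcongr

end LocalMass

/-! ### Multiplication operators, translations and the Fourier transform on L² -/

section Multipliers

theorem norm_sq_eq_integral (f : L2) : ‖f‖ ^ 2 = ∫ x, ‖f x‖ ^ 2 := by
  have h := MeasureTheory.L2.inner_def (𝕜 := ℂ) f f
  rw [inner_self_eq_norm_sq_to_K] at h
  have h2 : ∀ x, inner ℂ (f x) (f x) = ((‖f x‖ ^ 2 : ℝ) : ℂ) := fun x => by
    rw [inner_self_eq_norm_sq_to_K]; push_cast; rfl
  simp_rw [h2] at h
  have h3 : ∫ x, ((‖f x‖ ^ 2 : ℝ) : ℂ) = ((∫ x, ‖f x‖ ^ 2 : ℝ) : ℂ) := integral_ofReal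
  rw [h3] at h
  refine Complex.ofReal_injective (Eq.trans ?_ h)
  push_cast
  rfl

theorem memLp_bdd_mul {b : R3 → ℂ} (hb : Measurable b) {C : ℝ} (hC : ∀ x, ‖b x‖ ≤ C) (f : L2) :
    MemLp (fun x => b x * f x) 2 volume :=
  (Lp.memLp f).of_le_mul (c := C) (hb.aestronglyMeasurable.mul (Lp.aestronglyMeasurable f))
    (Eventually.of_forall fun x => by
      rw [norm_mul]; exact mul_le_mul_of_nonneg_right (hC x) (norm_nonneg _))

/-- Multiplication by a bounded measurable function, on `L²`. -/
def mulL (b : R3 → ℂ) (hb : Measurable b) (C : ℝ) (hC : ∀ x, ‖b x‖ ≤ C) : L2 →L[ℂ] L2 :=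
  LinearMap.mkContinuous
    { toFun := fun f => (memLp_bdd_mul hb hC f).toLp _
      map_add' := fun f g => by
        ext1
        filter_upwards [(memLp_bdd_mul hb hC (f + g)).coeFn_toLp,
          (memLp_bdd_mul hb hC f).coeFn_toLp, (memLp_bdd_mul hb hC g).coeFn_toLp,
          Lp.coeFn_add f g, Lp.coeFn_add ((memLp_bdd_mul hb hC f).toLp _)
            ((memLp_bdd_mul hb hC g).toLp _)] with x h1 h2 h3 h4 h5
        rw [h1, h5, Pi.add_apply, h2, h3, h4, Pi.add_apply, mul_add]
      map_smul' := fun c f => by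
        ext1
        filter_upwards [(memLp_bdd_mul hb hC (c • f)).coeFn_toLp,
          (memLp_bdd_mul hb hC f).coeFn_toLp, Lp.coeFn_smul c f,
          Lp.coeFn_smul c ((memLp_bdd_mul hb hC f).toLp _)] with x h1 h2 h3 h4
        rw [h1, RingHom.id_apply, h4, Pi.smul_apply, h2, h3, Pi.smul_apply, smul_eq_mul,
          smul_eq_mul, mul_left_comm] }
    C fun f => by
      refine Lp.norm_le_mul_norm_of_ae_le_mul ?_
      filter_upwards [(memLp_bdd_mul hb hC f).coeFn_toLp] with x hx
      change ‖(memLp_bdd_mul hb hC f).toLp _ x‖ ≤ _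
      rw [hx, norm_mul]
      exact mul_le_mul_of_nonneg_right (hC x) (norm_nonneg _)

theorem coeFn_mulL {b : R3 → ℂ} (hb : Measurable b) {C : ℝ} (hC : ∀ x, ‖b x‖ ≤ C) (f : L2) :
    mulL b hb C hC f =ᵐ[volume] fun x => b x * f x :=
  (memLp_bdd_mul hb hC f).coeFn_toLp

/-- Translation `f ↦ f(· + a)` on `L²`. -/
def transL (a : R3) : L2 → L2 :=
  Lp.compMeasurePreserving (fun x => x + a) (measurePreserving_add_right volume a)

theorem coeFn_transL (a : R3) (f : L2) : transL a f =ᵐ[volume] fun x => f (x + a) :=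
  Lp.coeFn_compMeasurePreserving f _

theorem continuous_transL (a : R3) : Continuous (transL a) :=
  (Lp.isometry_compMeasurePreserving _).continuous

/-- The character `ξ ↦ exp(2πi a·ξ)`. -/
def phase (a ξ : R3) : ℂ := (Real.fourierChar (inner ℝ a ξ) : ℂ)

theorem measurable_phase (a : R3) : Measurable (phase a) := by
  have : Continuous (phase a) := by
    unfold phase
    exact continuous_subtype_val.comp (Real.continuous_fourierChar.comp (by fun_prop))
  exact this.measurable

theorem norm_phase (a ξ : R3) : ‖phase a ξ‖ = 1 := Circle.norm_coe _

theorem norm_phase_sub_one_le (a ξ : R3) :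
    ‖phase a ξ - 1‖ ≤ ‖a‖ * (2 * Real.pi * ‖ξ‖) := by
  rw [phase, Real.fourierChar_apply, mul_comm]
  refine Real.norm_exp_I_mul_ofReal_sub_one_le.trans ?_
  rw [norm_mul, Real.norm_of_nonneg (by positivity : (0 : ℝ) ≤ 2 * Real.pi)]
  calc 2 * Real.pi * ‖inner ℝ a ξ‖ ≤ 2 * Real.pi * (‖a‖ * ‖ξ‖) := by
        gcongr; exact norm_inner_le_norm a ξ
    _ = _ := by ring

/-- Both sides are continuous in f, so it suffices to take Schwartz functions, where this is the
formula for the Fourier integral of a translate. -/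
theorem fourier_transL (a : R3) (f : L2) :
    (𝓕 (transL a f) : L2) = mulL (phase a) (measurable_phase a) 1 (fun ξ => (norm_phase a ξ).le)
      (𝓕 f) := by
  refine DenseRange.induction_on (p := fun f : L2 => (𝓕 (transL a f) : L2) =
    mulL (phase a) (measurable_phase a) 1 (fun ξ => (norm_phase a ξ).le) (𝓕 f))
    (SchwartzMap.denseRange_toLpCLM (p := 2) ENNReal.ofNat_ne_top) f ?_ ?_
  · have hF : Continuous fun f : L2 => (𝓕 f : L2) := (Lp.fourierTransformₗᵢ R3 ℂ).continuous
    exact isClosed_eq (hF.comp (continuous_transL a)) ((mulL _ _ _ _).continuous.comp hF)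
  · intro χ
    simp only [SchwartzMap.toLpCLM_apply]
    have h1 : transL a (χ.toLp 2) = (SchwartzMap.compSubConstCLM ℝ (-a) χ).toLp 2 := by
      ext1
      have h := (measurePreserving_add_right volume a).quasiMeasurePreserving.ae
        (p := fun x => χ.toLp 2 volume x = χ x) (χ.coeFn_toLp 2 volume)
      filter_upwards [coeFn_transL a (χ.toLp 2),
        (SchwartzMap.compSubConstCLM ℝ (-a) χ).coeFn_toLp 2, h] with x hx hy hz
      rw [hx, hy, hz, SchwartzMap.compSubConstCLM_apply, sub_neg_eq_add]
    rw [h1, SchwartzMap.toLp_fourier_eq, SchwartzMap.toLp_fourier_eq]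
    ext1
    filter_upwards [(𝓕 (SchwartzMap.compSubConstCLM ℝ (-a) χ)).coeFn_toLp 2,
      (𝓕 χ).coeFn_toLp 2, coeFn_mulL (measurable_phase a) (fun ξ => (norm_phase a ξ).le)
        ((𝓕 χ).toLp 2)] with ξ h2 h3 h4
    rw [h2, h4, h3, SchwartzMap.fourier_coe, SchwartzMap.fourier_coe]
    have h5 := congrFun (VectorFourier.fourierIntegral_comp_add_right Real.fourierChar
      (volume : Measure R3) (innerₗ R3) (χ : R3 → ℂ) a) ξ
    have h6 : (fun x => χ (x + a)) = (SchwartzMap.compSubConstCLM ℝ (-a) χ : R3 → ℂ) := by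
      ext x; simp
    simp only [Function.comp_def, h6] at h5
    exact h5

end Multipliers

/-! ### Kinetic energy and the H¹ norm -/

section Sobolev

/-- The symbol `(2π|ξ|)²` of `-Δ`. -/
def symb (ξ : R3) : ℝ := (2 * Real.pi * ‖ξ‖) ^ 2

theorem symb_nonneg (ξ : R3) : 0 ≤ symb ξ := sq_nonneg _

theorem measurable_symb : Measurable symb := by unfold symb; fun_prop

/-- `f` has finite kinetic energy. -/
def FiniteKin (f : L2) : Prop := Integrable (fun ξ => symb ξ * ‖(𝓕 f : L2) ξ‖ ^ 2) volume

/-- The kinetic energy `‖∇f‖²`. -/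
def kin (f : L2) : ℝ := ∫ ξ, symb ξ * ‖(𝓕 f : L2) ξ‖ ^ 2

theorem kin_nonneg (f : L2) : 0 ≤ kin f :=
  integral_nonneg fun ξ => mul_nonneg (symb_nonneg ξ) (sq_nonneg _)

/-- Plancherel and |e^{iθ} - 1| ≤ |θ|. This supplies the translation hypothesis of Hardy's
inequality and of the pair estimate, with D² = `kin f`. -/
theorem norm_transL_sub_sq_le {f : L2} (hf : FiniteKin f) (a : R3) :
    ‖transL a f - f‖ ^ 2 ≤ kin f * ‖a‖ ^ 2 := by
  have h1 : ‖transL a f - f‖ = ‖(𝓕 (transL a f) : L2) - 𝓕 f‖ := by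
    rw [← Lp.norm_fourier_eq (transL a f - f)]
    congr 1
    exact map_sub (Lp.fourierTransformₗᵢ R3 ℂ) _ _
  rw [h1, fourier_transL, norm_sq_eq_integral, kin, ← integral_mul_const]
  refine integral_mono_of_nonneg (Eventually.of_forall fun x => by positivity)
    (hf.mul_const _) ?_
  filter_upwards [Lp.coeFn_sub (mulL (phase a) (measurable_phase a) 1
    (fun ξ => (norm_phase a ξ).le) (𝓕 f)) (𝓕 f), coeFn_mulL (measurable_phase a)
    (fun ξ => (norm_phase a ξ).le) (𝓕 f)] with ξ h2 h3
  rw [h2, Pi.sub_apply, h3, ← sub_one_mul, norm_mul, mul_pow, symb]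
  have := norm_phase_sub_one_le a ξ
  calc _ ≤ (‖a‖ * (2 * Real.pi * ‖ξ‖)) ^ 2 * ‖(𝓕 f : L2) ξ‖ ^ 2 := by gcongr
    _ = _ := by ring

theorem integral_trans_sub_le {f : L2} (hf : FiniteKin f) (a : R3) :
    ∫ x, ‖f (x + a) - f x‖ ^ 2 ≤ √(kin f) ^ 2 * ‖a‖ ^ 2 := by
  rw [Real.sq_sqrt (kin_nonneg f)]
  refine le_trans (le_of_eq ?_) (norm_transL_sub_sq_le hf a)
  rw [norm_sq_eq_integral]
  refine integral_congr_ae ?_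
  filter_upwards [Lp.coeFn_sub (transL a f) f, coeFn_transL a f] with x h1 h2
  rw [h1, Pi.sub_apply, h2]

/-- The Sobolev weight `(1 - Δ)^{s/2}` on the Fourier side. -/
def sobolevWeight (s : ℝ) (f : L2) (ξ : R3) : ℂ :=
  (((1 + (2 * Real.pi * ‖ξ‖) ^ 2) ^ (s / 2) : ℝ) : ℂ) * (𝓕 f : L2) ξ

theorem aestronglyMeasurable_sobolevWeight (s : ℝ) (f : L2) :
    AEStronglyMeasurable (sobolevWeight s f) volume := by
  refine AEStronglyMeasurable.mul (Measurable.aestronglyMeasurable ?_) (Lp.aestronglyMeasurable _)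
  fun_prop

theorem fourier_add (f g : L2) : (𝓕 (f + g) : L2) = 𝓕 f + 𝓕 g :=
  map_add (Lp.fourierTransformₗᵢ R3 ℂ) _ _

theorem fourier_sub (f g : L2) : (𝓕 (f - g) : L2) = 𝓕 f - 𝓕 g :=
  map_sub (Lp.fourierTransformₗᵢ R3 ℂ) _ _

theorem sobolevNorm_add_le (s : ℝ) (f g : L2) :
    sobolevNorm s (f + g) ≤ sobolevNorm s f + sobolevNorm s g := by
  have h : sobolevWeight s (f + g) =ᵐ[volume] sobolevWeight s f + sobolevWeight s g := by
    rw [Filter.EventuallyEq]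
    filter_upwards [Lp.coeFn_add (𝓕 f : L2) (𝓕 g)] with ξ h1
    simp only [sobolevWeight, fourier_add, h1, Pi.add_apply, mul_add]
  calc sobolevNorm s (f + g) = eLpNorm (sobolevWeight s f + sobolevWeight s g) 2 volume :=
        eLpNorm_congr_ae h
    _ ≤ _ := eLpNorm_add_le (aestronglyMeasurable_sobolevWeight s f)
        (aestronglyMeasurable_sobolevWeight s g) (by norm_num)

theorem sobolevNorm_sub_comm (s : ℝ) (f g : L2) :
    sobolevNorm s (f - g) = sobolevNorm s (g - f) := by
  have h : sobolevWeight s (f - g) =ᵐ[volume] -sobolevWeight s (g - f) := by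
    rw [Filter.EventuallyEq]
    filter_upwards [Lp.coeFn_sub (𝓕 f : L2) (𝓕 g), Lp.coeFn_sub (𝓕 g : L2) (𝓕 f)] with ξ h1 h2
    simp only [sobolevWeight, fourier_sub, h1, h2, Pi.sub_apply, Pi.neg_apply]
    ring
  calc sobolevNorm s (f - g) = eLpNorm (-sobolevWeight s (g - f)) 2 volume := eLpNorm_congr_ae h
    _ = _ := by rw [eLpNorm_neg]; rfl

theorem sobolevNorm_mono {s s' : ℝ} (h : s ≤ s') (f : L2) :
    sobolevNorm s f ≤ sobolevNorm s' f := by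
  refine eLpNorm_mono fun ξ => ?_
  have h1 : (1 : ℝ) ≤ 1 + (2 * Real.pi * ‖ξ‖) ^ 2 := by linarith [sq_nonneg (2 * Real.pi * ‖ξ‖)]
  rw [norm_mul, norm_mul, Complex.norm_real, Complex.norm_real, Real.norm_eq_abs, Real.norm_eq_abs,
    abs_of_nonneg (by positivity), abs_of_nonneg (by positivity)]
  gcongr

theorem norm_sobolevWeight_sq (f : L2) (ξ : R3) :
    ‖sobolevWeight 1 f ξ‖ ^ 2 = ‖(𝓕 f : L2) ξ‖ ^ 2 + symb ξ * ‖(𝓕 f : L2) ξ‖ ^ 2 := by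
  have h1 : (0 : ℝ) < 1 + (2 * Real.pi * ‖ξ‖) ^ 2 := by positivity
  rw [sobolevWeight, norm_mul, mul_pow, Complex.norm_real, Real.norm_eq_abs, sq_abs,
    ← Real.sqrt_eq_rpow, Real.sq_sqrt h1.le, symb]
  ring

theorem finiteKin_of_sobolevNorm {f : L2} (hf : sobolevNorm 1 f ≠ ∞) : FiniteKin f := by
  have hm : MemLp (sobolevWeight 1 f) 2 volume :=
    ⟨aestronglyMeasurable_sobolevWeight 1 f, lt_top_iff_ne_top.2 hf⟩
  have h1 := integrable_normSq hm
  have h2 := integrable_normSq (Lp.memLp (𝓕 f : L2))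
  refine (h1.sub h2).congr (Eventually.of_forall fun ξ => ?_)
  simp only [Pi.sub_apply, norm_sobolevWeight_sq]
  ring

theorem sobolevNorm_sq {f : L2} (hf : sobolevNorm 1 f ≠ ∞) :
    (sobolevNorm 1 f).toReal ^ 2 = ‖f‖ ^ 2 + kin f := by
  have hm : MemLp (sobolevWeight 1 f) 2 volume :=
    ⟨aestronglyMeasurable_sobolevWeight 1 f, lt_top_iff_ne_top.2 hf⟩
  have h1 : (sobolevNorm 1 f).toReal = ‖hm.toLp _‖ := by
    rw [Lp.norm_toLp]; rfl
  rw [h1, norm_sq_eq_integral, ← Lp.norm_fourier_eq f, norm_sq_eq_integral, kin,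
    ← integral_add (integrable_normSq (Lp.memLp (𝓕 f : L2))) (finiteKin_of_sobolevNorm hf)]
  refine integral_congr_ae ?_
  filter_upwards [hm.coeFn_toLp] with ξ h
  rw [h, norm_sobolevWeight_sq]

end Sobolev

/-! ### Three-body densities -/

section Kernels

/-- An even measurable pair potential between `0` and the Coulomb potential. -/
structure IsPairKernel (w : R3 → ℝ) : Prop where
  measurable : Measurable w
  nonneg : ∀ x, 0 ≤ w x
  le_coulomb : ∀ x, w x ≤ coulomb x
  even : ∀ x, w (-x) = w x

theorem coulomb_nonneg (x : R3) : 0 ≤ coulomb x := by unfold coulomb; positivity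

theorem measurable_coulomb : Measurable coulomb := by unfold coulomb; fun_prop

theorem isPairKernel_coulomb : IsPairKernel coulomb :=
  ⟨measurable_coulomb, coulomb_nonneg, fun _ => le_rfl, fun x => by simp [coulomb]⟩

theorem coulomb_neg (x : R3) : coulomb (-x) = coulomb x := isPairKernel_coulomb.even x

theorem cutCoulomb_eq {α : ℝ} (hα : 0 < α) (x : R3) :
    cutCoulomb α x = min (coulomb x) α⁻¹ := by
  rw [cutCoulomb, abs_of_nonneg (coulomb_nonneg x)]
  rcases (coulomb_nonneg x).eq_or_lt with h | h
  · rw [← h]; simp [hα.le]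
  · rw [Real.sign_of_pos h, one_mul]

theorem isPairKernel_cutCoulomb {α : ℝ} (hα : 0 < α) : IsPairKernel (cutCoulomb α) := by
  have h : cutCoulomb α = fun x => min (coulomb x) α⁻¹ := funext (cutCoulomb_eq hα)
  rw [h]
  exact ⟨measurable_coulomb.min measurable_const,
    fun x => le_min (coulomb_nonneg x) (inv_nonneg.2 hα.le), fun x => min_le_left _ _,
    fun x => by rw [coulomb_neg]⟩

theorem threeBody_nonneg {lam : ℝ} (hlam : 0 ≤ lam) {w : R3 → ℝ} (hw : IsPairKernel w)
    (x y z : R3) : 0 ≤ threeBody lam w x y z :=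
  mul_nonneg hlam (add_nonneg (add_nonneg (mul_nonneg (hw.nonneg _) (hw.nonneg _))
    (mul_nonneg (hw.nonneg _) (hw.nonneg _))) (mul_nonneg (hw.nonneg _) (hw.nonneg _)))

theorem threeBody_mono {lam : ℝ} (hlam : 0 ≤ lam) {w : R3 → ℝ} (hw : IsPairKernel w)
    (x y z : R3) : threeBody lam w x y z ≤ threeBody lam coulomb x y z := by
  have h := hw.le_coulomb
  have h0 := hw.nonneg
  have hc := coulomb_nonneg
  unfold threeBody
  gcongr <;> first | exact h0 _ | exact hc _ | exact h _

theorem threeBody_swap_right (lam : ℝ) (w : R3 → ℝ) (x y z : R3) :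
    threeBody lam w x z y = threeBody lam w x y z := by
  unfold threeBody
  ring

theorem threeBody_swap_left (lam : ℝ) {w : R3 → ℝ} (hw : IsPairKernel w) (x y z : R3) :
    threeBody lam w y x z = threeBody lam w x y z := by
  unfold threeBody
  rw [← hw.even (x - z), ← hw.even (y - z), neg_sub, neg_sub]
  ring

theorem measurable_threeBody (lam : ℝ) {w : R3 → ℝ} (hw : IsPairKernel w) :
    Measurable fun p : R3 × R3 × R3 => threeBody lam w p.1 p.2.1 p.2.2 := by
  have hm := hw.measurable
  unfold threeBody
  fun_prop

end Kernels

/-! ### Mean fields and trilinear forms of densities -/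

section Densities

/-- The Coulomb potential of a density. -/
def pot (p : R3 → ℝ≥0∞) (x : R3) : ℝ≥0∞ := ∫⁻ y, ENNReal.ofReal (coulomb (x - y)) * p y

theorem measurable_ofReal_coulomb : Measurable fun x => ENNReal.ofReal (coulomb x) :=
  measurable_coulomb.ennreal_ofReal

/-- Each product in the potential is a path through the three points. If x is its middle, the
integral factorises; otherwise integrating the far end first costs one potential and the remaining
point the other. Only the suprema A and B enter. -/
theorem lintegral_threeBody_le {lam : ℝ} (hlam : 0 ≤ lam) {w : R3 → ℝ} (hw : IsPairKernel w)
    {q r : R3 → ℝ≥0∞} (hq : Measurable q) (hr : Measurable r) {A B : ℝ≥0∞}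
    (hA : ∀ x, pot q x ≤ A) (hB : ∀ x, pot r x ≤ B) (x : R3) :
    ∫⁻ p : R3 × R3, ENNReal.ofReal (threeBody lam w x p.1 p.2) * (q p.1 * r p.2) ≤
      ENNReal.ofReal (3 * lam) * (A * B) := by
  set c : R3 → ℝ≥0∞ := fun x => ENNReal.ofReal (coulomb x) with hc
  have hcm : Measurable c := measurable_ofReal_coulomb
  have hcneg : ∀ a b : R3, c (a - b) = c (b - a) := fun a b => by
    simp only [hc]; rw [← coulomb_neg, neg_sub]
  have h1 : ∀ p : R3 × R3, ENNReal.ofReal (threeBody lam w x p.1 p.2) * (q p.1 * r p.2) ≤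
      ENNReal.ofReal lam * ((c (x - p.1) * q p.1) * (c (x - p.2) * r p.2) +
        (c (x - p.1) * q p.1) * (c (p.1 - p.2) * r p.2) +
        (c (x - p.2) * r p.2) * (c (p.2 - p.1) * q p.1)) := by
    intro p
    have h2 := threeBody_mono hlam hw x p.1 p.2
    have h3 : ENNReal.ofReal (threeBody lam coulomb x p.1 p.2) = ENNReal.ofReal lam *
        (c (x - p.1) * c (x - p.2) + c (p.1 - p.2) * c (p.1 - x) +
          c (p.2 - x) * c (p.2 - p.1)) := by
      have hn := coulomb_nonneg
      simp only [threeBody, hc]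
      rw [ENNReal.ofReal_mul hlam, ENNReal.ofReal_add (add_nonneg (mul_nonneg (hn _) (hn _))
        (mul_nonneg (hn _) (hn _))) (mul_nonneg (hn _) (hn _)), ENNReal.ofReal_add
        (mul_nonneg (hn _) (hn _)) (mul_nonneg (hn _) (hn _)), ENNReal.ofReal_mul (hn _),
        ENNReal.ofReal_mul (hn _), ENNReal.ofReal_mul (hn _)]
    calc _ ≤ ENNReal.ofReal (threeBody lam coulomb x p.1 p.2) * (q p.1 * r p.2) := by gcongr
      _ = _ := by rw [h3, hcneg p.1 x, hcneg p.2 x]; ring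
  have m1 : Measurable fun y => c (x - y) * q y := by fun_prop
  have m2 : Measurable fun y => c (x - y) * r y := by fun_prop
  have m3 : Measurable fun p : R3 × R3 => c (p.1 - p.2) * r p.2 := by fun_prop
  have m4 : Measurable fun p : R3 × R3 => c (p.2 - p.1) * q p.1 := by fun_prop
  have M1 : Measurable fun p : R3 × R3 => (c (x - p.1) * q p.1) * (c (x - p.2) * r p.2) := by
    fun_prop
  have M2 : Measurable fun p : R3 × R3 => (c (x - p.1) * q p.1) * (c (p.1 - p.2) * r p.2) := by
    fun_prop
  have M3 : Measurable fun p : R3 × R3 => (c (x - p.2) * r p.2) * (c (p.2 - p.1) * q p.1) := by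
    fun_prop
  refine (lintegral_mono h1).trans ?_
  rw [lintegral_const_mul' _ _ ENNReal.ofReal_ne_top, lintegral_add_right _ M3,
    lintegral_add_left M1]
  have t1 : ∫⁻ p : R3 × R3, (c (x - p.1) * q p.1) * (c (x - p.2) * r p.2) ≤ A * B := by
    rw [Measure.volume_eq_prod, lintegral_prod_mul m1.aemeasurable m2.aemeasurable]
    exact mul_le_mul' (hA x) (hB x)
  have t2 : ∫⁻ p : R3 × R3, (c (x - p.1) * q p.1) * (c (p.1 - p.2) * r p.2) ≤ A * B := by
    rw [Measure.volume_eq_prod, lintegral_prod _ M2.aemeasurable]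
    calc _ ≤ ∫⁻ y, (c (x - y) * q y) * B := by
          refine lintegral_mono fun y => ?_
          simp only
          rw [lintegral_const_mul _ (by fun_prop)]
          gcongr
          exact hB y
      _ ≤ A * B := by
          rw [lintegral_mul_const _ m1]
          gcongr
          exact hA x
  have t3 : ∫⁻ p : R3 × R3, (c (x - p.2) * r p.2) * (c (p.2 - p.1) * q p.1) ≤ A * B := by
    rw [Measure.volume_eq_prod, lintegral_prod_symm _ M3.aemeasurable]
    calc _ ≤ ∫⁻ y, (c (x - y) * r y) * A := by
          refine lintegral_mono fun y => ?_
          simp only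
          rw [lintegral_const_mul _ (by fun_prop)]
          gcongr
          exact hA y
      _ ≤ A * B := by
          rw [lintegral_mul_const _ m2, mul_comm A B]
          gcongr
          exact hB x
  calc _ ≤ ENNReal.ofReal lam * (A * B + A * B + A * B) := by gcongr
    _ = _ := by
        rw [ENNReal.ofReal_mul (by norm_num), ENNReal.ofReal_ofNat]; ring

/-- An integrable density whose Coulomb potential is at most `A`. -/
structure Dens (p : R3 → ℝ) (A : ℝ) : Prop where
  measurable : Measurable p
  integrable : Integrable p volume
  nonneg : 0 ≤ A
  pot_le : ∀ x, pot (fun y => ‖p y‖ₑ) x ≤ ENNReal.ofReal A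

theorem Dens.add {p q : R3 → ℝ} {A B : ℝ} (hp : Dens p A) (hq : Dens q B) :
    Dens (p + q) (A + B) where
  measurable := hp.measurable.add hq.measurable
  integrable := hp.integrable.add hq.integrable
  nonneg := add_nonneg hp.nonneg hq.nonneg
  pot_le := fun x => by
    have hm := hp.measurable
    have hc := measurable_ofReal_coulomb
    have hm1 : Measurable fun y => ENNReal.ofReal (coulomb (x - y)) * ‖p y‖ₑ :=
      (hc.comp (measurable_const.sub measurable_id)).mul hm.enorm
    rw [ENNReal.ofReal_add hp.nonneg hq.nonneg]
    refine le_trans ?_ (add_le_add (hp.pot_le x) (hq.pot_le x))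
    simp only [pot]
    rw [← lintegral_add_left hm1]
    refine lintegral_mono fun y => ?_
    simp only [Pi.add_apply]
    rw [← mul_add]
    gcongr
    exact enorm_add_le _ _

theorem Dens.const_mul {p : R3 → ℝ} {A : ℝ} (hp : Dens p A) (c : ℝ) :
    Dens (fun x => c * p x) (|c| * A) where
  measurable := hp.measurable.const_mul c
  integrable := hp.integrable.const_mul c
  nonneg := mul_nonneg (abs_nonneg c) hp.nonneg
  pot_le := fun x => by
    have hm := hp.measurable
    have hc := measurable_ofReal_coulomb
    have hm1 : Measurable fun y => ENNReal.ofReal (coulomb (x - y)) * ‖p y‖ₑ :=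
      (hc.comp (measurable_const.sub measurable_id)).mul hm.enorm
    rw [ENNReal.ofReal_mul (abs_nonneg c), ← Real.enorm_eq_ofReal_abs]
    refine le_trans (le_of_eq ?_) (mul_le_mul_right (hp.pot_le x) ‖c‖ₑ)
    simp only [pot]
    rw [← lintegral_const_mul _ hm1]
    refine lintegral_congr fun y => ?_
    rw [enorm_mul]; ring

/-- The bilinear mean field `x ↦ ∫ V(x,y,z) q(y) r(z) dy dz`. -/
def biField (V : R3 → R3 → R3 → ℝ) (q r : R3 → ℝ) (x : R3) : ℝ :=
  ∫ p : R3 × R3, V x p.1 p.2 * (q p.1 * r p.2)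

/-- The trilinear form `∫ V(x,y,z) p(x) q(y) r(z) dx dy dz`. -/
def triForm (V : R3 → R3 → R3 → ℝ) (p q r : R3 → ℝ) : ℝ :=
  ∫ s : R3 × R3 × R3, V s.1 s.2.1 s.2.2 * (p s.1 * (q s.2.1 * r s.2.2))

variable {lam : ℝ} {w : R3 → ℝ} {p q r : R3 → ℝ} {A B : ℝ}

theorem measurable_threeBody_right (lam : ℝ) (hw : IsPairKernel w) (x : R3) :
    Measurable fun p : R3 × R3 => threeBody lam w x p.1 p.2 :=
  (measurable_threeBody lam hw).comp (measurable_const.prodMk measurable_id)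

theorem lintegral_enorm_biField_le (hlam : 0 ≤ lam) (hw : IsPairKernel w) (hq : Dens q A)
    (hr : Dens r B) (x : R3) :
    ∫⁻ p : R3 × R3, ‖threeBody lam w x p.1 p.2 * (q p.1 * r p.2)‖ₑ ≤
      ENNReal.ofReal (3 * lam * (A * B)) := by
  have h := lintegral_threeBody_le hlam hw hq.measurable.enorm hr.measurable.enorm hq.pot_le
    hr.pot_le x
  rw [ENNReal.ofReal_mul (by positivity), ENNReal.ofReal_mul hq.nonneg]
  refine le_trans (le_of_eq (lintegral_congr fun p => ?_)) h
  rw [enorm_mul, enorm_mul, Real.enorm_of_nonneg (threeBody_nonneg hlam hw _ _ _)]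

theorem integrable_biField (hlam : 0 ≤ lam) (hw : IsPairKernel w) (hq : Dens q A)
    (hr : Dens r B) (x : R3) :
    Integrable (fun p : R3 × R3 => threeBody lam w x p.1 p.2 * (q p.1 * r p.2)) := by
  refine ⟨Measurable.aestronglyMeasurable ?_,
    (lintegral_enorm_biField_le hlam hw hq hr x).trans_lt ENNReal.ofReal_lt_top⟩
  exact (measurable_threeBody_right lam hw x).mul
    ((hq.measurable.comp measurable_fst).mul (hr.measurable.comp measurable_snd))

theorem abs_biField_le (hlam : 0 ≤ lam) (hw : IsPairKernel w) (hq : Dens q A)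
    (hr : Dens r B) (x : R3) : |biField (threeBody lam w) q r x| ≤ 3 * lam * (A * B) := by
  have h := (enorm_integral_le_lintegral_enorm _).trans
    (lintegral_enorm_biField_le hlam hw hq hr x)
  rw [← ofReal_norm] at h
  exact (ENNReal.ofReal_le_ofReal_iff
    (mul_nonneg (by positivity) (mul_nonneg hq.nonneg hr.nonneg))).1 h

theorem measurable_triIntegrand (lam : ℝ) (hw : IsPairKernel w) (hp : Measurable p)
    (hq : Measurable q) (hr : Measurable r) :
    Measurable fun s : R3 × R3 × R3 =>
      threeBody lam w s.1 s.2.1 s.2.2 * (p s.1 * (q s.2.1 * r s.2.2)) :=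
  (measurable_threeBody lam hw).mul ((hp.comp measurable_fst).mul
    ((hq.comp (measurable_fst.comp measurable_snd)).mul
      (hr.comp (measurable_snd.comp measurable_snd))))

theorem measurable_biField (lam : ℝ) (hw : IsPairKernel w) (hq : Measurable q)
    (hr : Measurable r) : Measurable (biField (threeBody lam w) q r) := by
  have h : StronglyMeasurable fun s : R3 × R3 × R3 =>
      threeBody lam w s.1 s.2.1 s.2.2 * (q s.2.1 * r s.2.2) :=
    ((measurable_threeBody lam hw).mul ((hq.comp (measurable_fst.comp measurable_snd)).mul
      (hr.comp (measurable_snd.comp measurable_snd)))).stronglyMeasurable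
  exact h.integral_prod_right.measurable

theorem integrable_triForm (hlam : 0 ≤ lam) (hw : IsPairKernel w) (hpm : Measurable p)
    (hp : Integrable p) (hq : Dens q A) (hr : Dens r B) :
    Integrable fun s : R3 × R3 × R3 =>
      threeBody lam w s.1 s.2.1 s.2.2 * (p s.1 * (q s.2.1 * r s.2.2)) := by
  have hm := measurable_triIntegrand lam hw hpm hq.measurable hr.measurable
  refine ⟨hm.aestronglyMeasurable, ?_⟩
  rw [HasFiniteIntegral, Measure.volume_eq_prod, lintegral_prod _ hm.enorm.aemeasurable]
  calc _ ≤ ∫⁻ x, ‖p x‖ₑ * ENNReal.ofReal (3 * lam * (A * B)) := by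
        refine lintegral_mono fun x => ?_
        simp only
        calc _ = ∫⁻ y : R3 × R3, ‖p x‖ₑ * ‖threeBody lam w x y.1 y.2 * (q y.1 * r y.2)‖ₑ := by
              refine lintegral_congr fun y => ?_
              rw [← enorm_mul]; congr 1; ring
          _ = ‖p x‖ₑ * ∫⁻ y : R3 × R3, ‖threeBody lam w x y.1 y.2 * (q y.1 * r y.2)‖ₑ :=
              lintegral_const_mul' _ _ enorm_ne_top
          _ ≤ _ := by gcongr; exact lintegral_enorm_biField_le hlam hw hq hr x
    _ < ∞ := by
        rw [lintegral_mul_const _ hpm.enorm]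
        exact ENNReal.mul_lt_top hp.2 ENNReal.ofReal_lt_top

theorem triForm_eq_integral (hlam : 0 ≤ lam) (hw : IsPairKernel w) (hpm : Measurable p)
    (hp : Integrable p) (hq : Dens q A) (hr : Dens r B) :
    triForm (threeBody lam w) p q r = ∫ x, p x * biField (threeBody lam w) q r x := by
  rw [triForm, Measure.volume_eq_prod, integral_prod _
    (integrable_triForm hlam hw hpm hp hq hr)]
  refine integral_congr_ae (Eventually.of_forall fun x => ?_)
  simp only [biField]
  rw [← integral_const_mul]
  refine integral_congr_ae (Eventually.of_forall fun y => ?_)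
  simp only
  ring

theorem abs_triForm_le (hlam : 0 ≤ lam) (hw : IsPairKernel w) (hpm : Measurable p)
    (hp : Integrable p) (hq : Dens q A) (hr : Dens r B) :
    |triForm (threeBody lam w) p q r| ≤ 3 * lam * (A * B) * ∫ x, |p x| := by
  rw [triForm_eq_integral hlam hw hpm hp hq hr, ← integral_const_mul, ← Real.norm_eq_abs]
  refine norm_integral_le_of_norm_le (hp.abs.const_mul _) (Eventually.of_forall fun x => ?_)
  rw [norm_mul, Real.norm_eq_abs, Real.norm_eq_abs, mul_comm]
  gcongr
  exact abs_biField_le hlam hw hq hr x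

/-- Together with `triForm_swap_left` this makes the form fully symmetric, which `triForm_cube`
relies on. -/
theorem triForm_swap_right :
    triForm (threeBody lam w) p q r = triForm (threeBody lam w) p r q := by
  have h := ((MeasurePreserving.id (volume : Measure R3)).prod
    (Measure.measurePreserving_swap (μ := (volume : Measure R3))
      (ν := (volume : Measure R3)))).integral_comp
    ((MeasurableEquiv.refl R3).prodCongr MeasurableEquiv.prodComm).measurableEmbedding
    (fun s : R3 × R3 × R3 => threeBody lam w s.1 s.2.1 s.2.2 * (p s.1 * (q s.2.1 * r s.2.2)))
  rw [triForm, triForm]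
  refine Eq.trans h.symm ?_
  refine integral_congr_ae (Eventually.of_forall fun s => ?_)
  simp only [Prod.map, id, Prod.swap]
  rw [threeBody_swap_right lam w]
  ring

theorem triForm_swap_left (hw : IsPairKernel w) :
    triForm (threeBody lam w) p q r = triForm (threeBody lam w) q p r := by
  have ha := measurePreserving_prodAssoc (volume : Measure R3) (volume : Measure R3)
    (volume : Measure R3)
  have h1 := ha.symm
  have h2 := (Measure.measurePreserving_swap (μ := (volume : Measure R3))
      (ν := (volume : Measure R3))).prod (MeasurePreserving.id (volume : Measure R3))
  have h := (ha.comp (h2.comp h1)).integral_comp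
    ((MeasurableEquiv.prodAssoc.symm.trans ((MeasurableEquiv.prodComm).prodCongr
      (MeasurableEquiv.refl R3))).trans MeasurableEquiv.prodAssoc).measurableEmbedding
    (fun s : R3 × R3 × R3 => threeBody lam w s.1 s.2.1 s.2.2 * (p s.1 * (q s.2.1 * r s.2.2)))
  rw [triForm, triForm]
  refine Eq.trans h.symm ?_
  refine integral_congr_ae (Eventually.of_forall fun s => ?_)
  simp only [Function.comp, MeasurableEquiv.prodAssoc, Prod.map, Prod.swap, id]
  simp
  rw [threeBody_swap_left lam hw]
  ring

end Densities

/-! ### The nonlinearity on bounded sets of `H¹` -/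

section NonlinearBounds

theorem lintegral_mul_sq_le {μ : Measure R3} {u v : R3 → ℝ≥0∞} (hu : AEMeasurable u μ)
    (hv : AEMeasurable v μ) :
    (∫⁻ x, u x * v x ∂μ) ^ 2 ≤ (∫⁻ x, u x ^ 2 ∂μ) * ∫⁻ x, v x ^ 2 ∂μ := by
  have h := ENNReal.lintegral_mul_le_Lp_mul_Lq μ
    (Real.HolderConjugate.two_two) hu hv
  have h2 := pow_le_pow_left' h 2
  refine h2.trans (le_of_eq ?_)
  rw [mul_pow, ← ENNReal.rpow_natCast, ← ENNReal.rpow_natCast, ← ENNReal.rpow_mul,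
    ← ENNReal.rpow_mul]
  simp

theorem integrable_fun_sub {α : Type*} [MeasurableSpace α] {μ : Measure α} {u v : α → ℝ}
    (hu : Integrable u μ) (hv : Integrable v μ) : Integrable (fun x => u x - v x) μ := hu.sub hv

theorem integrable_fun_add {α : Type*} [MeasurableSpace α] {μ : Measure α} {u v : α → ℝ}
    (hu : Integrable u μ) (hv : Integrable v μ) : Integrable (fun x => u x + v x) μ := hu.add hv

theorem enorm_le_of_sq_le {a b : ℝ≥0∞} (h : a ^ 2 ≤ b ^ 2) : a ≤ b :=
  (ENNReal.pow_le_pow_left_iff two_ne_zero).1 h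

theorem lintegral_enorm_sq (f : L2) : ∫⁻ x, ‖f x‖ₑ ^ 2 = ENNReal.ofReal (‖f‖ ^ 2) := by
  rw [norm_sq_eq_integral, ofReal_integral_eq_lintegral_ofReal (integrable_normSq (Lp.memLp f))
    (Eventually.of_forall fun x => by positivity)]
  exact lintegral_congr fun x => (ofReal_normSq _).symm

theorem lintegral_enorm_sub_sq (f g : L2) :
    ∫⁻ x, ‖f x - g x‖ₑ ^ 2 = ENNReal.ofReal (‖f - g‖ ^ 2) := by
  rw [← lintegral_enorm_sq]
  refine lintegral_congr_ae ?_
  filter_upwards [Lp.coeFn_sub f g] with x hx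
  rw [hx, Pi.sub_apply]

theorem measurable_coe (f : L2) : Measurable f := (Lp.stronglyMeasurable f).measurable

theorem coulomb_sq (z : R3) : ENNReal.ofReal (coulomb z) ^ 2 = ENNReal.ofReal ((‖z‖ ^ 2)⁻¹) := by
  rw [← ENNReal.ofReal_pow (coulomb_nonneg z), coulomb, one_div, inv_pow]

theorem lintegral_coulomb_sq_le {g : L2} (hg : FiniteKin g) (x : R3) :
    ∫⁻ y, ENNReal.ofReal (coulomb (x - y)) ^ 2 * ‖g y‖ₑ ^ 2 ≤ ENNReal.ofReal (12 * kin g) := by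
  have h := hardy (Lp.memLp g) (integral_trans_sub_le hg) x
  rw [Real.sq_sqrt (kin_nonneg g)] at h
  simpa only [coulomb_sq] using h

/-- Cauchy–Schwarz puts the whole singularity on g, where Hardy's inequality handles it, and leaves
u in L² only; 4 rounds up √12. This asymmetry is what later yields estimates in the L² distance. -/
theorem pot_mul_le {u : R3 → ℂ} (hu : Measurable u) {C : ℝ} (hC : 0 ≤ C)
    (huC : ∫⁻ x, ‖u x‖ₑ ^ 2 ≤ ENNReal.ofReal (C ^ 2)) {g : L2} (hg : FiniteKin g) {R : ℝ}
    (hR : 0 ≤ R) (hgR : kin g ≤ R ^ 2) (x : R3) :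
    pot (fun y => ‖u y‖ₑ * ‖g y‖ₑ) x ≤ ENNReal.ofReal (4 * C * R) := by
  have hgm := measurable_coe g
  have hcm : Measurable fun y => ENNReal.ofReal (coulomb (x - y)) :=
    measurable_ofReal_coulomb.comp (measurable_const.sub measurable_id)
  apply enorm_le_of_sq_le
  have h := lintegral_mul_sq_le (μ := volume) hu.enorm.aemeasurable
    (hcm.mul hgm.enorm).aemeasurable
  simp only [pot]
  calc _ = (∫⁻ y, ‖u y‖ₑ * (ENNReal.ofReal (coulomb (x - y)) * ‖g y‖ₑ)) ^ 2 := by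
        congr 1; exact lintegral_congr fun y => by ring
    _ ≤ _ := h
    _ ≤ ENNReal.ofReal (C ^ 2) * ENNReal.ofReal (12 * kin g) := by
        gcongr
        simp only [Pi.mul_apply, mul_pow]
        exact lintegral_coulomb_sq_le hg x
    _ ≤ _ := by
        rw [← ENNReal.ofReal_mul (by positivity), ← ENNReal.ofReal_pow (by positivity)]
        apply ENNReal.ofReal_le_ofReal
        nlinarith [mul_le_mul_of_nonneg_left hgR (sq_nonneg C),
          mul_nonneg (sq_nonneg C) (sq_nonneg R)]

/-- The density `|f|²`. -/
def dens (f : L2) (x : R3) : ℝ := ‖f x‖ ^ 2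

/-- `f` lies in the ball of radius `R` of `H¹`. -/
structure H1Bound (f : L2) (R : ℝ) : Prop where
  finiteKin : FiniteKin f
  norm_le : ‖f‖ ≤ R
  kin_le : kin f ≤ R ^ 2

theorem H1Bound.nonneg {f : L2} {R : ℝ} (h : H1Bound f R) : 0 ≤ R :=
  (norm_nonneg f).trans h.norm_le

theorem measurable_dens (f : L2) : Measurable (dens f) := (measurable_coe f).norm.pow_const 2

theorem integrable_dens (f : L2) : Integrable (dens f) := integrable_normSq (Lp.memLp f)

theorem integral_dens (f : L2) : ∫ x, dens f x = ‖f‖ ^ 2 := (norm_sq_eq_integral f).symm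

theorem dens_nonneg (f : L2) (x : R3) : 0 ≤ dens f x := sq_nonneg _

theorem H1Bound.isDens {f : L2} {R : ℝ} (h : H1Bound f R) : Dens (dens f) (4 * R ^ 2) where
  measurable := measurable_dens f
  integrable := integrable_dens f
  nonneg := by positivity
  pot_le := fun x => by
    have h1 := pot_mul_le (measurable_coe f) h.nonneg ((lintegral_enorm_sq f).le.trans
      (ENNReal.ofReal_le_ofReal (pow_le_pow_left₀ (norm_nonneg f) h.norm_le 2)))
      h.finiteKin h.nonneg h.kin_le x
    have h2 : (fun y => ‖dens f y‖ₑ) = fun y => ‖f y‖ₑ * ‖f y‖ₑ := by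
      funext y; rw [dens, enorm_pow, enorm_norm, pow_two]
    rw [h2]
    refine h1.trans (ENNReal.ofReal_le_ofReal (by nlinarith))

variable {lam R : ℝ} {w : R3 → ℝ} {f g : L2}

/-- Since ||f|² - |g|²| ≤ |f - g|(|f| + |g|), the difference f - g can take the L² slot of
`pot_mul_le`. -/
theorem isDens_sub (hf : H1Bound f R) (hg : H1Bound g R) :
    Dens (fun x => dens f x - dens g x) (8 * R * ‖f - g‖) where
  measurable := (measurable_dens f).sub (measurable_dens g)
  integrable := (integrable_dens f).sub (integrable_dens g)
  nonneg := mul_nonneg (mul_nonneg (by norm_num) hf.nonneg) (norm_nonneg _)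
  pot_le := fun x => by
    have hfm := measurable_coe f
    have hgm := measurable_coe g
    have hum : Measurable fun y => f y - g y := hfm.sub hgm
    have hcm : Measurable fun y => ENNReal.ofReal (coulomb (x - y)) :=
      measurable_ofReal_coulomb.comp (measurable_const.sub measurable_id)
    have h1 := pot_mul_le hum (norm_nonneg (f - g)) (lintegral_enorm_sub_sq f g).le
      hf.finiteKin hf.nonneg hf.kin_le x
    have h2 := pot_mul_le hum (norm_nonneg (f - g)) (lintegral_enorm_sub_sq f g).le
      hg.finiteKin hf.nonneg hg.kin_le x
    have h3 : ∀ y, ‖dens f y - dens g y‖ₑ ≤ ‖f y - g y‖ₑ * ‖f y‖ₑ + ‖f y - g y‖ₑ * ‖g y‖ₑ := by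
      intro y
      rw [← mul_add, Real.enorm_eq_ofReal_abs, ← ofReal_norm, ← ofReal_norm, ← ofReal_norm,
        ← ENNReal.ofReal_add (norm_nonneg _) (norm_nonneg _), ← ENNReal.ofReal_mul (norm_nonneg _)]
      apply ENNReal.ofReal_le_ofReal
      simp only [dens]
      rw [sq_sub_sq, abs_mul, abs_of_nonneg (by positivity : 0 ≤ ‖f y‖ + ‖g y‖), mul_comm]
      gcongr
      exact abs_norm_sub_norm_le _ _
    calc _ ≤ pot (fun y => ‖f y - g y‖ₑ * ‖f y‖ₑ) x + pot (fun y => ‖f y - g y‖ₑ * ‖g y‖ₑ) x := by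
          simp only [pot]
          have hm : Measurable fun y => ENNReal.ofReal (coulomb (x - y)) *
              (‖f y - g y‖ₑ * ‖f y‖ₑ) := hcm.mul (hum.enorm.mul hfm.enorm)
          rw [← lintegral_add_left hm]
          refine lintegral_mono fun y => ?_
          simp only
          rw [← mul_add]
          gcongr
          exact h3 y
      _ ≤ _ := add_le_add h1 h2
      _ = _ := by
          have := hf.nonneg
          rw [← ENNReal.ofReal_add (by positivity) (by positivity)]; congr 1; ring

theorem meanField_eq_biField (V : R3 → R3 → R3 → ℝ) (f : L2) :
    meanField V f = biField V (dens f) (dens f) := by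
  funext x
  simp only [meanField, biField, dens, mul_assoc]

theorem abs_meanField_le (hlam : 0 ≤ lam) (hw : IsPairKernel w) (hf : H1Bound f R) (x : R3) :
    |meanField (threeBody lam w) f x| ≤ 48 * lam * R ^ 4 := by
  rw [meanField_eq_biField]
  refine (abs_biField_le hlam hw hf.isDens hf.isDens x).trans (le_of_eq (by ring))

theorem measurable_meanField (lam : ℝ) (hw : IsPairKernel w) (f : L2) :
    Measurable (meanField (threeBody lam w) f) := by
  rw [meanField_eq_biField]
  exact measurable_biField lam hw (measurable_dens f) (measurable_dens f)

theorem abs_meanField_sub_le (hlam : 0 ≤ lam) (hw : IsPairKernel w) (hf : H1Bound f R)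
    (hg : H1Bound g R) (x : R3) :
    |meanField (threeBody lam w) f x - meanField (threeBody lam w) g x| ≤
      192 * lam * R ^ 3 * ‖f - g‖ := by
  have hs := isDens_sub hf hg
  have e : meanField (threeBody lam w) f x - meanField (threeBody lam w) g x =
      biField (threeBody lam w) (fun x => dens f x - dens g x) (dens f) x +
        biField (threeBody lam w) (dens g) (fun x => dens f x - dens g x) x := by
    rw [meanField_eq_biField, meanField_eq_biField, biField, biField, biField, biField,
      ← integral_sub (integrable_biField hlam hw hf.isDens hf.isDens x)
        (integrable_biField hlam hw hg.isDens hg.isDens x),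
      ← integral_add (integrable_biField hlam hw hs hf.isDens x)
        (integrable_biField hlam hw hg.isDens hs x)]
    exact integral_congr_ae (Eventually.of_forall fun p => by simp only; ring)
  rw [e]
  refine (abs_add_le _ _).trans ((add_le_add (abs_biField_le hlam hw hs hf.isDens x)
    (abs_biField_le hlam hw hg.isDens hs x)).trans (le_of_eq (by ring)))

/-- The nonlinearity `½ (∫ V |f|² |f|²) f` of the equation, as an element of `L²` (and `0` if it
is not square integrable). -/
def nonlin (V : R3 → R3 → R3 → ℝ) (f : L2) : L2 :=
  open Classical in
  if h : MemLp (fun x => (1 / 2 : ℂ) * (meanField V f x : ℂ) * f x) 2 volume then h.toLp _ else 0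

theorem measurable_half_meanField (lam : ℝ) (hw : IsPairKernel w) (f : L2) :
    Measurable fun x => (1 / 2 : ℂ) * (meanField (threeBody lam w) f x : ℂ) :=
  (Complex.measurable_ofReal.comp (measurable_meanField lam hw f)).const_mul _

theorem norm_half_ofReal (r : ℝ) : ‖(1 / 2 : ℂ) * (r : ℂ)‖ = 1 / 2 * |r| := by
  simp

theorem norm_half_meanField_le (hlam : 0 ≤ lam) (hw : IsPairKernel w) (hf : H1Bound f R) (x : R3) :
    ‖(1 / 2 : ℂ) * (meanField (threeBody lam w) f x : ℂ)‖ ≤ 24 * lam * R ^ 4 := by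
  rw [norm_half_ofReal]
  linarith [abs_meanField_le hlam hw hf x]

theorem coeFn_nonlin (hlam : 0 ≤ lam) (hw : IsPairKernel w) (hf : H1Bound f R) :
    nonlin (threeBody lam w) f =ᵐ[volume]
      fun x => (1 / 2 : ℂ) * (meanField (threeBody lam w) f x : ℂ) * f x := by
  have h := memLp_bdd_mul (measurable_half_meanField lam hw f)
    (norm_half_meanField_le hlam hw hf) f
  rw [nonlin, dif_pos h]
  exact h.coeFn_toLp

theorem norm_mulL_le {b : R3 → ℂ} (hb : Measurable b) {C : ℝ} (hC : ∀ x, ‖b x‖ ≤ C) (f : L2) :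
    ‖mulL b hb C hC f‖ ≤ C * ‖f‖ := by
  refine Lp.norm_le_mul_norm_of_ae_le_mul ?_
  filter_upwards [coeFn_mulL hb hC f] with x hx
  rw [hx, norm_mul]
  exact mul_le_mul_of_nonneg_right (hC x) (norm_nonneg _)

theorem norm_nonlin_le (hlam : 0 ≤ lam) (hw : IsPairKernel w) (hf : H1Bound f R) :
    ‖nonlin (threeBody lam w) f‖ ≤ 24 * lam * R ^ 5 := by
  have h : ‖nonlin (threeBody lam w) f‖ ≤ 24 * lam * R ^ 4 * ‖f‖ := by
    refine Lp.norm_le_mul_norm_of_ae_le_mul ?_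
    filter_upwards [coeFn_nonlin hlam hw hf] with x hx
    rw [hx, norm_mul]
    exact mul_le_mul_of_nonneg_right (norm_half_meanField_le hlam hw hf x) (norm_nonneg _)
  have h2 := hf.norm_le
  have h3 := hf.nonneg
  calc _ ≤ 24 * lam * R ^ 4 * R := h.trans (by gcongr)
    _ = _ := by ring

/-- Writing W for the mean field, F(f) - F(g) = ½(W_f - W_g)f + ½W_g(f - g), and 96 + 24 = 120. The
bound involves only the L² distance, so Gronwall closes in L². -/
theorem norm_nonlin_sub_le (hlam : 0 ≤ lam) (hw : IsPairKernel w) (hf : H1Bound f R)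
    (hg : H1Bound g R) :
    ‖nonlin (threeBody lam w) f - nonlin (threeBody lam w) g‖ ≤ 120 * lam * R ^ 4 * ‖f - g‖ := by
  set b : R3 → ℂ := fun x => (1 / 2 : ℂ) *
    ((meanField (threeBody lam w) f x - meanField (threeBody lam w) g x : ℝ) : ℂ)
  have hb : Measurable b := (Complex.measurable_ofReal.comp
    ((measurable_meanField lam hw f).sub (measurable_meanField lam hw g))).const_mul _
  have hC : ∀ x, ‖b x‖ ≤ 96 * lam * R ^ 3 * ‖f - g‖ := fun x => by
    rw [norm_half_ofReal]
    linarith [abs_meanField_sub_le hlam hw hf hg x]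
  have hg1 := measurable_half_meanField lam hw g
  have hg2 := norm_half_meanField_le hlam hw hg
  have e : nonlin (threeBody lam w) f - nonlin (threeBody lam w) g =
      mulL b hb _ hC f + mulL _ hg1 _ hg2 (f - g) := by
    ext1
    filter_upwards [Lp.coeFn_sub (nonlin (threeBody lam w) f) (nonlin (threeBody lam w) g),
      Lp.coeFn_add (mulL b hb _ hC f) (mulL _ hg1 _ hg2 (f - g)), coeFn_nonlin hlam hw hf,
      coeFn_nonlin hlam hw hg, coeFn_mulL hb hC f, coeFn_mulL hg1 hg2 (f - g),
      Lp.coeFn_sub f g] with x h1 h2 h3 h4 h5 h6 h7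
    rw [h1, h2, Pi.sub_apply, Pi.add_apply, h3, h4, h5, h6, h7, Pi.sub_apply]
    simp only [b]
    push_cast
    ring
  rw [e]
  have h3 := hf.nonneg
  calc _ ≤ 96 * lam * R ^ 3 * ‖f - g‖ * ‖f‖ + 24 * lam * R ^ 4 * ‖f - g‖ :=
        (norm_add_le _ _).trans (add_le_add (norm_mulL_le hb hC f) (norm_mulL_le hg1 hg2 (f - g)))
    _ ≤ 96 * lam * R ^ 3 * ‖f - g‖ * R + 24 * lam * R ^ 4 * ‖f - g‖ := by
        have := hf.norm_le
        gcongr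
    _ = _ := by ring

/-- The potential energy `∫ V(x,y,z) |f(x)|² |f(y)|² |f(z)|²`. -/
def potEnergy (V : R3 → R3 → R3 → ℝ) (f : L2) : ℝ := triForm V (dens f) (dens f) (dens f)

/-- The density `|f - g|²`. -/
def diffDens (f g : L2) (x : R3) : ℝ := ‖f x - g x‖ ^ 2

theorem measurable_diffDens (f g : L2) : Measurable (diffDens f g) :=
  ((measurable_coe f).sub (measurable_coe g)).norm.pow_const 2

theorem diffDens_ae (f g : L2) : diffDens f g =ᵐ[volume] dens (f - g) := by
  filter_upwards [Lp.coeFn_sub f g] with x hx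
  rw [diffDens, dens, hx, Pi.sub_apply]

theorem integrable_diffDens (f g : L2) : Integrable (diffDens f g) :=
  (integrable_dens (f - g)).congr (diffDens_ae f g).symm

theorem integral_diffDens (f g : L2) : ∫ x, diffDens f g x = ‖f - g‖ ^ 2 := by
  rw [integral_congr_ae (diffDens_ae f g), integral_dens]

/-- The mean field is real, so only Re⟨f(x), g(x)⟩ = ½(|f|² + |g|² - |f - g|²) matters. This
polarisation expresses everything through densities. -/
theorem re_inner_nonlin (hlam : 0 ≤ lam) (hw : IsPairKernel w) (f : L2) (hg : H1Bound g R) :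
    RCLike.re (inner ℂ f (nonlin (threeBody lam w) g)) =
      1 / 4 * (triForm (threeBody lam w) (dens f) (dens g) (dens g) +
        potEnergy (threeBody lam w) g -
        triForm (threeBody lam w) (diffDens f g) (dens g) (dens g)) := by
  have hd := hg.isDens
  have hIb : ∀ {p : R3 → ℝ}, Integrable p →
      Integrable fun x => p x * meanField (threeBody lam w) g x := fun hp =>
    hp.mul_bdd (c := 48 * lam * R ^ 4) (measurable_meanField lam hw g).aestronglyMeasurable
      (Eventually.of_forall fun x => abs_meanField_le hlam hw hg x)
  rw [potEnergy, triForm_eq_integral hlam hw (measurable_dens f) (integrable_dens f) hd hd,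
    triForm_eq_integral hlam hw (measurable_dens g) (integrable_dens g) hd hd,
    triForm_eq_integral hlam hw (measurable_diffDens f g) (integrable_diffDens f g) hd hd,
    ← meanField_eq_biField, ← integral_add (hIb (integrable_dens f)) (hIb (integrable_dens g)),
    ← integral_sub (integrable_fun_add (hIb (integrable_dens f)) (hIb (integrable_dens g)))
      (hIb (integrable_diffDens f g)), ← integral_const_mul, MeasureTheory.L2.inner_def,
    ← integral_re (MeasureTheory.L2.integrable_inner _ _)]
  refine integral_congr_ae ?_
  filter_upwards [coeFn_nonlin hlam hw hg] with x hx
  rw [hx]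
  simp only [dens, diffDens]
  have h := norm_sub_sq (𝕜 := ℂ) (f x) (g x)
  rw [h]
  have h2 : (1 / 2 : ℂ) * (meanField (threeBody lam w) g x : ℂ) * g x =
      (1 / 2 * meanField (threeBody lam w) g x : ℝ) • g x := by
    rw [Complex.real_smul]; push_cast; ring
  rw [h2, inner_smul_right_eq_smul, RCLike.smul_re]
  ring

theorem re_inner_self_nonlin (hlam : 0 ≤ lam) (hw : IsPairKernel w) (hg : H1Bound g R) :
    RCLike.re (inner ℂ g (nonlin (threeBody lam w) g)) =
      1 / 2 * potEnergy (threeBody lam w) g := by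
  rw [re_inner_nonlin hlam hw g hg]
  have : triForm (threeBody lam w) (diffDens g g) (dens g) (dens g) = 0 := by
    simp [triForm, diffDens]
  rw [this, potEnergy]
  ring

theorem potEnergy_nonneg (hlam : 0 ≤ lam) (hw : IsPairKernel w) (f : L2) :
    0 ≤ potEnergy (threeBody lam w) f :=
  integral_nonneg fun _ => mul_nonneg (threeBody_nonneg hlam hw _ _ _)
    (mul_nonneg (dens_nonneg _ _) (mul_nonneg (dens_nonneg _ _) (dens_nonneg _ _)))

theorem potEnergy_le (hlam : 0 ≤ lam) (hw : IsPairKernel w) (hf : H1Bound f R) :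
    potEnergy (threeBody lam w) f ≤ 48 * lam * R ^ 6 := by
  have h := re_inner_self_nonlin hlam hw hf
  have h1 : RCLike.re (inner ℂ f (nonlin (threeBody lam w) f)) ≤ R * (24 * lam * R ^ 5) :=
    (RCLike.re_le_norm _).trans ((norm_inner_le_norm _ _).trans
      (mul_le_mul hf.norm_le (norm_nonlin_le hlam hw hf) (norm_nonneg _) hf.nonneg))
  nlinarith

theorem integral_abs_dens_sub_le (hf : H1Bound f R) (hg : H1Bound g R) :
    ∫ x, |dens f x - dens g x| ≤ 4 * R ^ 2 := by
  have h : ∫ x, |dens f x - dens g x| ≤ ∫ x, (dens f x + dens g x) := by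
    refine integral_mono ((integrable_dens f).sub (integrable_dens g)).abs
      ((integrable_dens f).add (integrable_dens g)) fun x => ?_
    have h1 := dens_nonneg f x
    have h2 := dens_nonneg g x
    simp only
    rw [abs_le]; constructor <;> linarith
  rw [integral_add (integrable_dens f) (integrable_dens g), integral_dens, integral_dens] at h
  have h1 := pow_le_pow_left₀ (norm_nonneg f) hf.norm_le 2
  have h2 := pow_le_pow_left₀ (norm_nonneg g) hg.norm_le 2
  nlinarith [sq_nonneg R]

/-- The binomial formula for a symmetric trilinear form. It trades the antisymmetric combination of
the mixed terms for a third of the increment of the potential energy and a cubic remainder. -/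
theorem triForm_cube (hlam : 0 ≤ lam) (hw : IsPairKernel w) (hf : H1Bound f R)
    (hg : H1Bound g R) :
    triForm (threeBody lam w) (fun x => dens g x - dens f x) (fun x => dens g x - dens f x)
        (fun x => dens g x - dens f x) =
      potEnergy (threeBody lam w) g - 3 * triForm (threeBody lam w) (dens f) (dens g) (dens g) +
        3 * triForm (threeBody lam w) (dens g) (dens f) (dens f) -
          potEnergy (threeBody lam w) f := by
  have I : ∀ {u v z : L2}, H1Bound u R → H1Bound v R → H1Bound z R →
      Integrable fun s : R3 × R3 × R3 =>
        threeBody lam w s.1 s.2.1 s.2.2 * (dens u s.1 * (dens v s.2.1 * dens z s.2.2)) :=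
    fun {u v z} _ hv hz => integrable_triForm hlam hw (measurable_dens u) (integrable_dens u)
      hv.isDens hz.isDens
  have S := fun {u v : R3 × R3 × R3 → ℝ} (hu : Integrable u) (hv : Integrable v) =>
    integrable_fun_sub hu hv
  set T := threeBody lam w
  have e1 : triForm T (dens g) (dens f) (dens g) = triForm T (dens f) (dens g) (dens g) :=
    triForm_swap_left hw
  have e2 : triForm T (dens g) (dens g) (dens f) = triForm T (dens f) (dens g) (dens g) := by
    rw [← e1]; exact triForm_swap_right
  have e3 : triForm T (dens f) (dens g) (dens f) = triForm T (dens g) (dens f) (dens f) :=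
    triForm_swap_left hw
  have e4 : triForm T (dens f) (dens f) (dens g) = triForm T (dens g) (dens f) (dens f) := by
    rw [← e3]; exact triForm_swap_right
  have key : triForm T (fun x => dens g x - dens f x) (fun x => dens g x - dens f x)
        (fun x => dens g x - dens f x) =
      ((triForm T (dens g) (dens g) (dens g) - triForm T (dens f) (dens g) (dens g)) -
      (triForm T (dens g) (dens f) (dens g) - triForm T (dens f) (dens f) (dens g))) -
      ((triForm T (dens g) (dens g) (dens f) - triForm T (dens f) (dens g) (dens f)) -
      (triForm T (dens g) (dens f) (dens f) - triForm T (dens f) (dens f) (dens f))) := by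
    unfold triForm
    rw [← integral_sub (I hg hg hg) (I hf hg hg), ← integral_sub (I hg hf hg) (I hf hf hg),
      ← integral_sub (I hg hg hf) (I hf hg hf), ← integral_sub (I hg hf hf) (I hf hf hf),
      ← integral_sub (S (I hg hg hg) (I hf hg hg)) (S (I hg hf hg) (I hf hf hg)),
      ← integral_sub (S (I hg hg hf) (I hf hg hf)) (S (I hg hf hf) (I hf hf hf)),
      ← integral_sub (S (S (I hg hg hg) (I hf hg hg)) (S (I hg hf hg) (I hf hf hg)))
        (S (S (I hg hg hf) (I hf hg hf)) (S (I hg hf hf) (I hf hf hf)))]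
    refine integral_congr_ae (Eventually.of_forall fun s => ?_)
    simp only
    ring
  rw [key, e1, e2, e3, e4, potEnergy, potEnergy]
  ring

/-- Up to quadratic terms, the antisymmetric part of `⟨f, F(g)⟩` is the increment of the potential
energy. -/
theorem abs_re_inner_nonlin_sub_le (hlam : 0 ≤ lam) (hw : IsPairKernel w) (hf : H1Bound f R)
    (hg : H1Bound g R) :
    |RCLike.re (inner ℂ f (nonlin (threeBody lam w) g)) -
        RCLike.re (inner ℂ g (nonlin (threeBody lam w) f)) -
        1 / 3 * (potEnergy (threeBody lam w) g - potEnergy (threeBody lam w) f)| ≤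
      100 * lam * R ^ 4 * ‖g - f‖ ^ 2 := by
  have hc := triForm_cube hlam hw hf hg
  have hs := isDens_sub hg hf
  -- In the cubic remainder two factors give ‖g - f‖ each and the third is bounded by its L¹ norm,
  -- at most 4R². In total 768/12 + 2 · 48/4 = 88 ≤ 100.
  have b1 := abs_triForm_le hlam hw hs.measurable hs.integrable hs hs
  rw [hc] at b1
  have b2 := abs_triForm_le hlam hw (measurable_diffDens f g) (integrable_diffDens f g)
    hg.isDens hg.isDens
  have b3 := abs_triForm_le hlam hw (measurable_diffDens g f) (integrable_diffDens g f)
    hf.isDens hf.isDens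
  have hab : ∀ u v : L2, ∫ x, |diffDens u v x| = ‖u - v‖ ^ 2 := fun u v => by
    rw [← integral_diffDens]
    exact integral_congr_ae (Eventually.of_forall fun x => abs_of_nonneg (sq_nonneg _))
  rw [hab] at b2 b3
  rw [norm_sub_rev] at b2
  rw [re_inner_nonlin hlam hw f hg, re_inner_nonlin hlam hw g hf]
  have b4 := integral_abs_dens_sub_le hg hf
  have b5 : 3 * lam * (8 * R * ‖g - f‖ * (8 * R * ‖g - f‖)) * ∫ x, |dens g x - dens f x| ≤
      3 * lam * (8 * R * ‖g - f‖ * (8 * R * ‖g - f‖)) * (4 * R ^ 2) := by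
    have := hf.nonneg
    gcongr
  have b6 := b1.trans b5
  have hpos : 0 ≤ lam * R ^ 4 * ‖g - f‖ ^ 2 := by positivity
  rw [abs_le] at b2 b3 b6 ⊢
  constructor <;> linarith [b2.1, b2.2, b3.1, b3.2, b6.1, b6.2]

end NonlinearBounds

/-! ### The effect of the cut-off -/

section CutOff

/-- The Coulomb potential restricted to the ball of radius `α`. -/
def nearCoulomb (α : ℝ) (x : R3) : ℝ := if ‖x‖ < α then coulomb x else 0

theorem nearCoulomb_nonneg (α : ℝ) (x : R3) : 0 ≤ nearCoulomb α x := by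
  unfold nearCoulomb; split_ifs <;> simp [coulomb_nonneg]

theorem measurable_nearCoulomb (α : ℝ) : Measurable (nearCoulomb α) :=
  Measurable.ite (measurableSet_lt measurable_norm measurable_const) measurable_coulomb
    measurable_const

theorem nearCoulomb_neg (α : ℝ) (x : R3) : nearCoulomb α (-x) = nearCoulomb α x := by
  simp [nearCoulomb, coulomb_neg]

theorem coulomb_sub_cutCoulomb_le {α : ℝ} (hα : 0 < α) (x : R3) :
    coulomb x - cutCoulomb α x ≤ nearCoulomb α x := by
  rw [cutCoulomb_eq hα, nearCoulomb]
  split_ifs with h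
  · have : 0 ≤ min (coulomb x) α⁻¹ := le_min (coulomb_nonneg x) (inv_nonneg.2 hα.le)
    linarith
  · have : coulomb x ≤ α⁻¹ := by
      rw [coulomb, one_div]; exact inv_anti₀ hα (not_lt.1 h)
    rw [min_eq_left this, sub_self]

/-- With a' ≤ a, ab - a'b' = (a - a')b + a'(b - b'): every term of the error carries a factor
supported in the ball of radius α. -/
theorem abs_mul_sub_cut_le {α : ℝ} (hα : 0 < α) (x y : R3) :
    coulomb x * coulomb y - cutCoulomb α x * cutCoulomb α y ≤
      nearCoulomb α x * coulomb y + coulomb x * nearCoulomb α y := by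
  have h1 := coulomb_sub_cutCoulomb_le hα x
  have h2 := coulomb_sub_cutCoulomb_le hα y
  have h3 := (isPairKernel_cutCoulomb hα).le_coulomb x
  have h5 := coulomb_nonneg y
  have h6 := nearCoulomb_nonneg α y
  have h7 := (isPairKernel_cutCoulomb hα).nonneg x
  nlinarith [mul_le_mul_of_nonneg_right h1 h5, mul_le_mul_of_nonneg_left h2 h7,
    mul_le_mul_of_nonneg_right h3 h6]

theorem threeBody_sub_cut_le {lam : ℝ} (hlam : 0 ≤ lam) {α : ℝ} (hα : 0 < α) (x y z : R3) :
    |threeBody lam coulomb x y z - threeBody lam (cutCoulomb α) x y z| ≤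
      lam * ((nearCoulomb α (x - y) * coulomb (x - z) + coulomb (x - y) * nearCoulomb α (x - z)) +
        (nearCoulomb α (y - z) * coulomb (x - y) + coulomb (y - z) * nearCoulomb α (x - y)) +
        (nearCoulomb α (x - z) * coulomb (z - y) + coulomb (x - z) * nearCoulomb α (z - y))) := by
  rw [abs_of_nonneg (sub_nonneg.2 (threeBody_mono hlam (isPairKernel_cutCoulomb hα) x y z))]
  have h1 := abs_mul_sub_cut_le hα (x - y) (x - z)
  have h2 := abs_mul_sub_cut_le hα (y - z) (y - x)
  have h3 := abs_mul_sub_cut_le hα (z - x) (z - y)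
  rw [← neg_sub x y, coulomb_neg, nearCoulomb_neg] at h2
  rw [← neg_sub x z, coulomb_neg, nearCoulomb_neg] at h3
  unfold threeBody
  rw [← neg_sub x y, ← neg_sub x z, coulomb_neg, coulomb_neg, ← mul_sub]
  gcongr
  linarith

/-- The potential of a density generated by the points at distance less than `α`. -/
def nearPot (α : ℝ) (q : R3 → ℝ≥0∞) (x : R3) : ℝ≥0∞ :=
  ∫⁻ y, ENNReal.ofReal (nearCoulomb α (x - y)) * q y

theorem measurable_ofReal_nearCoulomb (α : ℝ) :
    Measurable fun x => ENNReal.ofReal (nearCoulomb α x) :=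
  (measurable_nearCoulomb α).ennreal_ofReal

theorem measurable_nearPot (α : ℝ) {q : R3 → ℝ≥0∞} (hq : Measurable q) :
    Measurable (nearPot α q) := by
  have h : Measurable fun p : R3 × R3 => ENNReal.ofReal (nearCoulomb α (p.1 - p.2)) * q p.2 :=
    ((measurable_ofReal_nearCoulomb α).comp (measurable_fst.sub measurable_snd)).mul
      (hq.comp measurable_snd)
  exact h.lintegral_prod_right'

/-- Six terms arise. In four of them the near kernel joins x to one of the points and the other
factor integrates to at most A. In the other two it joins the two integrated points, which gives the
Coulomb potential of q · `nearPot α q`. -/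
theorem lintegral_threeBody_sub_cut_le {lam : ℝ} (hlam : 0 ≤ lam) {α : ℝ} (hα : 0 < α)
    {q : R3 → ℝ≥0∞} (hq : Measurable q) {A : ℝ≥0∞} (hA : ∀ x, pot q x ≤ A) (x : R3) :
    ∫⁻ p : R3 × R3, ‖threeBody lam coulomb x p.1 p.2 -
        threeBody lam (cutCoulomb α) x p.1 p.2‖ₑ * (q p.1 * q p.2) ≤
      ENNReal.ofReal lam * (4 * (A * nearPot α q x) +
        2 * pot (fun y => q y * nearPot α q y) x) := by
  set c : R3 → ℝ≥0∞ := fun x => ENNReal.ofReal (coulomb x) with hc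
  set k : R3 → ℝ≥0∞ := fun x => ENNReal.ofReal (nearCoulomb α x) with hk
  have hcm : Measurable c := measurable_ofReal_coulomb
  have hkm : Measurable k := measurable_ofReal_nearCoulomb α
  have hKm := measurable_nearPot α hq
  have hsym : ∀ a b : R3, k (a - b) = k (b - a) := fun a b => by
    simp only [hk]; rw [← nearCoulomb_neg, neg_sub]
  have hsymc : ∀ a b : R3, c (a - b) = c (b - a) := fun a b => by
    simp only [hc]; rw [← coulomb_neg, neg_sub]
  set s1 : R3 × R3 → ℝ≥0∞ := fun p => (k (x - p.1) * q p.1) * (c (x - p.2) * q p.2) with hs1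
  set s2 : R3 × R3 → ℝ≥0∞ := fun p => (c (x - p.1) * q p.1) * (k (x - p.2) * q p.2) with hs2
  set s3 : R3 × R3 → ℝ≥0∞ := fun p => (c (x - p.1) * q p.1) * (k (p.1 - p.2) * q p.2) with hs3
  set s4 : R3 × R3 → ℝ≥0∞ := fun p => (k (x - p.1) * q p.1) * (c (p.1 - p.2) * q p.2) with hs4
  set s5 : R3 × R3 → ℝ≥0∞ := fun p => (k (x - p.2) * q p.2) * (c (p.2 - p.1) * q p.1) with hs5
  set s6 : R3 × R3 → ℝ≥0∞ := fun p => (c (x - p.2) * q p.2) * (k (p.2 - p.1) * q p.1) with hs6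
  have h1 : ∀ p : R3 × R3, ‖threeBody lam coulomb x p.1 p.2 -
      threeBody lam (cutCoulomb α) x p.1 p.2‖ₑ * (q p.1 * q p.2) ≤
      ENNReal.ofReal lam * (s1 p + s2 p + s3 p + s4 p + s5 p + s6 p) := by
    intro p
    have hn := coulomb_nonneg
    have hn' := nearCoulomb_nonneg α
    have h2 := ENNReal.ofReal_le_ofReal (threeBody_sub_cut_le hlam hα x p.1 p.2)
    rw [ENNReal.ofReal_mul hlam,
      ENNReal.ofReal_add (add_nonneg
        (add_nonneg (mul_nonneg (hn' _) (hn _)) (mul_nonneg (hn _) (hn' _)))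
        (add_nonneg (mul_nonneg (hn' _) (hn _)) (mul_nonneg (hn _) (hn' _))))
        (add_nonneg (mul_nonneg (hn' _) (hn _)) (mul_nonneg (hn _) (hn' _))),
      ENNReal.ofReal_add
        (add_nonneg (mul_nonneg (hn' _) (hn _)) (mul_nonneg (hn _) (hn' _)))
        (add_nonneg (mul_nonneg (hn' _) (hn _)) (mul_nonneg (hn _) (hn' _))),
      ENNReal.ofReal_add (mul_nonneg (hn' _) (hn _)) (mul_nonneg (hn _) (hn' _)),
      ENNReal.ofReal_add (mul_nonneg (hn' _) (hn _)) (mul_nonneg (hn _) (hn' _)),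
      ENNReal.ofReal_add (mul_nonneg (hn' _) (hn _)) (mul_nonneg (hn _) (hn' _)),
      ENNReal.ofReal_mul (hn' _), ENNReal.ofReal_mul (hn _), ENNReal.ofReal_mul (hn' _),
      ENNReal.ofReal_mul (hn _), ENNReal.ofReal_mul (hn' _), ENNReal.ofReal_mul (hn _),
      ← Real.enorm_eq_ofReal_abs] at h2
    refine (mul_le_mul_left h2 (q p.1 * q p.2)).trans (le_of_eq ?_)
    simp only [hs1, hs2, hs3, hs4, hs5, hs6, hc, hk]
    ring
  have mk : Measurable fun y => k (x - y) * q y := by fun_prop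
  have mc : Measurable fun y => c (x - y) * q y := by fun_prop
  have M1 : Measurable s1 := by fun_prop
  have M2 : Measurable s2 := by fun_prop
  have M3 : Measurable s3 := by fun_prop
  have M4 : Measurable s4 := by fun_prop
  have M5 : Measurable s5 := by fun_prop
  have M6 : Measurable s6 := by fun_prop
  refine (lintegral_mono h1).trans ?_
  rw [lintegral_const_mul' _ _ ENNReal.ofReal_ne_top, lintegral_add_right _ M6,
    lintegral_add_right _ M5, lintegral_add_right _ M4, lintegral_add_right _ M3,
    lintegral_add_right _ M2]
  set K := nearPot α q with hK
  set Z := pot (fun y => q y * K y) x with hZ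
  have t1 : ∫⁻ p, s1 p ≤ A * K x := by
    rw [Measure.volume_eq_prod, lintegral_prod_mul mk.aemeasurable mc.aemeasurable, mul_comm A]
    exact mul_le_mul' le_rfl (hA x)
  have t2 : ∫⁻ p, s2 p ≤ A * K x := by
    rw [Measure.volume_eq_prod, lintegral_prod_mul mc.aemeasurable mk.aemeasurable]
    exact mul_le_mul' (hA x) le_rfl
  have t3 : ∫⁻ p, s3 p ≤ Z := by
    rw [Measure.volume_eq_prod, lintegral_prod _ M3.aemeasurable]
    refine lintegral_mono fun y => ?_
    simp only [hs3]
    rw [lintegral_const_mul _ (by fun_prop), mul_assoc]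
    exact le_rfl
  have t4 : ∫⁻ p, s4 p ≤ A * K x := by
    rw [Measure.volume_eq_prod, lintegral_prod _ M4.aemeasurable]
    calc _ ≤ ∫⁻ y, A * (k (x - y) * q y) := by
          refine lintegral_mono fun y => ?_
          simp only [hs4]
          rw [lintegral_const_mul _ (by fun_prop), mul_comm A]
          gcongr
          exact hA y
      _ = _ := lintegral_const_mul _ mk
  have t5 : ∫⁻ p, s5 p ≤ A * K x := by
    rw [Measure.volume_eq_prod, lintegral_prod_symm _ M5.aemeasurable]
    calc _ ≤ ∫⁻ y, A * (k (x - y) * q y) := by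
          refine lintegral_mono fun y => ?_
          simp only [hs5]
          rw [lintegral_const_mul _ (by fun_prop), mul_comm A]
          gcongr
          exact hA y
      _ = _ := lintegral_const_mul _ mk
  have t6 : ∫⁻ p, s6 p ≤ Z := by
    rw [Measure.volume_eq_prod, lintegral_prod_symm _ M6.aemeasurable]
    refine lintegral_mono fun y => ?_
    simp only [hs6]
    rw [lintegral_const_mul _ (by fun_prop), mul_assoc]
    exact le_rfl
  calc _ ≤ ENNReal.ofReal lam * (A * K x + A * K x + Z + A * K x + A * K x + Z) := by gcongr
    _ = _ := by ring

/-- Bound on the mass of pairs of points at distance less than `α`, divided by `α³`. -/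
def pairConst (R : ℝ) : ℝ := 2 * (3 * R ^ 2 + 432 * R ^ 6)

theorem pairConst_nonneg (R : ℝ) : 0 ≤ pairConst R := by unfold pairConst; positivity

variable {f : L2} {R α : ℝ}

theorem nearCoulomb_ofReal (α : ℝ) (z : R3) : ENNReal.ofReal (nearCoulomb α z) =
    (if ‖z‖ < α then 1 else 0) * ENNReal.ofReal (coulomb z) := by
  unfold nearCoulomb; split_ifs <;> simp

theorem measurable_near_ind (α : ℝ) :
    Measurable fun z : R3 => if ‖z‖ < α then (1 : ℝ≥0∞) else 0 :=
  Measurable.ite (measurableSet_lt measurable_norm measurable_const) measurable_const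
    measurable_const

/-- The near kernel is Coulomb times an indicator. Cauchy–Schwarz gives a Hardy integral times the
mass within distance α of x, and integration against |f|² turns the latter into the mass of close
pairs. -/
theorem lintegral_nearPot_sq_le (hf : H1Bound f R) (hα : 0 < α) :
    ∫⁻ x, ‖f x‖ₑ ^ 2 * nearPot α (fun y => ‖f y‖ₑ ^ 2) x ^ 2 ≤
      ENNReal.ofReal (12 * R ^ 2 * (α ^ 3 * pairConst R)) := by
  have hfm := measurable_coe f
  have hK : ∀ x, nearPot α (fun y => ‖f y‖ₑ ^ 2) x ^ 2 ≤ ENNReal.ofReal (12 * R ^ 2) *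
      ∫⁻ y, (if ‖x - y‖ < α then 1 else 0) * ‖f y‖ₑ ^ 2 := by
    intro x
    have hi : Measurable fun y : R3 => if ‖x - y‖ < α then (1 : ℝ≥0∞) else 0 :=
      (measurable_near_ind α).comp (measurable_const.sub measurable_id)
    have hcm : Measurable fun y => ENNReal.ofReal (coulomb (x - y)) :=
      measurable_ofReal_coulomb.comp (measurable_const.sub measurable_id)
    have h := lintegral_mul_sq_le (μ := volume) (hcm.mul hfm.enorm).aemeasurable
      (hi.mul hfm.enorm).aemeasurable
    calc _ = (∫⁻ y, (ENNReal.ofReal (coulomb (x - y)) * ‖f y‖ₑ) *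
          ((if ‖x - y‖ < α then 1 else 0) * ‖f y‖ₑ)) ^ 2 := by
          rw [nearPot]
          congr 1
          refine lintegral_congr fun y => ?_
          rw [nearCoulomb_ofReal]; ring
      _ ≤ _ := h
      _ ≤ _ := by
          refine mul_le_mul' ?_ (lintegral_mono fun y => ?_)
          · simp only [Pi.mul_apply, mul_pow]
            exact (lintegral_coulomb_sq_le hf.finiteKin x).trans
              (ENNReal.ofReal_le_ofReal (by linarith [hf.kin_le]))
          · simp only [Pi.mul_apply, mul_pow]
            gcongr
            split_ifs <;> simp
  have hp := lintegral_pairs_le (Lp.memLp f) hfm (integral_trans_sub_le hf.finiteKin) hα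
  rw [← norm_sq_eq_integral] at hp
  calc _ ≤ ∫⁻ x, ENNReal.ofReal (12 * R ^ 2) * (‖f x‖ₑ ^ 2 *
        ∫⁻ y, (if ‖x - y‖ < α then 1 else 0) * ‖f y‖ₑ ^ 2) := by
        refine lintegral_mono fun x => ?_
        simp only
        rw [mul_left_comm]
        gcongr
        exact hK x
    _ ≤ ENNReal.ofReal (12 * R ^ 2) * ENNReal.ofReal (α ^ 3 * pairConst R) := by
        rw [lintegral_const_mul' _ _ ENNReal.ofReal_ne_top]
        gcongr
        refine hp.trans (ENNReal.ofReal_le_ofReal ?_)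
        have hk0 := kin_nonneg f
        have h1 := pow_le_pow_left₀ (norm_nonneg f) hf.norm_le 2
        have h2 := hf.kin_le
        have h3 : √(kin f) ^ 4 = kin f ^ 2 := by
          rw [show (4 : ℕ) = 2 * 2 from rfl, pow_mul, Real.sq_sqrt hk0]
        rw [h3, Real.sq_sqrt hk0, pairConst]
        calc _ ≤ 2 * α ^ 3 * (3 * R ^ 2 + 432 * (R ^ 2) ^ 2 * R ^ 2) := by gcongr
          _ = _ := by ring
    _ = _ := (ENNReal.ofReal_mul (by positivity)).symm

theorem lintegral_mul_nearPot_sq_le (hf : H1Bound f R) (hα : 0 < α) :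
    (∫⁻ x, ‖f x‖ₑ ^ 2 * nearPot α (fun y => ‖f y‖ₑ ^ 2) x) ^ 2 ≤
      ENNReal.ofReal (12 * R ^ 4 * (α ^ 3 * pairConst R)) := by
  have hfm := measurable_coe f
  have hKm := measurable_nearPot α (hfm.enorm.pow_const 2)
  have h := lintegral_mul_sq_le (μ := volume) hfm.enorm.aemeasurable
    (hfm.enorm.mul hKm).aemeasurable
  calc _ = (∫⁻ x, ‖f x‖ₑ * (‖f x‖ₑ * nearPot α (fun y => ‖f y‖ₑ ^ 2) x)) ^ 2 := by
        congr 1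
        exact lintegral_congr fun y => by ring
    _ ≤ _ := h
    _ ≤ ENNReal.ofReal (R ^ 2) * ENNReal.ofReal (12 * R ^ 2 * (α ^ 3 * pairConst R)) := by
        gcongr
        · rw [lintegral_enorm_sq]
          exact ENNReal.ofReal_le_ofReal (pow_le_pow_left₀ (norm_nonneg f) hf.norm_le 2)
        · simp only [Pi.mul_apply, mul_pow]
          exact lintegral_nearPot_sq_le hf hα
    _ = _ := by
        rw [← ENNReal.ofReal_mul (by positivity)]; congr 1; ring

/-- Let K be the near potential and P = ∫|f|²K. Cauchy–Schwarz for the weight |f|²K bounds the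
squared potential by P ∫|x-y|⁻²|f(y)|²K(y)dy. After exchanging the integrals, Hardy's inequality in
x gives 12R²P², and P² is of order α³. -/
theorem lintegral_pot_nearPot_sq_le (hf : H1Bound f R) (hα : 0 < α) :
    ∫⁻ x, ‖f x‖ₑ ^ 2 *
        pot (fun y => ‖f y‖ₑ ^ 2 * nearPot α (fun y => ‖f y‖ₑ ^ 2) y) x ^ 2 ≤
      ENNReal.ofReal (144 * R ^ 6 * (α ^ 3 * pairConst R)) := by
  have hfm := measurable_coe f
  set K := nearPot α (fun y => ‖f y‖ₑ ^ 2) with hK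
  have hKm : Measurable K := measurable_nearPot α (hfm.enorm.pow_const 2)
  have hcm := measurable_ofReal_coulomb
  set P := ∫⁻ x, ‖f x‖ₑ ^ 2 * K x with hP
  have hP2 : P ^ 2 ≤ _ := lintegral_mul_nearPot_sq_le hf hα
  have hPtop : P ≠ ∞ := by
    intro h
    rw [h] at hP2
    simp at hP2
  have hZ : ∀ x, pot (fun y => ‖f y‖ₑ ^ 2 * K y) x ^ 2 ≤
      (∫⁻ y, ENNReal.ofReal (coulomb (x - y)) ^ 2 * (‖f y‖ₑ ^ 2 * K y)) * P := by
    intro x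
    have hcx : Measurable fun y => ENNReal.ofReal (coulomb (x - y)) :=
      hcm.comp (measurable_const.sub measurable_id)
    have hsq : Measurable fun y => (‖f y‖ₑ ^ 2 * K y) ^ (1 / 2 : ℝ) :=
      ((hfm.enorm.pow_const 2).mul hKm).pow_const _
    have h := lintegral_mul_sq_le (μ := volume) (hcx.mul hsq).aemeasurable hsq.aemeasurable
    have hs : ∀ t : ℝ≥0∞, t ^ (1 / 2 : ℝ) * t ^ (1 / 2 : ℝ) = t := fun t => by
      rw [← ENNReal.rpow_add_of_nonneg _ _ (by norm_num) (by norm_num)]; norm_num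
    have hs2 : ∀ t : ℝ≥0∞, (t ^ (1 / 2 : ℝ)) ^ 2 = t := fun t => by rw [pow_two, hs]
    simp only [Pi.mul_apply, mul_pow, hs2, mul_assoc] at h
    simp only [hs] at h
    simp only [pot]
    exact h
  have hI : ∫⁻ x, ∫⁻ y, ‖f x‖ₑ ^ 2 * (ENNReal.ofReal (coulomb (x - y)) ^ 2 * (‖f y‖ₑ ^ 2 * K y)) ≤
      ENNReal.ofReal (12 * R ^ 2) * P := by
    have hm : Measurable fun p : R3 × R3 => ‖f p.1‖ₑ ^ 2 *
        (ENNReal.ofReal (coulomb (p.1 - p.2)) ^ 2 * (‖f p.2‖ₑ ^ 2 * K p.2)) := by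
      have h1 := hcm.comp (measurable_fst.sub measurable_snd : Measurable fun p : R3 × R3 =>
        p.1 - p.2)
      exact ((hfm.comp measurable_fst).enorm.pow_const 2).mul ((h1.pow_const 2).mul
        (((hfm.comp measurable_snd).enorm.pow_const 2).mul (hKm.comp measurable_snd)))
    rw [lintegral_lintegral_swap (f := fun x y => ‖f x‖ₑ ^ 2 *
        (ENNReal.ofReal (coulomb (x - y)) ^ 2 * (‖f y‖ₑ ^ 2 * K y))) hm.aemeasurable, hP,
      ← lintegral_const_mul' _ _ ENNReal.ofReal_ne_top]
    refine lintegral_mono fun y => ?_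
    simp only
    have hmy : Measurable fun x => ENNReal.ofReal (coulomb (y - x)) ^ 2 * ‖f x‖ₑ ^ 2 :=
      ((hcm.comp (measurable_const.sub measurable_id)).pow_const 2).mul (hfm.enorm.pow_const 2)
    calc _ = ∫⁻ x, (ENNReal.ofReal (coulomb (y - x)) ^ 2 * ‖f x‖ₑ ^ 2) * (‖f y‖ₑ ^ 2 * K y) := by
          refine lintegral_congr fun x => ?_
          rw [← coulomb_neg, neg_sub]; ring
      _ = (∫⁻ x, ENNReal.ofReal (coulomb (y - x)) ^ 2 * ‖f x‖ₑ ^ 2) * (‖f y‖ₑ ^ 2 * K y) :=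
          lintegral_mul_const _ hmy
      _ ≤ _ := by
          gcongr
          exact (lintegral_coulomb_sq_le hf.finiteKin y).trans
            (ENNReal.ofReal_le_ofReal (by linarith [hf.kin_le]))
  calc _ ≤ ∫⁻ x, (∫⁻ y, ‖f x‖ₑ ^ 2 *
        (ENNReal.ofReal (coulomb (x - y)) ^ 2 * (‖f y‖ₑ ^ 2 * K y))) * P := by
        refine lintegral_mono fun x => ?_
        simp only
        rw [lintegral_const_mul' _ _ (by simp), mul_assoc]
        gcongr
        exact hZ x
    _ ≤ ENNReal.ofReal (12 * R ^ 2) * P * P := by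
        rw [lintegral_mul_const' _ _ hPtop]
        gcongr
    _ = ENNReal.ofReal (12 * R ^ 2) * P ^ 2 := by ring
    _ ≤ ENNReal.ofReal (12 * R ^ 2) * ENNReal.ofReal (12 * R ^ 4 * (α ^ 3 * pairConst R)) := by
        gcongr
    _ = _ := by
        rw [← ENNReal.ofReal_mul (by positivity)]; congr 1; ring

theorem add_sq_le_two_mul (a b : ℝ≥0∞) : (a + b) ^ 2 ≤ 2 * (a ^ 2 + b ^ 2) := by
  have h := ENNReal.rpow_add_le_mul_rpow_add_rpow a b (p := 2) (by norm_num)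
  norm_num at h
  exact_mod_cast h

/-- The constant in the cut-off error. -/
def cutConst (lam R : ℝ) : ℝ := 1824 * lam ^ 2 * R ^ 6 * pairConst R

theorem cutConst_nonneg (lam R : ℝ) : 0 ≤ cutConst lam R :=
  mul_nonneg (by positivity) (pairConst_nonneg R)

theorem norm_nonlin_sub_cut_sq_le {lam : ℝ} (hlam : 0 ≤ lam) (hf : H1Bound f R) (hα : 0 < α) :
    ‖nonlin (threeBody lam coulomb) f - nonlin (threeBody lam (cutCoulomb α)) f‖ ^ 2 ≤
      cutConst lam R * α ^ 3 := by
  have hfm := measurable_coe f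
  have hpc := pairConst_nonneg R
  have hR := hf.nonneg
  set q : R3 → ℝ≥0∞ := fun y => ‖f y‖ₑ ^ 2 with hq
  have hqm : Measurable q := hfm.enorm.pow_const 2
  set K := nearPot α q with hK
  have hKm : Measurable K := measurable_nearPot α hqm
  set Z := pot (fun y => q y * K y) with hZ
  have hZm : Measurable Z := by
    have h : Measurable fun p : R3 × R3 =>
        ENNReal.ofReal (coulomb (p.1 - p.2)) * (q p.2 * K p.2) :=
      (measurable_ofReal_coulomb.comp (measurable_fst.sub measurable_snd)).mul
        ((hqm.comp measurable_snd).mul (hKm.comp measurable_snd))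
    exact h.lintegral_prod_right'
  set A := ENNReal.ofReal (4 * R ^ 2) with hAdef
  have hd := hf.isDens
  have hA : ∀ x, pot q x ≤ A := fun x => by
    have h := hd.pot_le x
    have h2 : (fun y => ‖dens f y‖ₑ) = q := by
      funext y; simp only [dens, hq]; rw [enorm_pow, enorm_norm]
    rwa [h2] at h
  have hk1 := isPairKernel_coulomb
  have hk2 := isPairKernel_cutCoulomb hα
  have hW : ∀ x, ‖meanField (threeBody lam coulomb) f x -
      meanField (threeBody lam (cutCoulomb α)) f x‖ₑ ≤
      ENNReal.ofReal lam * (4 * (A * K x) + 2 * Z x) := by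
    intro x
    rw [meanField_eq_biField, meanField_eq_biField, biField, biField,
      ← integral_sub (integrable_biField hlam hk1 hd hd x) (integrable_biField hlam hk2 hd hd x)]
    refine (enorm_integral_le_lintegral_enorm _).trans
      (le_trans (le_of_eq ?_) (lintegral_threeBody_sub_cut_le hlam hα hqm hA x))
    refine lintegral_congr fun p => ?_
    rw [← sub_mul, enorm_mul]
    congr 1
    simp only [dens, hq]
    rw [enorm_mul, enorm_pow, enorm_pow, enorm_norm, enorm_norm]
  have hpt : ∀ᵐ x, ‖(nonlin (threeBody lam coulomb) f -
      nonlin (threeBody lam (cutCoulomb α)) f) x‖ₑ ^ 2 ≤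
      ENNReal.ofReal (lam ^ 2) * (8 * A ^ 2 * (q x * K x ^ 2) + 2 * (q x * Z x ^ 2)) := by
    filter_upwards [Lp.coeFn_sub (nonlin (threeBody lam coulomb) f)
      (nonlin (threeBody lam (cutCoulomb α)) f), coeFn_nonlin hlam hk1 hf,
      coeFn_nonlin hlam hk2 hf] with x h1 h2 h3
    rw [h1, Pi.sub_apply, h2, h3]
    have h4 : (1 / 2 : ℂ) * (meanField (threeBody lam coulomb) f x : ℂ) * f x -
        (1 / 2 : ℂ) * (meanField (threeBody lam (cutCoulomb α)) f x : ℂ) * f x =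
        ((1 / 2 : ℝ) : ℂ) * ((meanField (threeBody lam coulomb) f x -
          meanField (threeBody lam (cutCoulomb α)) f x : ℝ) : ℂ) * f x := by
      push_cast; ring
    have e2 : ‖((1 / 2 : ℝ) : ℂ)‖ₑ = ENNReal.ofReal (1 / 2) := by
      rw [← ofReal_norm]; simp
    have e3 : ∀ r : ℝ, ‖(r : ℂ)‖ₑ = ‖r‖ₑ := fun r => by
      rw [← ofReal_norm, ← ofReal_norm, Complex.norm_real]
    rw [h4, enorm_mul, enorm_mul, e2, e3]
    have h5 : ENNReal.ofReal (1 / 2) * ‖meanField (threeBody lam coulomb) f x -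
        meanField (threeBody lam (cutCoulomb α)) f x‖ₑ ≤
        ENNReal.ofReal lam * (2 * (A * K x) + Z x) := by
      calc _ ≤ ENNReal.ofReal (1 / 2) * (ENNReal.ofReal lam * (4 * (A * K x) + 2 * Z x)) := by
            gcongr; exact hW x
        _ = ENNReal.ofReal lam * ((ENNReal.ofReal (1 / 2) * 2) * (2 * (A * K x) + Z x)) := by ring
        _ = _ := by
            rw [show (2 : ℝ≥0∞) = ENNReal.ofReal 2 by simp, ← ENNReal.ofReal_mul (by norm_num)]
            norm_num
    calc _ ≤ (ENNReal.ofReal lam * (2 * (A * K x) + Z x) * ‖f x‖ₑ) ^ 2 := by gcongr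
      _ = ENNReal.ofReal (lam ^ 2) * ((2 * (A * K x) + Z x) ^ 2 * q x) := by
          rw [ENNReal.ofReal_pow hlam]; simp only [hq]; ring
      _ ≤ ENNReal.ofReal (lam ^ 2) * ((2 * ((2 * (A * K x)) ^ 2 + Z x ^ 2)) * q x) := by
          gcongr
          exact add_sq_le_two_mul _ _
      _ = _ := by ring
  have h0 := lintegral_enorm_sq (nonlin (threeBody lam coulomb) f -
    nonlin (threeBody lam (cutCoulomb α)) f)
  have hm1 : Measurable fun x => q x * K x ^ 2 := hqm.mul (hKm.pow_const 2)
  have hm2 : Measurable fun x => q x * Z x ^ 2 := hqm.mul (hZm.pow_const 2)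
  rw [← ENNReal.ofReal_le_ofReal_iff (mul_nonneg (cutConst_nonneg _ _) (by positivity)), ← h0]
  refine (lintegral_mono_ae hpt).trans ?_
  rw [lintegral_const_mul' _ _ ENNReal.ofReal_ne_top, lintegral_add_left (hm1.const_mul _),
    lintegral_const_mul _ hm1, lintegral_const_mul _ hm2]
  -- With A = 4R², the constant 1824 in `cutConst` is 8 · 16 · 12 + 2 · 144.
  calc _ ≤ ENNReal.ofReal (lam ^ 2) * (8 * A ^ 2 *
        ENNReal.ofReal (12 * R ^ 2 * (α ^ 3 * pairConst R)) +
        2 * ENNReal.ofReal (144 * R ^ 6 * (α ^ 3 * pairConst R))) := by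
        gcongr
        · exact lintegral_nearPot_sq_le hf hα
        · exact lintegral_pot_nearPot_sq_le hf hα
    _ = _ := by
        rw [hAdef, ← ENNReal.ofReal_pow (by positivity),
          show (8 : ℝ≥0∞) = ENNReal.ofReal 8 by simp, show (2 : ℝ≥0∞) = ENNReal.ofReal 2 by simp,
          ← ENNReal.ofReal_mul (by norm_num), ← ENNReal.ofReal_mul (by positivity),
          ← ENNReal.ofReal_mul (by norm_num), ← ENNReal.ofReal_add (by positivity) (by positivity),
          ← ENNReal.ofReal_mul (by positivity)]
        congr 1
        rw [cutConst]; ring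

end CutOff

/-! ### The free propagator on the Fourier side -/

section Propagator

/-- The multiplier `e^{it|2πξ|²}`. -/
def propSymb (t : ℝ) (ξ : R3) : ℂ := Complex.exp ((t * symb ξ : ℝ) * Complex.I)

theorem norm_propSymb (t : ℝ) (ξ : R3) : ‖propSymb t ξ‖ = 1 := Complex.norm_exp_ofReal_mul_I _

theorem measurable_propSymb (t : ℝ) : Measurable (propSymb t) := by
  have := measurable_symb
  unfold propSymb
  fun_prop

theorem propSymb_add (s t : ℝ) (ξ : R3) : propSymb (s + t) ξ = propSymb s ξ * propSymb t ξ := by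
  rw [propSymb, propSymb, propSymb, ← Complex.exp_add]
  congr 1
  push_cast
  ring

theorem propSymb_zero (ξ : R3) : propSymb 0 ξ = 1 := by simp [propSymb]

theorem conj_propSymb (t : ℝ) (ξ : R3) : starRingEnd ℂ (propSymb t ξ) = propSymb (-t) ξ := by
  rw [propSymb, propSymb, ← Complex.exp_conj]
  simp

theorem continuous_propSymb (ξ : R3) : Continuous fun t => propSymb t ξ := by
  unfold propSymb
  fun_prop

/-- Multiplication by `e^{it|2πξ|²}` on `L²`. -/
def prop (t : ℝ) : L2 →L[ℂ] L2 :=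
  mulL (propSymb t) (measurable_propSymb t) 1 fun ξ => (norm_propSymb t ξ).le

theorem coeFn_prop (t : ℝ) (f : L2) : prop t f =ᵐ[volume] fun ξ => propSymb t ξ * f ξ :=
  coeFn_mulL _ _ f

theorem norm_prop (t : ℝ) (f : L2) : ‖prop t f‖ = ‖f‖ := by
  refine (sq_eq_sq₀ (norm_nonneg _) (norm_nonneg _)).1 ?_
  rw [norm_sq_eq_integral, norm_sq_eq_integral]
  refine integral_congr_ae ?_
  filter_upwards [coeFn_prop t f] with ξ h
  rw [h, norm_mul, norm_propSymb, one_mul]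

theorem prop_prop (s t : ℝ) (f : L2) : prop s (prop t f) = prop (s + t) f := by
  ext1
  filter_upwards [coeFn_prop s (prop t f), coeFn_prop t f, coeFn_prop (s + t) f] with ξ h1 h2 h3
  rw [h1, h2, h3, propSymb_add, mul_assoc]

theorem prop_zero (f : L2) : prop 0 f = f := by
  ext1
  filter_upwards [coeFn_prop 0 f] with ξ h1
  rw [h1, propSymb_zero, one_mul]

theorem inner_prop_left (t : ℝ) (f g : L2) : inner ℂ (prop t f) g = inner ℂ f (prop (-t) g) := by
  rw [L2.inner_def, L2.inner_def]
  refine integral_congr_ae ?_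
  filter_upwards [coeFn_prop t f, coeFn_prop (-t) g] with ξ h1 h2
  simp only [h1, h2, RCLike.inner_apply, map_mul, conj_propSymb]
  ring

theorem tendsto_prop (f : L2) (t : ℝ) : Tendsto (fun s => prop s f) (𝓝 t) (𝓝 (prop t f)) := by
  rw [tendsto_iff_norm_sub_tendsto_zero]
  have h1 : ∀ s, ‖prop s f - prop t f‖ ^ 2 =
      ∫ ξ, ‖propSymb s ξ - propSymb t ξ‖ ^ 2 * ‖f ξ‖ ^ 2 := fun s => by
    rw [norm_sq_eq_integral]
    refine integral_congr_ae ?_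
    filter_upwards [Lp.coeFn_sub (prop s f) (prop t f), coeFn_prop s f, coeFn_prop t f]
      with ξ h1 h2 h3
    rw [h1, Pi.sub_apply, h2, h3, ← sub_mul, norm_mul, mul_pow]
  have h2 : Tendsto (fun s => ∫ ξ, ‖propSymb s ξ - propSymb t ξ‖ ^ 2 * ‖f ξ‖ ^ 2) (𝓝 t)
      (𝓝 (∫ _ : R3, (0 : ℝ))) := by
    refine tendsto_integral_filter_of_dominated_convergence (fun ξ => 4 * ‖f ξ‖ ^ 2)
      (Eventually.of_forall fun s => ?_) (Eventually.of_forall fun s => ?_)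
      ((integrable_normSq (Lp.memLp f)).const_mul 4) (Eventually.of_forall fun ξ => ?_)
    · have h3 := measurable_propSymb s
      have h4 := measurable_propSymb t
      have h5 := measurable_coe f
      exact Measurable.aestronglyMeasurable (by fun_prop)
    · refine Eventually.of_forall fun ξ => ?_
      rw [Real.norm_of_nonneg (by positivity)]
      have : ‖propSymb s ξ - propSymb t ξ‖ ≤ 2 := by
        refine (norm_sub_le _ _).trans ?_
        rw [norm_propSymb, norm_propSymb]; norm_num
      gcongr
      nlinarith [norm_nonneg (propSymb s ξ - propSymb t ξ)]
    · have h3 : Continuous fun s => ‖propSymb s ξ - propSymb t ξ‖ ^ 2 * ‖f ξ‖ ^ 2 := by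
        have := continuous_propSymb ξ
        fun_prop
      simpa using h3.tendsto t
  simp_rw [← h1] at h2
  have h3 := h2.sqrt
  simpa [Real.sqrt_sq (norm_nonneg _)] using h3

theorem tendsto_prop_comp {ι : Type*} {l : Filter ι} {τ : ι → ℝ} {v : ι → L2} {t : ℝ} {f : L2}
    (hτ : Tendsto τ l (𝓝 t)) (hv : Tendsto v l (𝓝 f)) :
    Tendsto (fun i => prop (τ i) (v i)) l (𝓝 (prop t f)) := by
  have h1 : Tendsto (fun i => prop (τ i) (v i - f)) l (𝓝 0) := by
    rw [tendsto_zero_iff_norm_tendsto_zero]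
    simp_rw [norm_prop]
    exact tendsto_iff_norm_sub_tendsto_zero.1 hv
  have h2 := h1.add ((tendsto_prop f t).comp hτ)
  rw [zero_add] at h2
  refine h2.congr fun i => ?_
  simp

theorem continuous_prop {v : ℝ → L2} (hv : Continuous v) : Continuous fun t => prop t (v t) :=
  continuous_iff_continuousAt.2 fun t => tendsto_prop_comp tendsto_id (hv.tendsto t)

/-- Taylor's formula when |h| `symb ξ` ≤ 1 and the trivial bound 2 + |x| ≤ 3x² otherwise. The
estimate has to be global because the symbol is unbounded. -/
theorem norm_propSymb_sub_sub_le (h : ℝ) (ξ : R3) :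
    ‖propSymb h ξ - 1 - (h * symb ξ : ℝ) * Complex.I‖ ≤ 3 * h ^ 2 * symb ξ ^ 2 := by
  set x : ℝ := h * symb ξ with hx
  have hx2 : 3 * h ^ 2 * symb ξ ^ 2 = 3 * x ^ 2 := by rw [hx]; ring
  rw [hx2, propSymb, ← hx]
  have hn : ‖(x : ℂ) * Complex.I‖ = |x| := by simp
  by_cases h1 : |x| ≤ 1
  · have := Complex.norm_exp_sub_one_sub_id_le (x := (x : ℂ) * Complex.I) (by rw [hn]; exact h1)
    rw [hn, sq_abs] at this
    nlinarith [sq_nonneg x]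
  · push Not at h1
    calc _ ≤ ‖Complex.exp (x * Complex.I)‖ + ‖(1 : ℂ)‖ + ‖(x : ℂ) * Complex.I‖ :=
          (norm_sub_le _ _).trans (add_le_add_left (norm_sub_le _ _) _)
      _ = 2 + |x| := by rw [Complex.norm_exp_ofReal_mul_I, hn, norm_one]; ring
      _ ≤ 3 * x ^ 2 := by rw [← sq_abs]; nlinarith

/-- The hypotheses place g in the domain of the squared symbol, so the Taylor remainder is O(h²) in
L². -/
theorem hasDerivAt_prop {g g1 g2 : L2} (h1 : g1 =ᵐ[volume] fun ξ => (symb ξ : ℂ) * g ξ)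
    (h2 : g2 =ᵐ[volume] fun ξ => (symb ξ : ℂ) ^ 2 * g ξ) (t : ℝ) :
    HasDerivAt (fun s => prop s g) (Complex.I • prop t g1) t := by
  rw [hasDerivAt_iff_isLittleO_nhds_zero]
  refine Asymptotics.IsBigO.trans_isLittleO (g := fun h : ℝ => h ^ 2) ?_ ?_
  · refine Asymptotics.IsBigO.of_bound (3 * ‖g2‖) (Eventually.of_forall fun h => ?_)
    rw [Real.norm_of_nonneg (sq_nonneg h)]
    have : ‖prop (t + h) g - prop t g - h • Complex.I • prop t g1‖ ≤ (3 * h ^ 2) * ‖g2‖ := by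
      refine Lp.norm_le_mul_norm_of_ae_le_mul ?_
      filter_upwards [Lp.coeFn_sub (prop (t + h) g - prop t g) (h • Complex.I • prop t g1),
        Lp.coeFn_sub (prop (t + h) g) (prop t g), Lp.coeFn_smul h (Complex.I • prop t g1),
        Lp.coeFn_smul Complex.I (prop t g1), coeFn_prop (t + h) g, coeFn_prop t g,
        coeFn_prop t g1, h1, h2] with ξ a1 a2 a3 a4 a5 a6 a7 a8 a9
      rw [a1, Pi.sub_apply, a2, Pi.sub_apply, a3, Pi.smul_apply, a4, Pi.smul_apply, a5, a6, a7,
        a8, a9, propSymb_add, Complex.real_smul, smul_eq_mul]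
      have : propSymb t ξ * propSymb h ξ * g ξ - propSymb t ξ * g ξ -
          (h : ℂ) * (Complex.I * (propSymb t ξ * ((symb ξ : ℂ) * g ξ))) =
          propSymb t ξ * (propSymb h ξ - 1 - (h * symb ξ : ℝ) * Complex.I) * g ξ := by
        push_cast; ring
      rw [this, norm_mul, norm_mul, norm_propSymb, one_mul, norm_mul, norm_pow, Complex.norm_real,
        Real.norm_of_nonneg (symb_nonneg ξ), ← mul_assoc]
      exact mul_le_mul_of_nonneg_right (norm_propSymb_sub_sub_le h ξ) (norm_nonneg _)
    linarith
  · simpa using Asymptotics.isLittleO_pow_id (𝕜 := ℝ) one_lt_two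

end Propagator

/-! ### Duhamel's formula from the distributional equation -/

section WeakDerivative

/-- A product rule in which v is differentiable only when tested against the fixed vector g(t): the
quotients of g converge in norm, so continuity of v suffices for the other term. -/
theorem hasDerivAt_inner_of_weak {g v : ℝ → L2} {g' : L2} {d : ℂ} {t : ℝ}
    (hg : HasDerivAt g g' t) (hv : ContinuousAt v t)
    (hd : HasDerivAt (fun s => inner ℂ (g t) (v s)) d t) :
    HasDerivAt (fun s => inner ℂ (g s) (v s)) (inner ℂ g' (v t) + d) t := by
  have h1 : HasDerivAt (fun s => inner ℂ (g s - g t) (v s)) (inner ℂ g' (v t)) t := by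
    rw [hasDerivAt_iff_tendsto_slope] at hg ⊢
    have h2 : Tendsto (fun s => inner ℂ (slope g t s) (v s)) (𝓝[≠] t) (𝓝 (inner ℂ g' (v t))) :=
      hg.inner (hv.tendsto.mono_left nhdsWithin_le_nhds)
    refine h2.congr fun s => ?_
    rw [slope_def_module, slope_def_module, sub_self, inner_zero_left, sub_zero,
      RCLike.real_smul_eq_coe_smul (K := ℂ) (s - t)⁻¹ (g s - g t), inner_smul_left]
    simp
  refine (h1.add hd).congr_of_eventuallyEq (Eventually.of_forall fun s => ?_)
  simp [inner_sub_left]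

theorem integral_mul_fourier (ψ : 𝓢(R3, ℂ)) (f : L2) :
    ∫ ξ, ψ ξ * (𝓕 f : L2) ξ = ∫ x, (𝓕 ψ) x * f x := by
  have h := congrArg (fun T : 𝓢'(R3, ℂ) => T ψ) (Lp.fourier_toTemperedDistribution_eq f)
  simp only [TemperedDistribution.fourier_apply, Lp.toTemperedDistribution_apply] at h
  exact h.symm

theorem laplacian_fourier {ψ ψ' : 𝓢(R3, ℂ)} (h : ∀ ξ, ψ' ξ = -(symb ξ : ℂ) * ψ ξ) :
    Δ (𝓕 ψ) = 𝓕 ψ' := by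
  let b := EuclideanSpace.basisFun (Fin 3) ℝ
  rw [SchwartzMap.laplacian_eq_sum b]
  have hF : ∀ f : 𝓢(R3, ℂ), 𝓕 f = FourierTransform.fourierCLM ℂ 𝓢(R3, ℂ) f := fun _ => rfl
  simp_rw [SchwartzMap.lineDerivOp_fourier_eq, hF]
  rw [← map_sum]
  congr 1
  ext ξ
  have hg : ∀ m : R3, (fun x : R3 => inner ℝ x m).HasTemperateGrowth := fun m => by fun_prop
  simp only [sum_apply, smul_apply,
    SchwartzMap.smulLeftCLM_apply_apply (hg _), h, smul_eq_mul, Complex.real_smul]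
  rw [symb, mul_pow, ← b.sum_sq_inner_left ξ]
  push_cast
  rw [Finset.mul_sum, ← Finset.sum_neg_distrib, Finset.sum_mul]
  refine Finset.sum_congr rfl fun i _ => ?_
  linear_combination (inner ℝ ξ (b i) : ℂ) ^ 2 * 4 * (Real.pi : ℂ) ^ 2 * ψ ξ * Complex.I_sq

theorem contDiff_symb : ContDiff ℝ (⊤ : ℕ∞) fun ξ => (symb ξ : ℂ) := by
  have : (fun ξ => (symb ξ : ℂ)) = fun ξ : R3 => (((2 * Real.pi) ^ 2 * ‖ξ‖ ^ 2 : ℝ) : ℂ) := by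
    funext ξ; rw [symb, mul_pow]
  rw [this]
  exact Complex.ofRealCLM.contDiff.comp (contDiff_const.mul (contDiff_norm_sq ℝ))

theorem contDiff_propSymb (t : ℝ) : ContDiff ℝ (⊤ : ℕ∞) (propSymb t) := by
  have : propSymb t = fun ξ => Complex.exp ((t : ℂ) * (symb ξ : ℂ) * Complex.I) := by
    funext ξ; rw [propSymb]; push_cast; rfl
  rw [this]
  exact ((contDiff_const.mul contDiff_symb).mul contDiff_const).cexp

/-- The Schwartz function `p θ`, for a bump function `θ` and a smooth function `p`. -/
def cutSchwartz {θ : R3 → ℝ} (hθ : ContDiff ℝ (⊤ : ℕ∞) θ) (hc : HasCompactSupport θ) {p : R3 → ℂ}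
    (hp : ContDiff ℝ (⊤ : ℕ∞) p) : 𝓢(R3, ℂ) :=
  HasCompactSupport.toSchwartzMap (f := fun ξ => p ξ * (θ ξ : ℂ))
    ((hc.comp_left (g := fun r : ℝ => (r : ℂ)) Complex.ofReal_zero).mul_left)
    (hp.mul (Complex.ofRealCLM.contDiff.comp hθ))

theorem cutSchwartz_apply {θ : R3 → ℝ} (hθ : ContDiff ℝ (⊤ : ℕ∞) θ) (hc : HasCompactSupport θ)
    {p : R3 → ℂ} (hp : ContDiff ℝ (⊤ : ℕ∞) p) (ξ : R3) : cutSchwartz hθ hc hp ξ = p ξ * θ ξ := rfl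

theorem hasDerivAt_integral_mul_fourier {u F : ℝ → L2}
    (heq : ∀ (χ : 𝓢(R3, ℂ)) (t : ℝ), ∃ d : ℂ, HasDerivAt (fun s => ∫ x, χ x * u s x) d t ∧
      Complex.I * d = -(∫ x, (Δ χ) x * u t x) + ∫ x, χ x * F t x)
    {ψ ψ' : 𝓢(R3, ℂ)} (h : ∀ ξ, ψ' ξ = -(symb ξ : ℂ) * ψ ξ) (t : ℝ) :
    HasDerivAt (fun s => ∫ ξ, ψ ξ * (𝓕 (u s) : L2) ξ)
      (Complex.I * (∫ ξ, ψ' ξ * (𝓕 (u t) : L2) ξ)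
        - Complex.I * ∫ ξ, ψ ξ * (𝓕 (F t) : L2) ξ) t := by
  obtain ⟨d, hd, h1⟩ := heq (𝓕 ψ) t
  simp_rw [integral_mul_fourier]
  rw [laplacian_fourier h] at h1
  have : d = Complex.I * (∫ x, (𝓕 ψ') x * u t x) - Complex.I * ∫ x, (𝓕 ψ) x * F t x := by
    linear_combination (-Complex.I) * h1 + d * Complex.I_sq
  rwa [← this]

theorem inner_prop_eq_integral {g : L2} {ψ : R3 → ℂ} {q : R3 → ℝ}
    (hg : g =ᵐ[volume] fun ξ => (q ξ : ℂ)) (t : ℝ)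
    (hψ : ∀ ξ, ψ ξ = propSymb t ξ * q ξ) (f : L2) :
    inner ℂ (prop (-t) g) f = ∫ ξ, ψ ξ * f ξ := by
  rw [L2.inner_def]
  refine integral_congr_ae ?_
  filter_upwards [coeFn_prop (-t) g, hg] with ξ h1 h2
  rw [RCLike.inner_apply, h1, h2, hψ, map_mul, conj_propSymb, neg_neg, Complex.conj_ofReal]
  ring

/-- The propagator is moved onto g. The compact support of θ makes it norm differentiable there,
while u is differentiable against the fixed Schwartz function `propSymb t` · θ. The two
contributions of the symbol cancel. -/
theorem hasDerivAt_inner_prop {u F : ℝ → L2} (hu : Continuous u)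
    (heq : ∀ (χ : 𝓢(R3, ℂ)) (t : ℝ), ∃ d : ℂ, HasDerivAt (fun s => ∫ x, χ x * u s x) d t ∧
      Complex.I * d = -(∫ x, (Δ χ) x * u t x) + ∫ x, χ x * F t x)
    {θ : R3 → ℝ} (hθ : ContDiff ℝ (⊤ : ℕ∞) θ) (hc : HasCompactSupport θ) {g : L2}
    (hg : g =ᵐ[volume] fun ξ => (θ ξ : ℂ)) (t : ℝ) :
    HasDerivAt (fun s => inner ℂ g (prop s (𝓕 (u s))))
      (inner ℂ g (-(Complex.I • prop t (𝓕 (F t))))) t := by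
  let g1 : L2 := (cutSchwartz hθ hc contDiff_symb).toLp 2
  let g2 : L2 := (cutSchwartz hθ hc (contDiff_symb.pow 2)).toLp 2
  have hg1 : g1 =ᵐ[volume] fun ξ => ((symb ξ * θ ξ : ℝ) : ℂ) := by
    filter_upwards [(cutSchwartz hθ hc contDiff_symb).coeFn_toLp 2] with ξ h
    rw [h, cutSchwartz_apply]; push_cast; rfl
  have hg2 : g2 =ᵐ[volume] fun ξ => (symb ξ : ℂ) ^ 2 * θ ξ :=
    (cutSchwartz hθ hc (contDiff_symb.pow 2)).coeFn_toLp 2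
  have hd := hasDerivAt_prop (g := g) (g1 := g1) (g2 := g2)
    (by filter_upwards [hg1, hg] with ξ a b; rw [a, b]; push_cast; rfl)
    (by filter_upwards [hg2, hg] with ξ a b; rw [a, b]) (-t)
  have hd' := hd.scomp t (hasDerivAt_neg t)
  have hFc : Continuous fun f : L2 => (𝓕 f : L2) := (Lp.fourierTransformₗᵢ R3 ℂ).continuous
  have hψ := hasDerivAt_integral_mul_fourier heq
    (ψ := cutSchwartz hθ hc (contDiff_propSymb t))
    (ψ' := cutSchwartz hθ hc (contDiff_symb.neg.mul (contDiff_propSymb t)))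
    (fun ξ => by simp only [cutSchwartz_apply]; ring) t
  have hi : ∀ f : L2, inner ℂ (prop (-t) g) f =
      ∫ ξ, cutSchwartz hθ hc (contDiff_propSymb t) ξ * f ξ :=
    inner_prop_eq_integral hg t fun ξ => rfl
  have hi1 : ∀ f : L2, inner ℂ (prop (-t) g1) f =
      -∫ ξ, cutSchwartz hθ hc (contDiff_symb.neg.mul (contDiff_propSymb t)) ξ * f ξ := fun f => by
    rw [← integral_neg]
    simp_rw [← neg_mul]
    refine inner_prop_eq_integral hg1 t (fun ξ => ?_) f
    rw [cutSchwartz_apply]; push_cast; ring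
  simp_rw [← hi] at hψ
  have h := hasDerivAt_inner_of_weak hd' ((hFc.comp hu).continuousAt) hψ
  simp only [Function.comp_def, inner_prop_left, neg_neg] at h
  refine h.congr_deriv ?_
  rw [neg_one_smul, inner_neg_left, inner_smul_left, hi1, inner_neg_right, inner_smul_right,
    Complex.conj_I]
  ring

/-- **Duhamel's formula**, in differential form and on the Fourier side. -/
theorem hasDerivAt_prop_fourier {u F : ℝ → L2} (hu : Continuous u) (hF : Continuous F)
    (heq : ∀ (χ : 𝓢(R3, ℂ)) (t : ℝ), ∃ d : ℂ, HasDerivAt (fun s => ∫ x, χ x * u s x) d t ∧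
      Complex.I * d = -(∫ x, (Δ χ) x * u t x) + ∫ x, χ x * F t x) (t : ℝ) :
    HasDerivAt (fun s => prop s (𝓕 (u s))) (-(Complex.I • prop t (𝓕 (F t)))) t := by
  have hFc : Continuous fun f : L2 => (𝓕 f : L2) := (Lp.fourierTransformₗᵢ R3 ℂ).continuous
  have hG : Continuous fun s => -(Complex.I • prop s (𝓕 (F s))) :=
    ((continuous_prop (hFc.comp hF)).const_smul Complex.I).neg
  have hint : ∀ t, HasDerivAt (fun r => ∫ s in (0 : ℝ)..r, -(Complex.I • prop s (𝓕 (F s))))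
      (-(Complex.I • prop t (𝓕 (F t)))) t := fun t =>
    (hG.integral_hasStrictDerivAt 0 t).hasDerivAt
  -- Tested against a bump function, the discrepancy in the integral equation has zero time
  -- derivative and vanishes at time 0; bump functions determine an element of L².
  have key : ∀ t, prop t (𝓕 (u t)) - prop 0 (𝓕 (u 0)) -
      ∫ s in (0 : ℝ)..t, -(Complex.I • prop s (𝓕 (F s))) = 0 := fun t => by
    set y : ℝ → L2 := fun t => prop t (𝓕 (u t)) - prop 0 (𝓕 (u 0)) -
      ∫ s in (0 : ℝ)..t, -(Complex.I • prop s (𝓕 (F s))) with hy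
    change y t = 0
    have hz : ∀ᵐ ξ, y t ξ = 0 := by
      refine ae_eq_zero_of_integral_contDiff_smul_eq_zero
        ((Lp.memLp (y t)).locallyIntegrable one_le_two) fun θ hθ hc => ?_
      let g : L2 := (cutSchwartz hθ hc (contDiff_const (c := (1 : ℂ)))).toLp 2
      have hg : g =ᵐ[volume] fun ξ => (θ ξ : ℂ) := by
        filter_upwards [(cutSchwartz hθ hc (contDiff_const (c := (1 : ℂ)))).coeFn_toLp 2] with ξ h
        rw [h, cutSchwartz_apply, one_mul]
      have hd : ∀ r, HasDerivAt (fun s => inner ℂ g (y s)) 0 r := fun r => by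
        have h1 := ((hasDerivAt_inner_prop hu heq hθ hc hg r).sub_const
          (inner ℂ g (prop 0 (𝓕 (u 0))))).sub
          ((hasDerivAt_const r g).inner ℂ (hint r))
        simp only [inner_zero_left, add_zero, sub_self] at h1
        refine h1.congr_of_eventuallyEq (Eventually.of_forall fun s => ?_)
        simp only [hy, inner_sub_right, Pi.sub_apply]
      have h0 : inner ℂ g (y t) = 0 := by
        have h1 := is_const_of_deriv_eq_zero (fun r => (hd r).differentiableAt)
          (fun r => (hd r).deriv) t 0
        rw [h1]
        simp [hy]
      rw [← h0, L2.inner_def]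
      refine integral_congr_ae ?_
      filter_upwards [hg] with ξ h
      rw [h, RCLike.inner_apply, Complex.conj_ofReal, Complex.real_smul, mul_comm]
    exact Lp.eq_zero_iff_ae_eq_zero.2 hz
  refine ((hint t).add_const (prop 0 (𝓕 (u 0)))).congr_of_eventuallyEq
    (Eventually.of_forall fun s => ?_)
  have := key s
  rw [sub_sub, sub_eq_zero] at this
  simp only [this, add_comm]

end WeakDerivative

/-! ### Regularity of solutions and conservation of mass -/

section Solutions

variable {lam : ℝ} {w : R3 → ℝ} {V : R3 → R3 → R3 → ℝ} {u₀ : L2} {u : ℝ → L2}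

/-- Nearby times differ by a finite H¹ norm, so the times at which the norm is finite form a clopen
set; it contains 0, and ℝ is connected. -/
theorem IsHartreeSolution.sobolevNorm_ne_top (h : IsHartreeSolution V u₀ u)
    (h0 : sobolevNorm 1 u₀ ≠ ∞) (t : ℝ) : sobolevNorm 1 (u t) ≠ ∞ := by
  have hloc : ∀ t₀, ∀ᶠ t in 𝓝 t₀, sobolevNorm 1 (u t - u t₀) < ∞ := fun t₀ =>
    ((h.continuous t₀).eventually (gt_mem_nhds (zero_lt_one (α := ℝ≥0∞)))).mono fun t ht =>
      ht.trans ENNReal.one_lt_top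
  have hS : IsClopen {t | sobolevNorm 1 (u t) < ∞} := by
    constructor
    · rw [← isOpen_compl_iff, isOpen_iff_mem_nhds]
      intro t₀ ht₀
      filter_upwards [hloc t₀] with t ht hlt
      refine ht₀ ?_
      change sobolevNorm 1 (u t₀) < ∞
      have := sobolevNorm_add_le 1 (u t₀ - u t) (u t)
      rw [sub_add_cancel, sobolevNorm_sub_comm] at this
      exact this.trans_lt (ENNReal.add_lt_top.2 ⟨ht, hlt⟩)
    · rw [isOpen_iff_mem_nhds]
      intro t₀ ht₀
      filter_upwards [hloc t₀] with t ht
      have := sobolevNorm_add_le 1 (u t - u t₀) (u t₀)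
      rw [sub_add_cancel] at this
      exact this.trans_lt (ENNReal.add_lt_top.2 ⟨ht, ht₀⟩)
  have h1 : (0 : ℝ) ∈ {t | sobolevNorm 1 (u t) < ∞} := by
    change sobolevNorm 1 (u 0) < ∞
    rw [h.initial]
    exact lt_top_iff_ne_top.2 h0
  have h2 := hS.eq_univ ⟨0, h1⟩
  exact (h2 ▸ Set.mem_univ t : t ∈ {t | sobolevNorm 1 (u t) < ∞}).ne

theorem IsHartreeSolution.tendsto_toReal (h : IsHartreeSolution V u₀ u) (t₀ : ℝ) :
    Tendsto (fun t => (sobolevNorm 1 (u t - u t₀)).toReal) (𝓝 t₀) (𝓝 0) :=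
  (ENNReal.tendsto_toReal ENNReal.zero_ne_top).comp (h.continuous t₀)

theorem sobolevNorm_sub_ne_top {f g : L2} (hf : sobolevNorm 1 f ≠ ∞) (hg : sobolevNorm 1 g ≠ ∞) :
    sobolevNorm 1 (f - g) ≠ ∞ := by
  have h1 : sobolevNorm 1 (-g) = sobolevNorm 1 g := by
    have := sobolevNorm_sub_comm 1 0 g
    rwa [zero_sub, sub_zero] at this
  rw [sub_eq_add_neg]
  exact ((sobolevNorm_add_le 1 f (-g)).trans_lt
    (ENNReal.add_lt_top.2 ⟨lt_top_iff_ne_top.2 hf, h1 ▸ lt_top_iff_ne_top.2 hg⟩)).ne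

theorem IsHartreeSolution.continuous_toReal (h : IsHartreeSolution V u₀ u)
    (h0 : sobolevNorm 1 u₀ ≠ ∞) : Continuous fun t => (sobolevNorm 1 (u t)).toReal := by
  refine continuous_iff_continuousAt.2 fun t₀ => ?_
  rw [ContinuousAt, tendsto_iff_norm_sub_tendsto_zero]
  refine squeeze_zero (fun t => norm_nonneg _) (fun t => ?_) (h.tendsto_toReal t₀)
  have ht := h.sobolevNorm_ne_top h0 t
  have ht₀ := h.sobolevNorm_ne_top h0 t₀
  have hd := sobolevNorm_sub_ne_top ht ht₀
  have h1 := sobolevNorm_add_le 1 (u t - u t₀) (u t₀)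
  have h2 := sobolevNorm_add_le 1 (u t₀ - u t) (u t)
  rw [sub_add_cancel] at h1 h2
  rw [sobolevNorm_sub_comm] at h2
  have h1' := ENNReal.toReal_mono (ENNReal.add_ne_top.2 ⟨hd, ht₀⟩) h1
  have h2' := ENNReal.toReal_mono (ENNReal.add_ne_top.2 ⟨hd, ht⟩) h2
  rw [ENNReal.toReal_add hd ht₀] at h1'
  rw [ENNReal.toReal_add hd ht] at h2'
  rw [Real.norm_eq_abs, abs_le]
  constructor <;> linarith

theorem norm_le_toReal_sobolevNorm {f : L2} (hf : sobolevNorm 1 f ≠ ∞) :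
    ‖f‖ ≤ (sobolevNorm 1 f).toReal := by
  refine (pow_le_pow_iff_left₀ (norm_nonneg _) ENNReal.toReal_nonneg two_ne_zero).1 ?_
  rw [sobolevNorm_sq hf]
  linarith [kin_nonneg f]

theorem H1Bound.of_sobolevNorm {f : L2} (hf : sobolevNorm 1 f ≠ ∞) {R : ℝ}
    (h : (sobolevNorm 1 f).toReal ≤ R) : H1Bound f R where
  finiteKin := finiteKin_of_sobolevNorm hf
  norm_le := (norm_le_toReal_sobolevNorm hf).trans h
  kin_le := by
    have h1 := sobolevNorm_sq hf
    have h2 : (sobolevNorm 1 f).toReal ^ 2 ≤ R ^ 2 := by gcongr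
    nlinarith [sq_nonneg ‖f‖]

theorem IsHartreeSolution.exists_h1Bound (h : IsHartreeSolution V u₀ u)
    (h0 : sobolevNorm 1 u₀ ≠ ∞) (S : ℝ) : ∃ R, ∀ t ∈ Set.Icc (-S) S, H1Bound (u t) R := by
  obtain ⟨R, hR⟩ := isCompact_Icc.exists_bound_of_continuousOn (s := Set.Icc (-S) S)
    (h.continuous_toReal h0).continuousOn
  exact ⟨R, fun t ht => .of_sobolevNorm (h.sobolevNorm_ne_top h0 t)
    ((le_abs_self _).trans (hR t ht))⟩

theorem IsHartreeSolution.continuous_L2 (h : IsHartreeSolution V u₀ u)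
    (h0 : sobolevNorm 1 u₀ ≠ ∞) : Continuous u := by
  refine continuous_iff_continuousAt.2 fun t₀ => ?_
  rw [ContinuousAt, tendsto_iff_norm_sub_tendsto_zero]
  refine squeeze_zero (fun t => norm_nonneg _) (fun t => ?_) (h.tendsto_toReal t₀)
  exact norm_le_toReal_sobolevNorm
    (sobolevNorm_sub_ne_top (h.sobolevNorm_ne_top h0 t) (h.sobolevNorm_ne_top h0 t₀))

theorem IsHartreeSolution.continuous_nonlin (hlam : 0 ≤ lam) (hw : IsPairKernel w)
    (h : IsHartreeSolution (threeBody lam w) u₀ u) (h0 : sobolevNorm 1 u₀ ≠ ∞) :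
    Continuous fun t => nonlin (threeBody lam w) (u t) := by
  refine continuous_iff_continuousAt.2 fun t₀ => ?_
  obtain ⟨R, hR⟩ := h.exists_h1Bound h0 (|t₀| + 1)
  have hnear : ∀ᶠ t in 𝓝 t₀, t ∈ Set.Icc (-(|t₀| + 1)) (|t₀| + 1) :=
    Icc_mem_nhds (by linarith [neg_abs_le t₀]) (by linarith [le_abs_self t₀])
  rw [ContinuousAt, tendsto_iff_norm_sub_tendsto_zero]
  have hu := tendsto_iff_norm_sub_tendsto_zero.1 ((h.continuous_L2 h0).tendsto t₀)
  refine squeeze_zero' (Eventually.of_forall fun t => norm_nonneg _)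
    (hnear.mono fun t ht => norm_nonlin_sub_le hlam hw (hR t ht) (hR t₀ hnear.self_of_nhds)) ?_
  simpa using hu.const_mul (120 * lam * R ^ 4)

/-- Once the free evolution is removed, the equation holds in L² norm. Mass, correlations and
differences of solutions then obey ordinary calculus. -/
theorem IsHartreeSolution.hasDerivAt_prop (hlam : 0 ≤ lam) (hw : IsPairKernel w)
    (h : IsHartreeSolution (threeBody lam w) u₀ u) (h0 : sobolevNorm 1 u₀ ≠ ∞) (t : ℝ) :
    HasDerivAt (fun s => prop s (𝓕 (u s)))
      (-(Complex.I • prop t (𝓕 (nonlin (threeBody lam w) (u t))))) t := by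
  refine hasDerivAt_prop_fourier (h.continuous_L2 h0) (h.continuous_nonlin hlam hw h0)
    (fun χ t => ?_) t
  obtain ⟨d, hd, h1⟩ := h.equation χ t
  refine ⟨d, hd, h1.trans ?_⟩
  obtain ⟨R, hR⟩ := h.exists_h1Bound h0 |t|
  congr 1
  refine integral_congr_ae ?_
  filter_upwards [coeFn_nonlin hlam hw (hR t ⟨neg_abs_le t, le_abs_self t⟩)] with x hx
  rw [hx]

theorem im_inner_self_nonlin {R : ℝ} {f : L2} (hlam : 0 ≤ lam) (hw : IsPairKernel w)
    (hf : H1Bound f R) : (inner ℂ f (nonlin (threeBody lam w) f)).im = 0 := by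
  have h1 : inner ℂ f (nonlin (threeBody lam w) f) =
      ∫ x, ((1 / 2 * meanField (threeBody lam w) f x * ‖f x‖ ^ 2 : ℝ) : ℂ) := by
    rw [L2.inner_def]
    refine integral_congr_ae ?_
    filter_upwards [coeFn_nonlin hlam hw hf] with x hx
    rw [hx, RCLike.inner_apply, mul_assoc, Complex.mul_conj, Complex.normSq_eq_norm_sq]
    push_cast
    ring
  rw [h1, integral_complex_ofReal, Complex.ofReal_im]

theorem inner_prop_prop (t : ℝ) (f g : L2) : inner ℂ (prop t f) (prop t g) = inner ℂ f g := by
  rw [inner_prop_left, prop_prop, neg_add_cancel, prop_zero]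

/-- The mean field is real, hence so is ⟨u, F(u)⟩, and the two terms of the derivative of the
squared norm cancel. -/
theorem IsHartreeSolution.norm_eq (hlam : 0 ≤ lam) (hw : IsPairKernel w)
    (h : IsHartreeSolution (threeBody lam w) u₀ u) (h0 : sobolevNorm 1 u₀ ≠ ∞) (t : ℝ) :
    ‖u t‖ = ‖u₀‖ := by
  have hd : ∀ t, HasDerivAt (fun s => inner ℂ (prop s (𝓕 (u s))) (prop s (𝓕 (u s)))) 0 t := by
    intro t
    obtain ⟨R, hR⟩ := h.exists_h1Bound h0 |t|
    have him := im_inner_self_nonlin hlam hw (hR t ⟨neg_abs_le t, le_abs_self t⟩)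
    have h1 := h.hasDerivAt_prop hlam hw h0 t
    refine (h1.inner ℂ h1).congr_deriv ?_
    rw [inner_neg_left, inner_neg_right, inner_smul_left, inner_smul_right, inner_prop_prop,
      inner_prop_prop, Lp.inner_fourier_eq, Lp.inner_fourier_eq, Complex.conj_I,
      ← inner_conj_symm (nonlin (threeBody lam w) (u t)), Complex.conj_eq_iff_im.2 him]
    ring
  have h1 := is_const_of_deriv_eq_zero (fun r => (hd r).differentiableAt) (fun r => (hd r).deriv)
    t 0
  rw [inner_prop_prop, inner_prop_prop, Lp.inner_fourier_eq, Lp.inner_fourier_eq, h.initial,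
    inner_self_eq_norm_sq_to_K, inner_self_eq_norm_sq_to_K] at h1
  have h2 : ‖u t‖ ^ 2 = ‖u₀‖ ^ 2 := by exact_mod_cast h1
  exact (sq_eq_sq₀ (norm_nonneg _) (norm_nonneg _)).1 h2

end Solutions

/-! ### Conservation of energy -/

section KineticLimits

theorem norm_prop_neg_sub_sq (h : ℝ) (g : L2) :
    ‖prop (-h) g - g‖ ^ 2 = ∫ ξ, ‖propSymb (-h) ξ - 1‖ ^ 2 * ‖g ξ‖ ^ 2 := by
  rw [norm_sq_eq_integral]
  refine integral_congr_ae ?_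
  filter_upwards [Lp.coeFn_sub (prop (-h) g) g, coeFn_prop (-h) g] with ξ h1 h2
  rw [h1, Pi.sub_apply, h2, ← sub_one_mul, norm_mul, mul_pow]

theorem norm_propSymb_sub_one_le (h : ℝ) (ξ : R3) : ‖propSymb h ξ - 1‖ ≤ |h| * symb ξ := by
  have := Real.norm_exp_I_mul_ofReal_sub_one_le (x := h * symb ξ)
  rw [mul_comm Complex.I] at this
  refine this.trans (le_of_eq ?_)
  rw [norm_mul, Real.norm_eq_abs, Real.norm_of_nonneg (symb_nonneg ξ)]

theorem norm_propSymb_sub_one_sq_le (h : ℝ) (ξ : R3) :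
    ‖propSymb h ξ - 1‖ ^ 2 ≤ 2 * |h| * symb ξ := by
  have h1 : ‖propSymb h ξ - 1‖ ≤ 2 := by
    refine (norm_sub_le _ _).trans ?_
    rw [norm_propSymb, norm_one]; norm_num
  nlinarith [norm_propSymb_sub_one_le h ξ, norm_nonneg (propSymb h ξ - 1)]

theorem norm_prop_neg_sub_sq_le {f : L2} (hf : FiniteKin f) (h : ℝ) :
    ‖prop (-h) (𝓕 f) - 𝓕 f‖ ^ 2 ≤ 2 * |h| * kin f := by
  rw [norm_prop_neg_sub_sq, kin, ← integral_const_mul]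
  refine integral_mono_of_nonneg (Eventually.of_forall fun x => by positivity)
    (hf.const_mul _) (Eventually.of_forall fun ξ => ?_)
  have := norm_propSymb_sub_one_sq_le (-h) ξ
  rw [abs_neg] at this
  change _ ≤ 2 * |h| * (symb ξ * ‖(𝓕 f : L2) ξ‖ ^ 2)
  rw [← mul_assoc]
  exact mul_le_mul_of_nonneg_right this (sq_nonneg _)

/-- With σ = `symb`, the integrand divided by h is at most 2σ|f̂|², integrable for finite kinetic
energy, and at most hσ²|f̂|², which tends to 0 pointwise. Thus the free flow displaces f by o(√h) in
L². -/
theorem tendsto_norm_prop_neg_sub_sq_div {f : L2} (hf : FiniteKin f) :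
    Tendsto (fun h : ℝ => ‖prop (-h) (𝓕 f) - 𝓕 f‖ ^ 2 / h) (𝓝[>] 0) (𝓝 0) := by
  have h1 : Tendsto (fun h : ℝ => ∫ ξ, ‖propSymb (-h) ξ - 1‖ ^ 2 * ‖(𝓕 f : L2) ξ‖ ^ 2 / h)
      (𝓝[>] 0) (𝓝 (∫ _ : R3, (0 : ℝ))) := by
    refine tendsto_integral_filter_of_dominated_convergence
      (fun ξ => 2 * (symb ξ * ‖(𝓕 f : L2) ξ‖ ^ 2)) (Eventually.of_forall fun h => ?_) ?_
      (hf.const_mul 2) (Eventually.of_forall fun ξ => ?_)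
    · have h3 := measurable_propSymb (-h)
      have h5 := measurable_coe (𝓕 f)
      exact Measurable.aestronglyMeasurable (by fun_prop)
    · filter_upwards [self_mem_nhdsWithin] with h (hh : 0 < h)
      refine Eventually.of_forall fun ξ => ?_
      have := norm_propSymb_sub_one_sq_le (-h) ξ
      rw [abs_neg, abs_of_pos hh] at this
      rw [Real.norm_of_nonneg (by positivity), div_le_iff₀ hh]
      calc _ ≤ 2 * h * symb ξ * ‖(𝓕 f : L2) ξ‖ ^ 2 := by gcongr
        _ = _ := by ring
    · have hlim : Tendsto (fun h : ℝ => h * (symb ξ ^ 2 * ‖(𝓕 f : L2) ξ‖ ^ 2)) (𝓝[>] 0) (𝓝 0) := by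
        have : Continuous fun h : ℝ => h * (symb ξ ^ 2 * ‖(𝓕 f : L2) ξ‖ ^ 2) := by fun_prop
        simpa using (this.tendsto 0).mono_left nhdsWithin_le_nhds
      refine squeeze_zero' ?_ ?_ hlim
      · filter_upwards [self_mem_nhdsWithin] with h (hh : 0 < h)
        positivity
      · filter_upwards [self_mem_nhdsWithin] with h (hh : 0 < h)
        rw [div_le_iff₀ hh]
        have := norm_propSymb_sub_one_le (-h) ξ
        rw [abs_neg, abs_of_pos hh] at this
        calc _ ≤ (h * symb ξ) ^ 2 * ‖(𝓕 f : L2) ξ‖ ^ 2 := by gcongr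
          _ = _ := by ring
  rw [integral_zero] at h1
  refine h1.congr fun h => ?_
  rw [norm_prop_neg_sub_sq, integral_div]

theorem re_inner_I_prop_neg (h : ℝ) (g : L2) :
    (inner ℂ g (Complex.I • prop (-h) g)).re = ∫ ξ, Real.sin (h * symb ξ) * ‖g ξ‖ ^ 2 := by
  rw [L2.inner_def, ← RCLike.re_eq_complex_re, ← integral_re (L2.integrable_inner _ _)]
  refine integral_congr_ae ?_
  filter_upwards [Lp.coeFn_smul Complex.I (prop (-h) g), coeFn_prop (-h) g] with ξ h1 h2
  rw [h1, Pi.smul_apply, h2, RCLike.inner_apply, smul_eq_mul, propSymb, Complex.exp_mul_I]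
  have h3 : Complex.I * ((Complex.cos ((-h * symb ξ : ℝ) : ℂ) +
      Complex.sin ((-h * symb ξ : ℝ) : ℂ) * Complex.I) * g ξ) * starRingEnd ℂ (g ξ) =
      ((Real.sin (h * symb ξ) * ‖g ξ‖ ^ 2 : ℝ) : ℂ) +
        ((Real.cos (h * symb ξ) * ‖g ξ‖ ^ 2 : ℝ) : ℂ) * Complex.I := by
    have h4 := Complex.mul_conj (g ξ)
    rw [Complex.normSq_eq_norm_sq] at h4
    push_cast at h4 ⊢
    rw [neg_mul, Complex.cos_neg, Complex.sin_neg, ← h4]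
    linear_combination (-Complex.sin (h * symb ξ) * g ξ * starRingEnd ℂ (g ξ)) * Complex.I_sq
  rw [h3, RCLike.re_eq_complex_re, Complex.add_re, Complex.ofReal_re, Complex.re_ofReal_mul,
    Complex.I_re, mul_zero, add_zero]

/-- With σ = `symb`, the real part is ∫ sin(hσ)|f̂|². The quotient sin(hσ)/h tends to σ and is
dominated by σ. -/
theorem tendsto_re_inner_I_prop_neg_div {f : L2} (hf : FiniteKin f) :
    Tendsto (fun h : ℝ => (inner ℂ (𝓕 f : L2) (Complex.I • prop (-h) (𝓕 f))).re / h)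
      (𝓝[>] 0) (𝓝 (kin f)) := by
  have h1 : Tendsto (fun h : ℝ => ∫ ξ, Real.sin (h * symb ξ) * ‖(𝓕 f : L2) ξ‖ ^ 2 / h)
      (𝓝[>] 0) (𝓝 (kin f)) := by
    refine tendsto_integral_filter_of_dominated_convergence
      (fun ξ => symb ξ * ‖(𝓕 f : L2) ξ‖ ^ 2) (Eventually.of_forall fun h => ?_) ?_
      hf (Eventually.of_forall fun ξ => ?_)
    · have h3 := measurable_symb
      have h5 := measurable_coe (𝓕 f)
      exact Measurable.aestronglyMeasurable (by fun_prop)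
    · filter_upwards [self_mem_nhdsWithin] with h (hh : 0 < h)
      refine Eventually.of_forall fun ξ => ?_
      have : |Real.sin (h * symb ξ)| ≤ |h * symb ξ| := Real.abs_sin_le_abs
      rw [abs_of_nonneg (mul_nonneg hh.le (symb_nonneg ξ))] at this
      rw [norm_div, norm_mul, Real.norm_of_nonneg hh.le, div_le_iff₀ hh, Real.norm_eq_abs,
        Real.norm_of_nonneg (by positivity : 0 ≤ ‖(𝓕 f : L2) ξ‖ ^ 2)]
      calc _ ≤ h * symb ξ * ‖(𝓕 f : L2) ξ‖ ^ 2 := by gcongr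
        _ = _ := by ring
    · have hd : HasDerivAt (fun h : ℝ => Real.sin (h * symb ξ) * ‖(𝓕 f : L2) ξ‖ ^ 2)
          (symb ξ * ‖(𝓕 f : L2) ξ‖ ^ 2) 0 := by
        have := (((hasDerivAt_id (0 : ℝ)).mul_const (symb ξ)).sin).mul_const (‖(𝓕 f : L2) ξ‖ ^ 2)
        simpa using this
      have := (hasDerivAt_iff_tendsto_slope.1 hd).mono_left
        (nhdsWithin_mono _ (fun x (hx : 0 < x) => hx.ne') : 𝓝[>] (0 : ℝ) ≤ 𝓝[≠] 0)
      refine this.congr fun h => ?_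
      simp [slope_def_field]
  refine h1.congr fun h => ?_
  rw [re_inner_I_prop_neg, integral_div]

end KineticLimits

/-! ### Time-shifted correlations and the energy identity -/

section Energy

variable {lam : ℝ} {w : R3 → ℝ} {u₀ : L2} {u : ℝ → L2}

theorem prop_neg_prop_add (h s : ℝ) (f : L2) : prop (-h) (prop (s + h) f) = prop s f := by
  rw [prop_prop]
  congr 1
  ring_nf

/-- This correlation stands in for h times the energy. The free evolution is unitary, so the
Laplacian drops out of its derivative exactly and no regularity beyond H¹ is needed. -/
theorem IsHartreeSolution.hasDerivAt_corr (hlam : 0 ≤ lam) (hw : IsPairKernel w)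
    (hu : IsHartreeSolution (threeBody lam w) u₀ u) (h0 : sobolevNorm 1 u₀ ≠ ∞) (h s : ℝ) :
    HasDerivAt (fun s => (inner ℂ (u s) (Complex.I • u (s + h))).re)
      ((inner ℂ (u s) (nonlin (threeBody lam w) (u (s + h)))).re -
        (inner ℂ (u (s + h)) (nonlin (threeBody lam w) (u s))).re) s := by
  have h1 := hu.hasDerivAt_prop hlam hw h0 s
  have h2 := (hu.hasDerivAt_prop hlam hw h0 (s + h)).comp_add_const s h
  have h3 := (((prop (-h)).restrictScalars ℝ).hasFDerivAt.comp_hasDerivAt s h2).const_smul Complex.I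
  have h4 := Complex.reCLM.hasFDerivAt.comp_hasDerivAt s (h1.inner ℂ h3)
  refine (h4.congr_deriv ?_).congr_of_eventuallyEq (Eventually.of_forall fun r => ?_)
  · simp only [ContinuousLinearMap.coe_restrictScalars', Pi.smul_apply, Function.comp_apply,
      map_neg, map_smul, prop_neg_prop_add, Complex.reCLM_apply, inner_neg_left, inner_neg_right, smul_neg,
      inner_smul_left, inner_smul_right, inner_prop_prop, Lp.inner_fourier_eq, Complex.conj_I]
    have h6 : (inner ℂ (nonlin (threeBody lam w) (u s)) (u (s + h))).re =
        (inner ℂ (u (s + h)) (nonlin (threeBody lam w) (u s))).re := inner_re_symm (𝕜 := ℂ) _ _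
    rw [← h6]
    have h5 := Complex.I_mul_I
    simp only [← mul_assoc, neg_mul, mul_neg, h5]
    simp
    ring
  · simp only [ContinuousLinearMap.coe_restrictScalars', Pi.smul_apply, Function.comp_apply,
      prop_neg_prop_add, Complex.reCLM_apply, inner_smul_right, inner_prop_prop,
      Lp.inner_fourier_eq]

/-- Formally this is Re⟨u, i∂ₜu⟩ = ‖∇u‖² + ⟨u, F(u)⟩. The free displacement of u(s) produces the
kinetic term, and the derivative after removal of the free evolution produces the other. -/
theorem IsHartreeSolution.tendsto_corr_div (hlam : 0 ≤ lam) (hw : IsPairKernel w)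
    (hu : IsHartreeSolution (threeBody lam w) u₀ u) (h0 : sobolevNorm 1 u₀ ≠ ∞) (s : ℝ) :
    Tendsto (fun h : ℝ => (inner ℂ (u s) (Complex.I • u (s + h))).re / h) (𝓝[>] 0)
      (𝓝 (kin (u s) + 1 / 2 * potEnergy (threeBody lam w) (u s))) := by
  obtain ⟨R, hR⟩ := hu.exists_h1Bound h0 |s|
  have hb := hR s ⟨neg_abs_le s, le_abs_self s⟩
  have hsl := (hasDerivAt_iff_tendsto_slope_zero.1 (hu.hasDerivAt_prop hlam hw h0 s)).mono_left
    (nhdsWithin_mono _ (fun x (hx : 0 < x) => hx.ne') : 𝓝[>] (0 : ℝ) ≤ 𝓝[≠] 0)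
  have hneg : Tendsto (fun h : ℝ => -h) (𝓝[>] 0) (𝓝 0) := by
    have : Continuous fun h : ℝ => -h := continuous_neg
    simpa using (this.tendsto 0).mono_left nhdsWithin_le_nhds
  have h1 := ((tendsto_prop_comp hneg hsl).const_smul Complex.I)
  have h2 := (Complex.continuous_re.tendsto _).comp
    ((tendsto_const_nhds (x := prop s (𝓕 (u s)))).inner (𝕜 := ℂ) h1)
  rw [prop_zero, smul_neg, smul_smul, Complex.I_mul_I, neg_one_smul, neg_neg, inner_prop_prop,
    Lp.inner_fourier_eq, ← RCLike.re_eq_complex_re, re_inner_self_nonlin hlam hw hb] at h2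
  refine ((tendsto_re_inner_I_prop_neg_div hb.finiteKin).add h2).congr fun h => ?_
  have e1 : inner ℂ (u s) (Complex.I • u (s + h)) =
      inner ℂ (prop s (𝓕 (u s))) (Complex.I • prop (-h) (prop (s + h) (𝓕 (u (s + h))))) := by
    rw [prop_neg_prop_add, inner_smul_right, inner_smul_right, inner_prop_prop,
      Lp.inner_fourier_eq]
  have e2 : inner ℂ (𝓕 (u s) : L2) (Complex.I • prop (-h) (𝓕 (u s))) =
      inner ℂ (prop s (𝓕 (u s))) (Complex.I • prop (-h) (prop s (𝓕 (u s)))) := by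
    rw [inner_smul_right, inner_smul_right, prop_prop (-h) s, add_comm (-h) s, ← prop_prop s (-h),
      inner_prop_prop]
  have e3 : prop (-h) (h⁻¹ • (prop (s + h) (𝓕 (u (s + h))) - prop s (𝓕 (u s)))) =
      h⁻¹ • (prop (-h) (prop (s + h) (𝓕 (u (s + h)))) - prop (-h) (prop s (𝓕 (u s)))) := by
    rw [← map_sub]
    exact ((prop (-h)).restrictScalars ℝ).map_smul _ _
  simp only [Function.comp_apply]
  rw [e1, e2, e3, RCLike.re_eq_complex_re, RCLike.real_smul_eq_coe_smul (K := ℂ) h⁻¹]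
  simp only [inner_smul_right, inner_sub_right]
  generalize inner ℂ (prop s (𝓕 (u s))) (prop (-h) (prop (s + h) (𝓕 (u (s + h))))) = A
  generalize inner ℂ (prop s (𝓕 (u s))) (prop (-h) (prop s (𝓕 (u s)))) = B
  simp
  ring

theorem norm_sub_sq_le_prop (u : ℝ → L2) (s h : ℝ) :
    ‖u (s + h) - u s‖ ^ 2 ≤ 2 * ‖prop (s + h) (𝓕 (u (s + h))) - prop s (𝓕 (u s))‖ ^ 2 +
      2 * ‖prop (-h) (𝓕 (u s)) - 𝓕 (u s)‖ ^ 2 := by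
  set a := prop (s + h) (𝓕 (u (s + h))) - prop s (𝓕 (u s)) with ha
  set b := prop (-h) (𝓕 (u s)) - 𝓕 (u s) with hb
  have h1 : prop s (𝓕 (u (s + h) - u s)) = prop (-h) a + prop s b := by
    rw [ha, hb, map_sub, map_sub, prop_neg_prop_add, fourier_sub, map_sub, prop_prop (-h) s,
      prop_prop s (-h), add_comm (-h) s]
    abel
  have h2 : ‖u (s + h) - u s‖ ≤ ‖a‖ + ‖b‖ := by
    rw [← Lp.norm_fourier_eq (u (s + h) - u s), ← norm_prop s, h1, ← norm_prop (-h) a,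
      ← norm_prop s b]
    exact norm_add_le _ _
  have h3 : ‖u (s + h) - u s‖ ^ 2 ≤ (‖a‖ + ‖b‖) ^ 2 := by gcongr
  nlinarith [sq_nonneg (‖a‖ - ‖b‖)]

theorem IsHartreeSolution.tendsto_norm_sub_sq_div (hlam : 0 ≤ lam) (hw : IsPairKernel w)
    (hu : IsHartreeSolution (threeBody lam w) u₀ u) (h0 : sobolevNorm 1 u₀ ≠ ∞) (s : ℝ) :
    Tendsto (fun h : ℝ => ‖u (s + h) - u s‖ ^ 2 / h) (𝓝[>] 0) (𝓝 0) := by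
  have hsl := (hasDerivAt_iff_tendsto_slope_zero.1 (hu.hasDerivAt_prop hlam hw h0 s)).mono_left
    (nhdsWithin_mono _ (fun x (hx : 0 < x) => hx.ne') : 𝓝[>] (0 : ℝ) ≤ 𝓝[≠] 0)
  have hid : Tendsto (fun h : ℝ => 2 * h) (𝓝[>] 0) (𝓝 0) := by
    have : Continuous fun h : ℝ => 2 * h := by fun_prop
    simpa using (this.tendsto 0).mono_left nhdsWithin_le_nhds
  have h1 := (hid.mul (hsl.norm.pow 2)).add ((tendsto_norm_prop_neg_sub_sq_div
    (finiteKin_of_sobolevNorm (hu.sobolevNorm_ne_top h0 s))).const_mul 2)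
  rw [zero_mul, mul_zero, add_zero] at h1
  refine squeeze_zero' ?_ ?_ h1
  · filter_upwards [self_mem_nhdsWithin] with h (hh : 0 < h)
    positivity
  · filter_upwards [self_mem_nhdsWithin] with h (hh : 0 < h)
    rw [norm_smul, norm_inv, Real.norm_of_nonneg hh.le, div_le_iff₀ hh]
    refine (norm_sub_sq_le_prop u s h).trans (le_of_eq ?_)
    field_simp

/-- Uniformity in s is the point: this is the dominating bound for the remainder integral in
`IsHartreeSolution.energy_eq`. -/
theorem IsHartreeSolution.norm_sub_sq_le_mul (hlam : 0 ≤ lam) (hw : IsPairKernel w)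
    (hu : IsHartreeSolution (threeBody lam w) u₀ u) (h0 : sobolevNorm 1 u₀ ≠ ∞) {S R : ℝ}
    (hR : ∀ t ∈ Set.Icc (-S) S, H1Bound (u t) R) {s h : ℝ} (hs : s ∈ Set.Icc (-S) S)
    (hsh : s + h ∈ Set.Icc (-S) S) (hh : 0 < h) (h1 : h ≤ 1) :
    ‖u (s + h) - u s‖ ^ 2 ≤ (2 * (24 * lam * R ^ 5) ^ 2 + 4 * R ^ 2) * h := by
  have hm : ‖prop (s + h) (𝓕 (u (s + h))) - prop s (𝓕 (u s))‖ ≤ 24 * lam * R ^ 5 * ‖s + h - s‖ := by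
    refine Convex.norm_image_sub_le_of_norm_hasDerivWithin_le (s := Set.Icc (-S) S)
      (fun x _ => (hu.hasDerivAt_prop hlam hw h0 x).hasDerivWithinAt) (fun x hx => ?_)
      (convex_Icc _ _) hs hsh
    rw [norm_neg, norm_smul, Complex.norm_I, one_mul, norm_prop, Lp.norm_fourier_eq]
    exact norm_nonlin_le hlam hw (hR x hx)
  rw [add_sub_cancel_left, Real.norm_of_nonneg hh.le] at hm
  have hk := norm_prop_neg_sub_sq_le (hR s hs).finiteKin h
  rw [abs_of_pos hh] at hk
  have hkin := (hR s hs).kin_le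
  have hm2 : ‖prop (s + h) (𝓕 (u (s + h))) - prop s (𝓕 (u s))‖ ^ 2 ≤
      (24 * lam * R ^ 5) ^ 2 * h := by
    calc _ ≤ (24 * lam * R ^ 5 * h) ^ 2 := by gcongr
      _ = (24 * lam * R ^ 5) ^ 2 * (h * h) := by ring
      _ ≤ (24 * lam * R ^ 5) ^ 2 * (1 * h) := by gcongr
      _ = _ := by ring
  have hk2 : 2 * h * kin (u s) ≤ 2 * h * R ^ 2 := by gcongr
  have := norm_sub_sq_le_prop u s h
  nlinarith

theorem IsHartreeSolution.continuous_potEnergy (hlam : 0 ≤ lam) (hw : IsPairKernel w)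
    (hu : IsHartreeSolution (threeBody lam w) u₀ u) (h0 : sobolevNorm 1 u₀ ≠ ∞) :
    Continuous fun t => potEnergy (threeBody lam w) (u t) := by
  have h1 : ∀ t, potEnergy (threeBody lam w) (u t) =
      2 * (inner ℂ (u t) (nonlin (threeBody lam w) (u t))).re := fun t => by
    obtain ⟨R, hR⟩ := hu.exists_h1Bound h0 |t|
    rw [← RCLike.re_eq_complex_re,
      re_inner_self_nonlin hlam hw (hR t ⟨neg_abs_le t, le_abs_self t⟩)]
    ring
  simp_rw [h1]
  exact continuous_const.mul (Complex.continuous_re.comp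
    ((hu.continuous_L2 h0).inner (hu.continuous_nonlin hlam hw h0)))

/-- Only continuity of T is available. The shift moves onto the endpoints of the integral, where the
fundamental theorem of calculus applies. -/
theorem tendsto_integral_increment_div {T : ℝ → ℝ} (hT : Continuous T) (a b : ℝ) :
    Tendsto (fun h : ℝ => ∫ s in a..b, (T (s + h) - T s) / h) (𝓝[>] 0) (𝓝 (T b - T a)) := by
  have hI : ∀ x y : ℝ, IntervalIntegrable T volume x y := fun x y => hT.intervalIntegrable x y
  have hd : HasDerivAt (fun h => (∫ s in (0 : ℝ)..(b + h), T s) - ∫ s in (0 : ℝ)..(a + h), T s)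
      (T b - T a) 0 := by
    refine HasDerivAt.sub ?_ ?_
    · have := (hT.integral_hasStrictDerivAt 0 (b + 0)).hasDerivAt.comp_const_add b 0
      rwa [add_zero] at this
    · have := (hT.integral_hasStrictDerivAt 0 (a + 0)).hasDerivAt.comp_const_add a 0
      rwa [add_zero] at this
  have h1 := (hasDerivAt_iff_tendsto_slope_zero.1 hd).mono_left
    (nhdsWithin_mono _ (fun x (hx : 0 < x) => hx.ne') : 𝓝[>] (0 : ℝ) ≤ 𝓝[≠] 0)
  refine h1.congr fun h => ?_
  have hc : Continuous fun s => T (s + h) := hT.comp (by fun_prop)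
  rw [intervalIntegral.integral_div, intervalIntegral.integral_sub (hc.intervalIntegrable _ _)
    (hI _ _), intervalIntegral.integral_comp_add_right,
    intervalIntegral.integral_interval_sub_left (hI _ _) (hI _ _),
    intervalIntegral.integral_interval_sub_left (hI _ _) (hI _ _), smul_eq_mul, zero_add, add_zero,
    add_zero, div_eq_inv_mul]

/-- Conservation of energy. -/
theorem IsHartreeSolution.energy_eq (hlam : 0 ≤ lam) (hw : IsPairKernel w)
    (hu : IsHartreeSolution (threeBody lam w) u₀ u) (h0 : sobolevNorm 1 u₀ ≠ ∞) (a b : ℝ) :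
    kin (u b) + 1 / 6 * potEnergy (threeBody lam w) (u b) =
      kin (u a) + 1 / 6 * potEnergy (threeBody lam w) (u a) := by
  set V := threeBody lam w with hV
  obtain ⟨R, hR⟩ := hu.exists_h1Bound h0 (|a| + |b| + 1)
  set S := |a| + |b| + 1 with hS
  have huc := hu.continuous_L2 h0
  have hFc := hu.continuous_nonlin hlam hw h0
  have hTc := hu.continuous_potEnergy hlam hw h0
  have hmem : ∀ s ∈ Set.uIcc a b, ∀ h : ℝ, 0 ≤ h → h ≤ 1 → s + h ∈ Set.Icc (-S) S := by
    intro s hs h hh h1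
    rw [Set.uIcc, Set.mem_Icc] at hs
    have e1 : -(|a| + |b|) ≤ min a b := le_min (by linarith [neg_abs_le a, abs_nonneg b])
      (by linarith [neg_abs_le b, abs_nonneg a])
    have e2 : max a b ≤ |a| + |b| := max_le (by linarith [le_abs_self a, abs_nonneg b])
      (by linarith [le_abs_self b, abs_nonneg a])
    constructor <;> linarith [hs.1, hs.2]
  set J' : ℝ → ℝ → ℝ := fun h s => (inner ℂ (u s) (nonlin V (u (s + h)))).re -
    (inner ℂ (u (s + h)) (nonlin V (u s))).re with hJ'
  have hJ'c : ∀ h, Continuous (J' h) := fun h => by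
    have a1 : Continuous fun s => u (s + h) := huc.comp (by fun_prop)
    have a2 : Continuous fun s => nonlin V (u (s + h)) := hFc.comp (by fun_prop)
    exact (Complex.continuous_re.comp (huc.inner a2)).sub
      (Complex.continuous_re.comp (a1.inner hFc))
  have hTs : ∀ h, Continuous fun s => potEnergy V (u (s + h)) := fun h => hTc.comp (by fun_prop)
  -- By `abs_re_inner_nonlin_sub_le` the integrand is O(‖u(s+h) - u(s)‖²/h), which tends to 0 for
  -- each s and is uniformly bounded.
  have hrem : Tendsto (fun h : ℝ => ∫ s in a..b,
      (J' h s - 1 / 3 * (potEnergy V (u (s + h)) - potEnergy V (u s))) / h) (𝓝[>] 0) (𝓝 0) := by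
    have h1 : ∀ s ∈ Set.uIcc a b, ∀ h : ℝ, 0 < h → h ≤ 1 →
        ‖(J' h s - 1 / 3 * (potEnergy V (u (s + h)) - potEnergy V (u s))) / h‖ ≤
          100 * lam * R ^ 4 * (‖u (s + h) - u s‖ ^ 2 / h) := by
      intro s hs h hh h1
      have hs0 := hmem s hs 0 le_rfl zero_le_one
      rw [add_zero] at hs0
      have := abs_re_inner_nonlin_sub_le hlam hw (hR s hs0) (hR (s + h) (hmem s hs h hh.le h1))
      rw [norm_div, Real.norm_of_nonneg hh.le, ← mul_div_assoc]
      exact div_le_div_of_nonneg_right this hh.le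
    have hev : ∀ᶠ h : ℝ in 𝓝[>] 0, 0 < h ∧ h ≤ 1 := by
      filter_upwards [self_mem_nhdsWithin, mem_nhdsWithin_of_mem_nhds (Iic_mem_nhds zero_lt_one)]
        with h h1 h2 using ⟨h1, h2⟩
    have h2 := intervalIntegral.tendsto_integral_filter_of_dominated_convergence (μ := volume)
      (a := a) (b := b) (l := 𝓝[>] (0 : ℝ)) (f := fun _ => (0 : ℝ))
      (F := fun h s => (J' h s - 1 / 3 * (potEnergy V (u (s + h)) - potEnergy V (u s))) / h)
      (fun _ => 100 * lam * R ^ 4 * (2 * (24 * lam * R ^ 5) ^ 2 + 4 * R ^ 2))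
      (Eventually.of_forall fun h => ?_) ?_ intervalIntegrable_const
      (Eventually.of_forall fun s hs => ?_)
    · simpa using h2
    · exact (((hJ'c h).sub (continuous_const.mul ((hTs h).sub hTc))).div_const
        h).aestronglyMeasurable
    · filter_upwards [hev] with h hh
      refine Eventually.of_forall fun s hs => (h1 s (Set.uIoc_subset_uIcc hs) h hh.1 hh.2).trans ?_
      have hs' := Set.uIoc_subset_uIcc hs
      have hs0 := hmem s hs' 0 le_rfl zero_le_one
      rw [add_zero] at hs0
      gcongr
      rw [div_le_iff₀ hh.1]
      exact hu.norm_sub_sq_le_mul hlam hw h0 hR hs0 (hmem s hs' h hh.1.le hh.2) hh.1 hh.2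
    · have h3 := (hu.tendsto_norm_sub_sq_div hlam hw h0 s).const_mul (100 * lam * R ^ 4)
      rw [mul_zero] at h3
      exact squeeze_zero_norm'
        (hev.mono fun h hh => h1 s (Set.uIoc_subset_uIcc hs) h hh.1 hh.2) h3
  -- Writing P for the potential energy, the limit says that the increment of kin + P/2 is a third
  -- of the increment of P. Since 1/2 - 1/3 = 1/6, kin + P/6 is conserved.
  have hmain := hrem.add ((tendsto_integral_increment_div hTc a b).const_mul (1 / 3))
  have hcorr := (hu.tendsto_corr_div hlam hw h0 b).sub (hu.tendsto_corr_div hlam hw h0 a)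
  have heq : ∀ h : ℝ, (∫ s in a..b,
      (J' h s - 1 / 3 * (potEnergy V (u (s + h)) - potEnergy V (u s))) / h) +
      1 / 3 * ∫ s in a..b, (potEnergy V (u (s + h)) - potEnergy V (u s)) / h =
      (inner ℂ (u b) (Complex.I • u (b + h))).re / h -
        (inner ℂ (u a) (Complex.I • u (a + h))).re / h := fun h => by
    have c1 : Continuous fun s =>
        (J' h s - 1 / 3 * (potEnergy V (u (s + h)) - potEnergy V (u s))) / h :=
      ((hJ'c h).sub (continuous_const.mul ((hTs h).sub hTc))).div_const h
    have c2 : Continuous fun s => 1 / 3 * ((potEnergy V (u (s + h)) - potEnergy V (u s)) / h) :=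
      continuous_const.mul (((hTs h).sub hTc).div_const h)
    have h1 := intervalIntegral.integral_eq_sub_of_hasDerivAt
      (fun s _ => hu.hasDerivAt_corr hlam hw h0 h s) ((hJ'c h).intervalIntegrable a b)
    rw [← sub_div, ← h1, ← intervalIntegral.integral_const_mul, ← intervalIntegral.integral_div,
      ← intervalIntegral.integral_add (c1.intervalIntegrable _ _) (c2.intervalIntegrable _ _)]
    refine intervalIntegral.integral_congr fun s _ => ?_
    simp only [hJ']
    ring
  have := tendsto_nhds_unique (hmain.congr heq) hcorr
  linarith

end Energy

/-! ### Comparison of the two dynamics -/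

section Comparison

variable {lam : ℝ} {w : R3 → ℝ} {u₀ : L2} {u : ℝ → L2}

/-- A radius such that solutions with datum in the ball of radius `m` of `H¹` remain in the ball
of that radius. -/
def h1Radius (lam m : ℝ) : ℝ := √(m ^ 2 + 8 * lam * m ^ 6)

theorem IsHartreeSolution.h1Bound (hlam : 0 ≤ lam) (hw : IsPairKernel w)
    (hu : IsHartreeSolution (threeBody lam w) u₀ u) (h0 : sobolevNorm 1 u₀ ≠ ∞) {m : ℝ}
    (hm : (sobolevNorm 1 u₀).toReal ≤ m) (t : ℝ) : H1Bound (u t) (h1Radius lam m) := by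
  have hb := H1Bound.of_sobolevNorm h0 hm
  have hm0 := hb.nonneg
  have hpos : 0 ≤ m ^ 2 + 8 * lam * m ^ 6 := by positivity
  refine ⟨finiteKin_of_sobolevNorm (hu.sobolevNorm_ne_top h0 t), ?_, ?_⟩
  · rw [hu.norm_eq hlam hw h0]
    refine hb.norm_le.trans (Real.le_sqrt_of_sq_le ?_)
    have : 0 ≤ 8 * lam * m ^ 6 := by positivity
    linarith
  · rw [h1Radius, Real.sq_sqrt hpos]
    -- The potential energy at time t is nonnegative and can be dropped; at time 0 it is at most
    -- 48λm⁶, and 48/6 = 8.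
    have h1 := hu.energy_eq hlam hw h0 0 t
    rw [hu.initial] at h1
    linarith [potEnergy_nonneg hlam hw (u t), potEnergy_le hlam hw hb, hb.kin_le]

/-- The condition K ≥ 1 absorbs the factor 1/K in Gronwall's bound. -/
theorem norm_le_mul_exp_of_deriv_le_right {E : Type*} [NormedAddCommGroup E] [NormedSpace ℝ E]
    {f f' : ℝ → E} {K ε : ℝ} (hK : 1 ≤ K) (hε : 0 ≤ ε) (hf : ∀ t, HasDerivAt f (f' t) t)
    (h0 : f 0 = 0) (hb : ∀ t, ‖f' t‖ ≤ K * ‖f t‖ + ε) {t : ℝ} (ht : 0 ≤ t) :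
    ‖f t‖ ≤ ε * Real.exp (K * t) := by
  have h1 := norm_le_gronwallBound_of_norm_deriv_right_le (f := f) (f' := f') (δ := 0) (K := K)
    (ε := ε) (a := 0) (b := t) (fun x _ => (hf x).continuousAt.continuousWithinAt)
    (fun x _ => (hf x).hasDerivWithinAt) (by simp [h0]) (fun x _ => hb x) t ⟨ht, le_rfl⟩
  rw [gronwallBound_of_K_ne_0 (by linarith)] at h1
  simp only [zero_mul, zero_add, sub_zero] at h1
  refine h1.trans ?_
  have h2 : ε / K ≤ ε := div_le_self hε hK
  have h3 : 0 ≤ Real.exp (K * t) - 1 := by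
    have := Real.one_le_exp (x := K * t) (by positivity)
    linarith
  calc _ ≤ ε * (Real.exp (K * t) - 1) := by gcongr
    _ ≤ _ := by linarith

theorem norm_le_mul_exp_of_deriv_le {E : Type*} [NormedAddCommGroup E] [NormedSpace ℝ E]
    {f f' : ℝ → E} {K ε : ℝ} (hK : 1 ≤ K) (hε : 0 ≤ ε) (hf : ∀ t, HasDerivAt f (f' t) t)
    (h0 : f 0 = 0) (hb : ∀ t, ‖f' t‖ ≤ K * ‖f t‖ + ε) (t : ℝ) :
    ‖f t‖ ≤ ε * Real.exp (K * |t|) := by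
  rcases le_total 0 t with ht | ht
  · rw [abs_of_nonneg ht]
    exact norm_le_mul_exp_of_deriv_le_right hK hε hf h0 hb ht
  · have h1 := norm_le_mul_exp_of_deriv_le_right (f := fun s => f (-s)) (f' := fun s => -f' (-s))
      hK hε (fun s => by simpa [Function.comp_def] using (hf (-s)).scomp s (hasDerivAt_neg s))
      (by simpa using h0)
      (fun s => by rw [norm_neg]; exact hb (-s)) (t := -t) (by linarith)
    rw [neg_neg] at h1
    rwa [abs_of_nonpos ht]

theorem norm_sub_le_of_solutions (hlam : 0 ≤ lam) {m α : ℝ} (hα : 0 < α) {φ ϕ : ℝ → L2}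
    (h0 : sobolevNorm 1 u₀ ≠ ∞) (hm : (sobolevNorm 1 u₀).toReal ≤ m)
    (hφ : IsHartreeSolution (threeBody lam coulomb) u₀ φ)
    (hϕ : IsHartreeSolution (threeBody lam (cutCoulomb α)) u₀ ϕ) (t : ℝ) :
    ‖φ t - ϕ t‖ ≤ √(cutConst lam (h1Radius lam m) * α ^ 3) *
      Real.exp ((120 * lam * h1Radius lam m ^ 4 + 1) * |t|) := by
  have hwc := isPairKernel_coulomb
  have hwα := isPairKernel_cutCoulomb hα
  set R := h1Radius lam m with hR
  have hR0 : 0 ≤ R := Real.sqrt_nonneg _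
  have hb1 := hφ.h1Bound hlam hwc h0 hm
  have hb2 := hϕ.h1Bound hlam hwα h0 hm
  have hn : ∀ s, ‖prop s (𝓕 (φ s)) - prop s (𝓕 (ϕ s))‖ = ‖φ s - ϕ s‖ := fun s => by
    rw [← map_sub, norm_prop, ← fourier_sub, Lp.norm_fourier_eq]
  rw [← hn]
  refine norm_le_mul_exp_of_deriv_le (f := fun s => prop s (𝓕 (φ s)) - prop s (𝓕 (ϕ s)))
    (le_add_of_nonneg_left (by positivity)) (Real.sqrt_nonneg _)
    (fun s => (hφ.hasDerivAt_prop hlam hwc h0 s).sub (hϕ.hasDerivAt_prop hlam hwα h0 s))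
    (by rw [hφ.initial, hϕ.initial, sub_self]) (fun s => ?_) t
  rw [hn]
  set F1 := nonlin (threeBody lam coulomb) (φ s)
  set F2 := nonlin (threeBody lam (cutCoulomb α)) (ϕ s)
  -- Passing through F_α(φ) separates the two sources of error: one function with two potentials,
  -- then two functions with one potential.
  set F3 := nonlin (threeBody lam (cutCoulomb α)) (φ s)
  have e1 : ‖-(Complex.I • prop s (𝓕 F1)) - -(Complex.I • prop s (𝓕 F2))‖ = ‖F1 - F2‖ := by
    rw [neg_sub_neg, ← smul_sub, norm_smul, Complex.norm_I, one_mul, ← map_sub, norm_prop,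
      ← fourier_sub, Lp.norm_fourier_eq, norm_sub_rev]
  have e2 : ‖F1 - F3‖ ≤ √(cutConst lam R * α ^ 3) :=
    Real.le_sqrt_of_sq_le (norm_nonlin_sub_cut_sq_le hlam (hb1 s) hα)
  have e3 : ‖F3 - F2‖ ≤ 120 * lam * R ^ 4 * ‖φ s - ϕ s‖ :=
    norm_nonlin_sub_le hlam hwα (hb1 s) (hb2 s)
  rw [e1]
  calc ‖F1 - F2‖ ≤ ‖F1 - F3‖ + ‖F3 - F2‖ := norm_sub_le_norm_sub_add_norm_sub _ _ _
    _ ≤ _ := by linarith [norm_nonneg (φ s - ϕ s)]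

/-- For α ≤ 1 the exponent 3/2 may be lowered to p. For α ≥ 1, which a negative η permits, the
cut-off estimate is too weak, and conservation of mass gives 2m ≤ 2mα^p. -/
theorem norm_sub_le_rpow_of_solutions (hlam : 0 ≤ lam) {m α p : ℝ} (hα : 0 < α) (hp : 0 ≤ p)
    (hp2 : p ≤ 3 / 2) {φ ϕ : ℝ → L2}
    (h0 : sobolevNorm 1 u₀ ≠ ∞) (hm : (sobolevNorm 1 u₀).toReal ≤ m)
    (hφ : IsHartreeSolution (threeBody lam coulomb) u₀ φ)
    (hϕ : IsHartreeSolution (threeBody lam (cutCoulomb α)) u₀ ϕ) (t : ℝ) :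
    ‖φ t - ϕ t‖ ≤ (√(cutConst lam (h1Radius lam m)) + 2 * m) * α ^ p *
      Real.exp ((120 * lam * h1Radius lam m ^ 4 + 1) * |t|) := by
  have hm0 : 0 ≤ m := ENNReal.toReal_nonneg.trans hm
  have hR0 : 0 ≤ h1Radius lam m := Real.sqrt_nonneg _
  have hαp : 0 < α ^ p := Real.rpow_pos_of_pos hα p
  rcases le_total α 1 with h1 | h1
  · refine (norm_sub_le_of_solutions hlam hα h0 hm hφ hϕ t).trans ?_
    gcongr
    have h2 : √(α ^ 3) = α ^ (3 / 2 : ℝ) := by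
      rw [Real.sqrt_eq_rpow, ← Real.rpow_natCast, ← Real.rpow_mul hα.le]
      norm_num
    rw [Real.sqrt_mul (cutConst_nonneg _ _), h2]
    have h3 : α ^ (3 / 2 : ℝ) ≤ α ^ p := Real.rpow_le_rpow_of_exponent_ge hα h1 hp2
    calc _ ≤ √(cutConst lam (h1Radius lam m)) * α ^ p := by gcongr
      _ ≤ _ := by gcongr; linarith
  · have h2 : ‖φ t - ϕ t‖ ≤ 2 * m := by
      refine (norm_sub_le _ _).trans ?_
      rw [hφ.norm_eq hlam isPairKernel_coulomb h0,
        hϕ.norm_eq hlam (isPairKernel_cutCoulomb hα) h0]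
      linarith [(norm_le_toReal_sobolevNorm h0).trans hm]
    have h3 : 1 ≤ α ^ p := Real.one_le_rpow h1 hp
    have h4 : 1 ≤ Real.exp ((120 * lam * h1Radius lam m ^ 4 + 1) * |t|) :=
      Real.one_le_exp (by positivity)
    have h5 : 0 ≤ √(cutConst lam (h1Radius lam m)) := Real.sqrt_nonneg _
    calc ‖φ t - ϕ t‖ ≤ (√(cutConst lam (h1Radius lam m)) + 2 * m) * 1 * 1 := by linarith
      _ ≤ _ := by gcongr

/-- The exponent -pη falls short of the stated one by exactly 1/2, and N ≥ 1. -/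
theorem rpow_le_rpow_cutoff {α η p : ℝ} {N : ℕ} (hN : 1 ≤ N) (hα : 0 < α)
    (h : α ≤ (N : ℝ) ^ (-η)) (hp : 0 ≤ p) : α ^ p ≤ (N : ℝ) ^ ((1 - 2 * p * η) / 2) := by
  have hN' : (1 : ℝ) ≤ N := by exact_mod_cast hN
  calc α ^ p ≤ ((N : ℝ) ^ (-η)) ^ p := Real.rpow_le_rpow hα.le h hp
    _ = (N : ℝ) ^ (-η * p) := (Real.rpow_mul (by positivity) _ _).symm
    _ ≤ _ := Real.rpow_le_rpow_of_exponent_le hN' (by linarith)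

theorem exists_rate (lam : ℝ) (hlam : 0 < lam) (s p M : ℝ) (hs : 1 ≤ s) (hp : 0 ≤ p)
    (hp2 : p ≤ 3 / 2) :
    ∃ C K : ℝ, ∀ φ₀ : L2, sobolevNorm s φ₀ ≤ ENNReal.ofReal M →
      ∀ (η : ℝ) (N : ℕ) (α : ℝ), 1 ≤ N → 0 < α → α ≤ (N : ℝ) ^ (-η) →
      ∀ φ ϕ : ℝ → L2, IsHartreeSolution (threeBody lam coulomb) φ₀ φ →
        IsHartreeSolution (threeBody lam (cutCoulomb α)) φ₀ ϕ → ∀ t : ℝ,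
        ‖φ t - ϕ t‖ ≤ C * (N : ℝ) ^ ((1 - 2 * p * η) / 2) * Real.exp (K * |t|) ∧
        (‖φ₀‖ = 1 → ∀ k : ℕ, traceNorm (projTensor (φ t) k - projTensor (ϕ t) k) ≤
          ENNReal.ofReal (C * k * (N : ℝ) ^ ((1 - 2 * p * η) / 2) * Real.exp (K * |t|))) := by
  -- `ENNReal.ofReal M` sees only the positive part of M.
  set m := max M 0
  set C := √(cutConst lam (h1Radius lam m)) + 2 * m with hC
  set K := 120 * lam * h1Radius lam m ^ 4 + 1
  have hC0 : 0 ≤ C := by have : 0 ≤ m := le_max_right _ _; positivity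
  -- The factor 2 is the one in the trace norm bound 2k‖φ - ϕ‖.
  refine ⟨2 * C, K, fun φ₀ hφ₀ η N α hN hα hαN φ ϕ hφ hϕ t => ?_⟩
  have h1 : sobolevNorm 1 φ₀ ≤ ENNReal.ofReal M := (sobolevNorm_mono hs φ₀).trans hφ₀
  have h0 : sobolevNorm 1 φ₀ ≠ ∞ := (h1.trans_lt ENNReal.ofReal_lt_top).ne
  have hm : (sobolevNorm 1 φ₀).toReal ≤ m := by
    have := ENNReal.toReal_mono ENNReal.ofReal_ne_top h1
    rwa [ENNReal.toReal_ofReal'] at this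
  have hd : ‖φ t - ϕ t‖ ≤ C * (N : ℝ) ^ ((1 - 2 * p * η) / 2) * Real.exp (K * |t|) := by
    refine (norm_sub_le_rpow_of_solutions hlam.le hα hp hp2 h0 hm hφ hϕ t).trans ?_
    gcongr
    exact rpow_le_rpow_cutoff hN hα hαN hp
  refine ⟨?_, fun hn k => ?_⟩
  · linarith [norm_nonneg (φ t - ϕ t)]
  · refine (traceNorm_projTensor_sub ?_ ?_ k).trans (ENNReal.ofReal_le_ofReal ?_)
    · rw [hφ.norm_eq hlam.le isPairKernel_coulomb h0, hn]
    · rw [hϕ.norm_eq hlam.le (isPairKernel_cutCoulomb hα) h0, hn]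
    · calc 2 * k * ‖φ t - ϕ t‖ ≤
          2 * k * (C * (N : ℝ) ^ ((1 - 2 * p * η) / 2) * Real.exp (K * |t|)) := by gcongr
        _ = _ := by ring

end Comparison

end QuinticHartree

end

theorem mainTheorem5 (lam : ℝ) (hlam : 0 < lam) (a : ℝ) (M : ℝ) :
    (0 ≤ a → a < 1 / 2 →
      ∃ C K : ℝ, ∀ φ₀ : QuinticHartree.L2,
        QuinticHartree.MemH (3 / 2 + a) φ₀ →
        QuinticHartree.sobolevNorm (3 / 2 + a) φ₀ ≤ ENNReal.ofReal M →
        ∀ (η : ℝ) (N : ℕ) (α : ℝ), 1 ≤ N → 0 < α → α ≤ (N : ℝ) ^ (-η) →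
        ∀ φ ϕ : ℝ → QuinticHartree.L2,
          QuinticHartree.IsHartreeSolution
            (QuinticHartree.threeBody lam QuinticHartree.coulomb) φ₀ φ →
          QuinticHartree.IsHartreeSolution
            (QuinticHartree.threeBody lam (QuinticHartree.cutCoulomb α)) φ₀ ϕ →
          ∀ t : ℝ,
            ‖φ t - ϕ t‖ ≤ C * (N : ℝ) ^ ((1 - η * (1 + 2 * a)) / 2) * Real.exp (K * |t|) ∧
            (‖φ₀‖ = 1 → ∀ k : ℕ,
              QuinticHartree.traceNorm
                  (QuinticHartree.projTensor (φ t) k - QuinticHartree.projTensor (ϕ t) k) ≤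
                ENNReal.ofReal
                  (C * k * (N : ℝ) ^ ((1 - η * (1 + 2 * a)) / 2) * Real.exp (K * |t|)))) ∧
    (1 < a →
      ∃ C K : ℝ, ∀ φ₀ : QuinticHartree.L2,
        QuinticHartree.MemH (3 / 2 + a) φ₀ →
        QuinticHartree.sobolevNorm (3 / 2 + a) φ₀ ≤ ENNReal.ofReal M →
        ∀ (η : ℝ) (N : ℕ) (α : ℝ), 1 ≤ N → 0 < α → α ≤ (N : ℝ) ^ (-η) →
        ∀ φ ϕ : ℝ → QuinticHartree.L2,
          QuinticHartree.IsHartreeSolution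
            (QuinticHartree.threeBody lam QuinticHartree.coulomb) φ₀ φ →
          QuinticHartree.IsHartreeSolution
            (QuinticHartree.threeBody lam (QuinticHartree.cutCoulomb α)) φ₀ ϕ →
          ∀ t : ℝ,
            ‖φ t - ϕ t‖ ≤ C * (N : ℝ) ^ ((1 - 3 * η) / 2) * Real.exp (K * |t|) ∧
            (‖φ₀‖ = 1 → ∀ k : ℕ,
              QuinticHartree.traceNorm
                  (QuinticHartree.projTensor (φ t) k - QuinticHartree.projTensor (ϕ t) k) ≤
                ENNReal.ofReal
                  (C * k * (N : ℝ) ^ ((1 - 3 * η) / 2) * Real.exp (K * |t|)))) := by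
  refine ⟨fun ha ha2 => ?_, fun ha => ?_⟩
  -- The choice p = 1/2 + a makes 2p = 1 + 2a, and a < 1/2 keeps p below 3/2.
  · obtain ⟨C, K, h⟩ := QuinticHartree.exists_rate lam hlam (3 / 2 + a) (1 / 2 + a) M
      (by linarith) (by linarith) (by linarith)
    have he : ∀ η : ℝ, (1 - η * (1 + 2 * a)) / 2 = (1 - 2 * (1 / 2 + a) * η) / 2 := fun η => by
      ring
    simp_rw [he]
    exact ⟨C, K, fun φ₀ _ => h φ₀⟩
  -- Here p = 3/2 is the full power of α provided by the cut-off estimate.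
  · obtain ⟨C, K, h⟩ := QuinticHartree.exists_rate lam hlam (3 / 2 + a) (3 / 2) M
      (by linarith) (by linarith) le_rfl
    have he : ∀ η : ℝ, (1 - 3 * η) / 2 = (1 - 2 * (3 / 2) * η) / 2 := fun η => by ring
    simp_rw [he]
    exact ⟨C, K, fun φ₀ _ => h φ₀⟩
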